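/- Conventions. Let $M=\mathbb T^2=\mathbb R^2/\mathbb Z^2$ with coordinates $(\theta,r)$, normalized Lebesgue measure $\mu$ on $M$ and $\lambda$ on the circle, projections $\pi_\theta,\pi_r$, and $R_\alpha(\theta,r)=(\theta+\alpha,r)$. Let $\mathbb PTM=M\times\mathbb P\mathbb R^2$ be the projectivized tangent bundle, $\pi_M$ its projection to $M$, and write $t\in\mathbb R/\mathbb Z$ for the line spanned by $(\cos \pi t,\sin\pi t)$. For a diffeomorphism $f$ of $M$, $(f,\mathrm df)$ denotes its projectivized derivative extension to $\mathbb PTM$. Parameters. Let $n,k,q,q'\ge 1$ and $p'$ be integers ($k=k_n$, $q=q_n$, $p'/q'=p_{n+1}/q_{n+1}=\alpha_{n+1}$) with $k\ge 20n^5$, $q^{1/4}>2k$, $q'>2k^{12}q^2$ and $\gcd(p',q')=1$. Put $T_j=[\frac jk,\frac{j+1}k]\subset\mathbb P\mathbb R^2$ for $0\le j<k$. Conjugation map. Let $\tilde\phi$ be an area-preserving $C^\infty$ diffeomorphism of $\mathbb T^2$, commuting with $R_{1/q}$, whose lift to $\mathbb R^2$ satisfies, for all $l,v\in\mathbb Z$: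 it maps the column $[\frac{l}{2kq},\frac{l+1}{2kq}]\times[v,v+1]$ onto itself; with $\varepsilon=\frac1{2k^5}$ it is the identity on the part of the column outside $[\frac{l+\varepsilon}{2kq},\frac{l+1-\varepsilon}{2kq}]\times[v+\varepsilon,v+1-\varepsilon]$; and with $\varepsilon_2=\frac1{4n^5k^{10}}$, for all integers $1\le t_1,t_2\le k^5-2$, on $$\Big[\tfrac{l}{2kq}+\tfrac{t_1+2\varepsilon_2}{2k^6q},\tfrac{l}{2kq}+\tfrac{t_1+1-2\varepsilon_2}{2k^6q}\Big]\times\Big[v+\tfrac{t_2+2\varepsilon_2}{k^5},v+\tfrac{t_2+1-2\varepsilon_2}{k^5}\Big]$$ it is the translation onto the rectangle of the same form with $(t_1,t_2)$ replaced by $(k^5-t_2-1,t_1)$. Let $a=2k^{11}q$, $b=2kq$, $c=k^5$, $\epsilon=\frac1{2n^5k^{11}}$, and let $i$ be an area-preserving $C^\infty$ diffeomorphism of $\mathbb T^2$, commuting with $R_{1/q}$, whose lift to $\mathbb R^2$ satisfies: for all $u,v\in\mathbb Z$ it maps the square $[\frac ua,\frac{u+1}a]\times[\frac va,\frac{v+1}a]$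 onto itself and is the identity on the part of it outside $[\frac{u+\epsilon}a,\frac{u+1-\epsilon}a]\times[\frac{v+\epsilon}a,\frac{v+1-\epsilon}a]$; and for all integers $l,v$, $0\le u<a/b$, $1\le s_1,s_2\le c-2$, on the square $$\Big[\tfrac lb+\tfrac ua+\tfrac{s_1+2\epsilon}{ac},\tfrac lb+\tfrac ua+\tfrac{s_1+1-2\epsilon}{ac}\Big]\times\Big[\tfrac va+\tfrac{s_2+2\epsilon}{ac},\tfrac va+\tfrac{s_2+1-2\epsilon}{ac}\Big]$$ it is the composition of the rotation by $\frac{s\pi}{k}$, $s\in\{0,\dots,k-1\}$, $s\equiv l \bmod k$, and a translation. Let $\phi$ be $i\circ\tilde\phi$ on $[\frac{2u}{2q},\frac{2u+1}{2q}]\times\mathbb T$ and the identity on $[\frac{2u+1}{2q},\frac{2u+2}{2q}]\times\mathbb T$, $0\le u<q$. Let $$m=\min\Big\{m\le q' : \inf_{j\in\mathbb Z}\Big|m\tfrac{q\,p'}{q'}-\tfrac12+j\Big|\le\tfrac q{q'}\Big\},\qquad \Phi=\phi\circ R_{p'/q'}^{m}\circ\phi^{-1}.$$ Partial partition. For $0\le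 u_0\le 2q-1$, $0\le u_1\le k-1$, $1\le v_0\le k^5-2$ let $\tilde I^{u_0,u_1}_{v_0}\subset M$ be the union, over $1\le u_2,u_3,u_4,v_2\le k^5-2$ and $2q\le v_1\le 2k^6q-2q-1$, of the squares $[x+\kappa,\,x+\frac1{2k^{16}q}-\kappa]\times[y+\kappa,\,y+\frac1{2k^{16}q}-\kappa]$ with $\kappa=\frac1{4n^5k^{26}q}$, $x=\frac{u_0}{2q}+\frac{u_1}{2kq}+\frac{u_2}{2k^6q}+\frac{u_3}{2k^{11}q}+\frac{u_4}{2k^{16}q}$, $y=\frac{v_0}{k^5}+\frac{v_1}{2k^{11}q}+\frac{v_2}{2k^{16}q}$. Let $\hat\eta$ consist of the sets $\hat I_{u_0,v_0,j}=\tilde I^{u_0}_{v_0}\times T_j$, $\tilde I^{u_0}_{v_0}=\bigcup_{u_1}\tilde I^{u_0,u_1}_{v_0}$, $0\le j<k$. Number the segments of $\tilde I^{u_0}_{v_0}$ as $\tilde I_l$, $0\le l<k$, where $\tilde I_l=\tilde I^{u_0,u_1}_{v_0}$ with $u_1=l$ if $u_0$ is odd and $u_1\equiv -l\bmod k$ if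 $u_0$ is even. Statement. $(\Phi,\mathrm d\Phi)$ is $(\gamma,\delta,\varepsilon_1,\varepsilon_2)$-distributing every element $\hat I_{u_0,v_0,j}$ of $\hat\eta$ with $\gamma=\frac1{2k^5q}$, $\delta=\frac1{k^4}$, $\varepsilon_1=\varepsilon_2=\frac1{n^5}$. That is, for all $u_0,v_0$ there are measurable sets $J_l$ ($0\le l<k$) such that 1. $J_l\subseteq\pi_r(\Phi(\tilde I_l))$ and $1-\delta\le\lambda(J_l)\le1$ for every $l$; 2. for every $l$ there is $c_l\in\mathbb T$ with $\Phi(\tilde I_l)\subseteq[c_l,c_l+\gamma]\times\mathbb T$; 3. for every $l$ and every measurable $\tilde J\subseteq J_l$, $\left|\frac{\mu(\tilde I_l\cap\Phi^{-1}(\mathbb T\times\tilde J))}{\mu(\tilde I_l)}-\frac{\lambda(\tilde J)}{\lambda(J_l)}\right|\le\varepsilon_1\frac{\lambda(\tilde J)}{\lambda(J_l)}$; 4. for all $j,t\in\{0,\dots,k-1\}$ there is a unique $l\in\{0,\dots,k-1\}$ with $t\equiv l+j\bmod k$, and for this $l$ and every measurable $\tilde J\subseteq J_l$, $$\left|\frac{\mu\big(\pi_M\big((\tilde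 I_l\times T_j)\cap(\Phi,\mathrm d\Phi)^{-1}(\mathbb T\times\tilde J\times T_t)\big)\big)}{\mu(\tilde I_l)}-\frac{\lambda(\tilde J)}{\lambda(J_l)}\right|\le\varepsilon_2\frac{\lambda(\tilde J)}{\lambda(J_l)}.$$ -/

import Mathlib

open MeasureTheory Set
open scoped ContDiff LinearAlgebra.Projectivization

noncomputable section

namespace TorusAbC

/-! ### The torus, its diffeomorphisms, and the projectivized tangent bundle -/

/-- The two-torus with coordinates `(θ, r)`; `volume` is the normalized Lebesgue measure. -/
abbrev Torus : Type := UnitAddCircle × UnitAddCircle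

/-- The projectivized tangent bundle of the torus, in the standard trivialization. -/
abbrev PTM : Type := Torus × ℙ ℝ (ℝ × ℝ)

/-- The covering map from the plane to the torus. -/
def proj (x : ℝ × ℝ) : Torus := ((x.1 : UnitAddCircle), (x.2 : UnitAddCircle))

/-- The representative in `[0,1)²` of a point of the torus. -/
def rep (p : Torus) : ℝ × ℝ :=
  ((AddCircle.equivIco (1 : ℝ) 0 p.1 : ℝ), (AddCircle.equivIco (1 : ℝ) 0 p.2 : ℝ))

theorem proj_rep (p : Torus) : proj (rep p) = p :=
  Prod.ext (AddCircle.coe_equivIco (p := (1 : ℝ)) (a := 0))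
    (AddCircle.coe_equivIco (p := (1 : ℝ)) (a := 0))

/-- Lifts to the plane of the smooth diffeomorphisms of the torus that are homotopic to the
identity, as a group under composition. -/
def TorusDiff : Subgroup (Equiv.Perm (ℝ × ℝ)) where
  carrier := {f | ContDiff ℝ ∞ (f : ℝ × ℝ → ℝ × ℝ) ∧
    ContDiff ℝ ∞ ((f⁻¹ : Equiv.Perm (ℝ × ℝ)) : ℝ × ℝ → ℝ × ℝ) ∧
    ∀ (x : ℝ × ℝ) (a b : ℤ), f (x + ((a : ℝ), (b : ℝ))) = f x + ((a : ℝ), (b : ℝ))}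
  mul_mem' := by
    rintro f g ⟨hf1, hf2, hf3⟩ ⟨hg1, hg2, hg3⟩
    refine ⟨?_, ?_, ?_⟩
    · rw [Equiv.Perm.coe_mul]; exact hf1.comp hg1
    · rw [mul_inv_rev, Equiv.Perm.coe_mul]; exact hg2.comp hf2
    · intro x a b
      rw [Equiv.Perm.mul_apply, Equiv.Perm.mul_apply, hg3, hf3]
  one_mem' := by
    refine ⟨?_, ?_, fun x a b => rfl⟩
    · rw [Equiv.Perm.coe_one]; exact contDiff_id
    · rw [inv_one, Equiv.Perm.coe_one]; exact contDiff_id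
  inv_mem' := by
    rintro f ⟨hf1, hf2, hf3⟩
    refine ⟨hf2, by rw [inv_inv]; exact hf1, ?_⟩
    intro x a b
    apply f.injective
    have e : ∀ y, f (f⁻¹ y) = y := fun y => f.apply_symm_apply y
    rw [hf3, e, e]

/-- A lift, as a map of the plane. -/
def lift (f : TorusDiff) : ℝ × ℝ → ℝ × ℝ := fun x => (f : Equiv.Perm (ℝ × ℝ)) x

/-- The map of the torus that a lift induces. -/
def torusMap (f : TorusDiff) : Torus → Torus := fun p => proj (lift f (rep p))

theorem exists_rep_proj (x : ℝ × ℝ) :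
    ∃ a b : ℤ, rep (proj x) = x + ((a : ℝ), (b : ℝ)) := by
  have key : ∀ t : ℝ, ∃ a : ℤ,
      (AddCircle.equivIco (1 : ℝ) 0 ((t : ℝ) : UnitAddCircle) : ℝ) = t + a := by
    intro t
    have h : (((AddCircle.equivIco (1 : ℝ) 0 ((t : ℝ) : UnitAddCircle) : ℝ)) : UnitAddCircle)
        = ((t : ℝ) : UnitAddCircle) := AddCircle.coe_equivIco (p := (1 : ℝ)) (a := 0)
    rw [← sub_eq_zero, ← AddCircle.coe_sub, AddCircle.coe_eq_zero_iff] at h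
    obtain ⟨a, ha⟩ := h
    refine ⟨a, ?_⟩
    rw [zsmul_eq_mul, mul_one] at ha
    linarith
  obtain ⟨a, ha⟩ := key x.1
  obtain ⟨b, hb⟩ := key x.2
  exact ⟨a, b, Prod.ext ha hb⟩

theorem proj_add_int (x : ℝ × ℝ) (a b : ℤ) : proj (x + ((a : ℝ), (b : ℝ))) = proj x := by
  have key : ∀ (t : ℝ) (a : ℤ), ((t + a : ℝ) : UnitAddCircle) = ((t : ℝ) : UnitAddCircle) := by
    intro t a
    rw [← sub_eq_zero, ← AddCircle.coe_sub, AddCircle.coe_eq_zero_iff]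
    exact ⟨a, by simp⟩
  exact Prod.ext (key x.1 a) (key x.2 b)

/-- `torusMap f` is the map covered by the lift `f`. -/
theorem torusMap_proj (f : TorusDiff) (x : ℝ × ℝ) : torusMap f (proj x) = proj (lift f x) := by
  obtain ⟨a, b, h⟩ := exists_rep_proj x
  unfold torusMap
  rw [h]
  unfold lift
  rw [f.2.2.2, proj_add_int]

theorem differentiable_lift (f : TorusDiff) : Differentiable ℝ (lift f) :=
  ContDiff.differentiable f.2.1 (by simp)

theorem fderiv_lift_injective (f : TorusDiff) (x : ℝ × ℝ) :
    Function.Injective (fderiv ℝ (lift f) x : ℝ × ℝ →ₗ[ℝ] ℝ × ℝ) := by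
  have hcomp : (lift f⁻¹) ∘ (lift f) = id := by
    funext y
    exact Equiv.symm_apply_apply (f : Equiv.Perm (ℝ × ℝ)) y
  have h := fderiv_comp x (differentiable_lift f⁻¹ (lift f x)) (differentiable_lift f x)
  rw [hcomp, fderiv_id] at h
  intro v w hvw
  have hv := congrArg (fun L : ℝ × ℝ →L[ℝ] ℝ × ℝ => L v) h
  have hw := congrArg (fun L : ℝ × ℝ →L[ℝ] ℝ × ℝ => L w) h
  simp only [ContinuousLinearMap.id_apply, ContinuousLinearMap.comp_apply] at hv hw
  have hvw' : fderiv ℝ (lift f) x v = fderiv ℝ (lift f) x w := hvw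
  rw [hv, hw, hvw']

/-- The projectivized derivative extension `(f, df)`. -/
def derivExt (f : TorusDiff) : PTM → PTM := fun z =>
  (torusMap f z.1,
    Projectivization.map (fderiv ℝ (lift f) (rep z.1) : ℝ × ℝ →ₗ[ℝ] ℝ × ℝ)
      (fderiv_lift_injective f (rep z.1)) z.2)

theorem direction_ne_zero (t : ℝ) : (Real.cos (Real.pi * t), Real.sin (Real.pi * t)) ≠ 0 := by
  intro h
  have h1 : Real.cos (Real.pi * t) = 0 := congrArg Prod.fst h
  have h2 : Real.sin (Real.pi * t) = 0 := congrArg Prod.snd h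
  have := Real.sin_sq_add_cos_sq (Real.pi * t)
  rw [h1, h2] at this
  norm_num at this

/-- The line with spherical coordinate `π t ∈ ℝ / π ℤ`. -/
def direction (t : ℝ) : ℙ ℝ (ℝ × ℝ) :=
  Projectivization.mk ℝ (Real.cos (Real.pi * t), Real.sin (Real.pi * t)) (direction_ne_zero t)

/-- The tangent interval `T_j = [j/k, (j+1)/k]`. -/
def tangentInterval (k j : ℕ) : Set (ℙ ℝ (ℝ × ℝ)) :=
  direction '' Icc ((j : ℝ) / k) (((j : ℝ) + 1) / k)

/-- The rotation by `α` in the `θ`-direction. -/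
def rot (α : ℝ) : TorusDiff :=
  ⟨Equiv.addRight ((α, 0) : ℝ × ℝ), by
    refine ⟨?_, ?_, ?_⟩
    · exact contDiff_id.add contDiff_const
    · have : (((Equiv.addRight ((α, 0) : ℝ × ℝ))⁻¹ : Equiv.Perm (ℝ × ℝ)) : ℝ × ℝ → ℝ × ℝ)
          = fun x => x - (α, 0) := by
        funext x
        rw [Equiv.Perm.inv_eq_iff_eq]
        simp
      rw [this]
      exact contDiff_id.sub contDiff_const
    · intro x a b
      simp only [Equiv.coe_addRight]
      abel⟩

/-! ### The notion of distribution -/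

/-- `(Φ, dΦ)` is `(γ, δ, ε₁, ε₂)`-distributing the elements `(⋃ l < k, I l) × T_j`, `j < k`,
where `I 0, …, I (k-1)` are the segments of an element of a partial partition of the torus.
(The last condition speaks of all `j` at once, so `j` is not a parameter.) -/
def IsDistributing (γ δ ε₁ ε₂ : ℝ) (k : ℕ) (Φ : TorusDiff) (I : ℕ → Set Torus) : Prop :=
  ∃ J : ℕ → Set UnitAddCircle,
    (∀ l < k, MeasurableSet (J l) ∧ J l ⊆ Prod.snd '' (torusMap Φ '' I l) ∧
      1 - δ ≤ volume.real (J l) ∧ volume.real (J l) ≤ 1) ∧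
    (∀ l < k, ∃ c : UnitAddCircle,
      torusMap Φ '' I l ⊆ ((fun s : ℝ => c + (s : UnitAddCircle)) '' Icc 0 γ) ×ˢ univ) ∧
    (∀ l < k, ∀ J' : Set UnitAddCircle, MeasurableSet J' → J' ⊆ J l →
      |volume.real (I l ∩ torusMap Φ ⁻¹' (univ ×ˢ J')) / volume.real (I l)
          - volume.real J' / volume.real (J l)|
        ≤ ε₁ * (volume.real J' / volume.real (J l))) ∧
    (∀ j < k, ∀ t < k, ∃ l < k, t ≡ l + j [MOD k] ∧
      (∀ l' < k, t ≡ l' + j [MOD k] → l' = l) ∧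
      ∀ J' : Set UnitAddCircle, MeasurableSet J' → J' ⊆ J l →
        |volume.real (Prod.fst '' ((I l ×ˢ tangentInterval k j) ∩
              derivExt Φ ⁻¹' ((univ ×ˢ J') ×ˢ tangentInterval k t))) / volume.real (I l)
            - volume.real J' / volume.real (J l)|
          ≤ ε₂ * (volume.real J' / volume.real (J l)))

/-! ### The partial partition -/

/-- The small squares that the partition is made of, in the plane. -/
def smallSquare (n k q u₀ u₁ u₂ u₃ u₄ v₀ v₁ v₂ : ℕ) : Set (ℝ × ℝ) :=
  Icc ((u₀ : ℝ) / (2 * q) + u₁ / (2 * k * q) + u₂ / (2 * k ^ 6 * q) + u₃ / (2 * k ^ 11 * q)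
        + u₄ / (2 * k ^ 16 * q) + 1 / (4 * n ^ 5 * k ^ 26 * q))
      ((u₀ : ℝ) / (2 * q) + u₁ / (2 * k * q) + u₂ / (2 * k ^ 6 * q) + u₃ / (2 * k ^ 11 * q)
        + (u₄ + 1) / (2 * k ^ 16 * q) - 1 / (4 * n ^ 5 * k ^ 26 * q)) ×ˢ
  Icc ((v₀ : ℝ) / k ^ 5 + v₁ / (2 * k ^ 11 * q) + v₂ / (2 * k ^ 16 * q)
        + 1 / (4 * n ^ 5 * k ^ 26 * q))
      ((v₀ : ℝ) / k ^ 5 + v₁ / (2 * k ^ 11 * q) + (v₂ + 1) / (2 * k ^ 16 * q)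
        - 1 / (4 * n ^ 5 * k ^ 26 * q))

/-- The set `Ĩ^{u₀,u₁}_{v₀}` on the torus. Its indices run over
`1 ≤ u₂, u₃, u₄, v₂ ≤ k⁵ - 2` and `2q ≤ v₁ ≤ 2k⁶q - 2q - 1`. -/
def tildeSegment (n k q u₀ v₀ u₁ : ℕ) : Set Torus :=
  {p | ∃ u₂ u₃ u₄ v₁ v₂ : ℕ,
    (1 ≤ u₂ ∧ u₂ + 2 ≤ k ^ 5) ∧ (1 ≤ u₃ ∧ u₃ + 2 ≤ k ^ 5) ∧ (1 ≤ u₄ ∧ u₄ + 2 ≤ k ^ 5) ∧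
    (2 * q ≤ v₁ ∧ v₁ + 2 * q + 1 ≤ 2 * k ^ 6 * q) ∧ (1 ≤ v₂ ∧ v₂ + 2 ≤ k ^ 5) ∧
    p ∈ proj '' smallSquare n k q u₀ u₁ u₂ u₃ u₄ v₀ v₁ v₂}

/-- The numbering of the `k` segments `Ĩ^{u₀,u₁}_{v₀}` of the element `Ĩ^{u₀}_{v₀}`: the segment
number `l` is the one with `u₁ = l` if `u₀` is odd, and with `u₁ ≡ -l` modulo `k` if `u₀` is even
(over such an element the fibre rotation goes in the negative direction). -/
def segmentIndex (k u₀ l : ℕ) : ℕ := if Even u₀ then (k - l) % k else l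

/-! ### The two inner rotations -/

/-- Column `l` of width `1/(2kq)` over the unit interval `[v, v+1]`. -/
def column (k q : ℕ) (l v : ℤ) : Set (ℝ × ℝ) :=
  Icc ((l : ℝ) / (2 * k * q)) (((l : ℝ) + 1) / (2 * k * q)) ×ˢ Icc (v : ℝ) ((v : ℝ) + 1)

/-- Column `l` without its collar of relative width `ε = 1/(2k⁵)`. -/
def columnCore (k q : ℕ) (l v : ℤ) : Set (ℝ × ℝ) :=
  Icc (((l : ℝ) + 1 / (2 * k ^ 5)) / (2 * k * q))
      (((l : ℝ) + 1 - 1 / (2 * k ^ 5)) / (2 * k * q)) ×ˢ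
  Icc ((v : ℝ) + 1 / (2 * k ^ 5)) ((v : ℝ) + 1 - 1 / (2 * k ^ 5))

/-- The cell `(t₁, t₂)` of column `l`, without a margin of relative width
`2 ε₂ = 1/(2n⁵k¹⁰)`; its size is nearly `1/(2k⁶q) × 1/k⁵`. -/
def columnCell (n k q : ℕ) (l v : ℤ) (t₁ t₂ : ℕ) : Set (ℝ × ℝ) :=
  Icc ((l : ℝ) / (2 * k * q) + (t₁ + 1 / (2 * n ^ 5 * k ^ 10)) / (2 * k ^ 6 * q))
      ((l : ℝ) / (2 * k * q) + (t₁ + 1 - 1 / (2 * n ^ 5 * k ^ 10)) / (2 * k ^ 6 * q)) ×ˢ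
  Icc ((v : ℝ) + (t₂ + 1 / (2 * n ^ 5 * k ^ 10)) / k ^ 5)
      ((v : ℝ) + (t₂ + 1 - 1 / (2 * n ^ 5 * k ^ 10)) / k ^ 5)

/-- An inner rotation of type A: an area-preserving diffeomorphism that maps every column
of width `1/(2kq)` onto itself, is the identity near the boundary of the column, and turns the
`k⁵ × k⁵` pattern of its cells by a quarter turn: every inner cell `(t₁, t₂)` is
translated onto the cell `(k⁵ - t₂ - 1, t₁)` of the same column. -/
structure IsInnerRotationA (n k q : ℕ) (f : TorusDiff) : Prop where
  measurePreserving : MeasurePreserving (lift f) volume volume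
  periodic : ∀ x, lift f (x + (1 / (q : ℝ), 0)) = lift f x + (1 / (q : ℝ), 0)
  image_column : ∀ l v : ℤ, lift f '' column k q l v = column k q l v
  eq_self : ∀ l v : ℤ, ∀ x ∈ column k q l v, x ∉ columnCore k q l v → lift f x = x
  cell : ∀ (l v : ℤ) (t₁ t₂ : ℕ), 1 ≤ t₁ → t₁ + 2 ≤ k ^ 5 → 1 ≤ t₂ → t₂ + 2 ≤ k ^ 5 →
    ∀ x ∈ columnCell n k q l v t₁ t₂,
      lift f x = x + (((k : ℝ) ^ 5 - t₂ - 1 - t₁) / (2 * k ^ 6 * q), ((t₁ : ℝ) - t₂) / k ^ 5)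

/-- The square `(u, v)` of side `1/a`, where `a = 2k¹¹q`. -/
def gridSquare (k q : ℕ) (u v : ℤ) : Set (ℝ × ℝ) :=
  Icc ((u : ℝ) / (2 * k ^ 11 * q)) (((u : ℝ) + 1) / (2 * k ^ 11 * q)) ×ˢ
  Icc ((v : ℝ) / (2 * k ^ 11 * q)) (((v : ℝ) + 1) / (2 * k ^ 11 * q))

/-- The square `(u, v)` without its collar of width `ε/a`, where `ε = 1/(2n⁵k¹¹)`. -/
def gridSquareCore (n k q : ℕ) (u v : ℤ) : Set (ℝ × ℝ) :=
  Icc (((u : ℝ) + 1 / (2 * n ^ 5 * k ^ 11)) / (2 * k ^ 11 * q))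
      (((u : ℝ) + 1 - 1 / (2 * n ^ 5 * k ^ 11)) / (2 * k ^ 11 * q)) ×ˢ
  Icc (((v : ℝ) + 1 / (2 * n ^ 5 * k ^ 11)) / (2 * k ^ 11 * q))
      (((v : ℝ) + 1 - 1 / (2 * n ^ 5 * k ^ 11)) / (2 * k ^ 11 * q))

/-- The square `(s₁, s₂)` of side nearly `1/(ac)`, where `c = k⁵`, inside the grid square with
lower left corner `(l/b + u/a, v/a)`, where `b = 2kq`. -/
def gridCell (n k q : ℕ) (l : ℤ) (u : ℕ) (v : ℤ) (s₁ s₂ : ℕ) : Set (ℝ × ℝ) :=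
  Icc ((l : ℝ) / (2 * k * q) + u / (2 * k ^ 11 * q)
        + (s₁ + 2 * (1 / (2 * n ^ 5 * k ^ 11))) / (2 * k ^ 11 * q * k ^ 5))
      ((l : ℝ) / (2 * k * q) + u / (2 * k ^ 11 * q)
        + (s₁ + 1 - 2 * (1 / (2 * n ^ 5 * k ^ 11))) / (2 * k ^ 11 * q * k ^ 5)) ×ˢ
  Icc ((v : ℝ) / (2 * k ^ 11 * q)
        + (s₂ + 2 * (1 / (2 * n ^ 5 * k ^ 11))) / (2 * k ^ 11 * q * k ^ 5))
      ((v : ℝ) / (2 * k ^ 11 * q)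
        + (s₂ + 1 - 2 * (1 / (2 * n ^ 5 * k ^ 11))) / (2 * k ^ 11 * q * k ^ 5))

/-- The rotation of the plane by the angle `β`. -/
def rotate (β : ℝ) (x : ℝ × ℝ) : ℝ × ℝ :=
  (Real.cos β * x.1 - Real.sin β * x.2, Real.sin β * x.1 + Real.cos β * x.2)

/-- An inner rotation of type B: an area-preserving diffeomorphism that maps every grid square
of side `1/a` onto itself, is the identity near the boundary of the square, and acts on each of the
small squares inside it as the rotation by `s π / k`, `s ≡ l` modulo `k`, followed by a translation;
here `l` is the column of width `1/b` in which the square lies. -/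
structure IsInnerRotationB (n k q : ℕ) (f : TorusDiff) : Prop where
  measurePreserving : MeasurePreserving (lift f) volume volume
  periodic : ∀ x, lift f (x + (1 / (q : ℝ), 0)) = lift f x + (1 / (q : ℝ), 0)
  image_square : ∀ u v : ℤ, lift f '' gridSquare k q u v = gridSquare k q u v
  eq_self : ∀ u v : ℤ, ∀ x ∈ gridSquare k q u v, x ∉ gridSquareCore n k q u v → lift f x = x
  cell : ∀ (l : ℤ) (u : ℕ) (v : ℤ) (s₁ s₂ : ℕ), u < k ^ 10 →
    1 ≤ s₁ → s₁ + 2 ≤ k ^ 5 → 1 ≤ s₂ → s₂ + 2 ≤ k ^ 5 →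
    ∃ w : ℝ × ℝ, ∀ x ∈ gridCell n k q l u v s₁ s₂,
      lift f x = rotate (((l % (k : ℤ) : ℤ) : ℝ) * Real.pi / k) x + w

/-! ### The conjugation map -/

/-- `f` is the identity near the vertical lines `θ ∈ ℤ/N` and preserves the strips between them. -/
def FixesLines (N : ℕ) (f : TorusDiff) : Prop :=
  (∃ δ > 0, ∀ (x : ℝ × ℝ) (z : ℤ), |N * x.1 - z| < δ → lift f x = x) ∧
    ∀ x, ⌊N * (lift f x).1⌋ = ⌊N * x.1⌋

theorem fixesLines_of {N : ℕ} {f : TorusDiff} {δ : ℝ} (hδ : 0 < δ)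
    (h1 : ∀ (x : ℝ × ℝ), N * x.1 < ⌊N * x.1⌋ + δ ∨ ⌊N * x.1⌋ + 1 - δ < N * x.1 → lift f x = x)
    (h2 : ∀ x : ℝ × ℝ, (⌊N * x.1⌋ : ℝ) ≤ N * (lift f x).1 ∧
      N * (lift f x).1 ≤ ⌊N * x.1⌋ + 1) : FixesLines N f := by
  have near : ∀ (x : ℝ × ℝ) (z : ℤ), |N * x.1 - z| < δ → lift f x = x := by
    intro x z h
    rw [abs_lt] at h
    apply h1
    rcases le_or_gt z ⌊N * x.1⌋ with hz | hz
    · left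
      have : (z : ℝ) ≤ ⌊N * x.1⌋ := by exact_mod_cast hz
      linarith
    · right
      have : (⌊N * x.1⌋ : ℝ) + 1 ≤ z := by exact_mod_cast hz
      linarith
  refine ⟨⟨δ, hδ, near⟩, fun x => ?_⟩
  obtain ⟨ha, hb⟩ := h2 x
  rcases hb.lt_or_eq with hb | hb
  · exact Int.floor_eq_iff.mpr ⟨ha, hb⟩
  · have hfix : lift f (lift f x) = lift f x := by
      apply near _ (⌊N * x.1⌋ + 1)
      rw [hb]
      push_cast
      simpa using hδ
    have : lift f x = x := (f : Equiv.Perm (ℝ × ℝ)).injective hfix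
    rw [this]

theorem FixesLines.mul {N : ℕ} {f g : TorusDiff} (hf : FixesLines N f) (hg : FixesLines N g) :
    FixesLines N (f * g) := by
  obtain ⟨⟨δ, hδ, h1⟩, h2⟩ := hf
  obtain ⟨⟨δ', hδ', h1'⟩, h2'⟩ := hg
  have e : ∀ x, lift (f * g) x = lift f (lift g x) := fun x => rfl
  refine ⟨⟨min δ δ', lt_min hδ hδ', fun x z h => ?_⟩, fun x => ?_⟩
  · rw [e, h1' x z (h.trans_le (min_le_right _ _)), h1 x z (h.trans_le (min_le_left _ _))]
  · rw [e, h2, h2']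

theorem FixesLines.of_mul {N m : ℕ} (hm : 0 < m) {f : TorusDiff} (hf : FixesLines (N * m) f) :
    FixesLines N f := by
  obtain ⟨⟨δ, hδ, h1⟩, h2⟩ := hf
  have hm' : (0 : ℝ) < m := by exact_mod_cast hm
  refine ⟨⟨δ / m, by positivity, fun x z h => h1 x (z * m) ?_⟩, fun x => ?_⟩
  · have : ((N * m : ℕ) : ℝ) * x.1 - ((z * m : ℤ) : ℝ) = (N * x.1 - z) * m := by
      push_cast; ring
    rw [this, abs_mul, abs_of_pos hm']
    exact (lt_div_iff₀ hm').mp h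
  · have key : ∀ t : ℝ, ⌊(N : ℝ) * t⌋ = ⌊((N * m : ℕ) : ℝ) * t⌋ / (m : ℤ) := by
      intro t
      have : (N : ℝ) * t = ((N * m : ℕ) : ℝ) * t / (m : ℕ) := by
        push_cast; field_simp
      rw [this, Int.floor_div_natCast]
    rw [key, key, h2]

theorem FixesLines.inv {N : ℕ} {f : TorusDiff} (hf : FixesLines N f) : FixesLines N f⁻¹ := by
  obtain ⟨⟨δ, hδ, h1⟩, h2⟩ := hf
  have e : ∀ x, lift f (lift f⁻¹ x) = x :=
    fun x => Equiv.apply_symm_apply (f : Equiv.Perm (ℝ × ℝ)) x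
  refine ⟨⟨δ, hδ, fun x z h => ?_⟩, fun x => ?_⟩
  · apply (f : Equiv.Perm (ℝ × ℝ)).injective
    exact (e x).trans (h1 x z h).symm
  · rw [← h2, e]

theorem IsInnerRotationA.fixesLines {n k q : ℕ} (hk : 0 < k) (hq : 0 < q) {f : TorusDiff}
    (hf : IsInnerRotationA n k q f) : FixesLines (2 * q) f := by
  apply FixesLines.of_mul hk
  have hk' : (0 : ℝ) < k := by exact_mod_cast hk
  have hq' : (0 : ℝ) < q := by exact_mod_cast hq
  have hN : (0 : ℝ) < 2 * k * q := by positivity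
  have hc : ((2 * q * k : ℕ) : ℝ) = 2 * k * q := by push_cast; ring
  have hmem : ∀ x : ℝ × ℝ, x ∈ column k q ⌊2 * k * q * x.1⌋ ⌊x.2⌋ := by
    intro x
    refine ⟨⟨?_, ?_⟩, Int.floor_le _, (Int.lt_floor_add_one _).le⟩
    · rw [div_le_iff₀ hN]
      have := Int.floor_le (2 * k * q * x.1)
      linarith
    · rw [le_div_iff₀ hN]
      have := Int.lt_floor_add_one (2 * k * q * x.1)
      linarith
  refine fixesLines_of (δ := 1 / (2 * (k : ℝ) ^ 5)) (by positivity) ?_ ?_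
  · intro x hx
    rw [hc] at hx
    refine hf.eq_self _ _ x (hmem x) ?_
    rintro ⟨⟨h1, h2⟩, -⟩
    rw [div_le_iff₀ hN] at h1
    rw [le_div_iff₀ hN] at h2
    rcases hx with hx | hx <;> linarith
  · intro x
    rw [hc]
    have : lift f x ∈ column k q ⌊2 * k * q * x.1⌋ ⌊x.2⌋ := by
      rw [← hf.image_column]
      exact mem_image_of_mem _ (hmem x)
    obtain ⟨⟨h1, h2⟩, -⟩ := this
    rw [div_le_iff₀ hN] at h1
    rw [le_div_iff₀ hN] at h2
    constructor <;> linarith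

theorem IsInnerRotationB.fixesLines {n k q : ℕ} (hn : 0 < n) (hk : 0 < k) (hq : 0 < q)
    {f : TorusDiff} (hf : IsInnerRotationB n k q f) : FixesLines (2 * q) f := by
  apply FixesLines.of_mul (pow_pos hk 11)
  have hn' : (0 : ℝ) < n := by exact_mod_cast hn
  have hk' : (0 : ℝ) < k := by exact_mod_cast hk
  have hq' : (0 : ℝ) < q := by exact_mod_cast hq
  have hN : (0 : ℝ) < 2 * k ^ 11 * q := by positivity
  have hc : ((2 * q * k ^ 11 : ℕ) : ℝ) = 2 * k ^ 11 * q := by push_cast; ring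
  have hmem : ∀ x : ℝ × ℝ,
      x ∈ gridSquare k q ⌊2 * k ^ 11 * q * x.1⌋ ⌊2 * k ^ 11 * q * x.2⌋ := by
    have key : ∀ t : ℝ, t ∈ Icc ((⌊2 * k ^ 11 * q * t⌋ : ℝ) / (2 * k ^ 11 * q))
        (((⌊2 * k ^ 11 * q * t⌋ : ℝ) + 1) / (2 * k ^ 11 * q)) := by
      intro t
      constructor
      · rw [div_le_iff₀ hN]
        have := Int.floor_le (2 * k ^ 11 * q * t)
        linarith
      · rw [le_div_iff₀ hN]
        have := Int.lt_floor_add_one (2 * k ^ 11 * q * t)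
        linarith
    exact fun x => ⟨key x.1, key x.2⟩
  refine fixesLines_of (δ := 1 / (2 * (n : ℝ) ^ 5 * (k : ℝ) ^ 11)) (by positivity) ?_ ?_
  · intro x hx
    rw [hc] at hx
    refine hf.eq_self _ _ x (hmem x) ?_
    rintro ⟨⟨h1, h2⟩, -⟩
    rw [div_le_iff₀ hN] at h1
    rw [le_div_iff₀ hN] at h2
    rcases hx with hx | hx <;> linarith
  · intro x
    rw [hc]
    have : lift f x ∈ gridSquare k q ⌊2 * k ^ 11 * q * x.1⌋ ⌊2 * k ^ 11 * q * x.2⌋ := by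
      rw [← hf.image_square]
      exact mem_image_of_mem _ (hmem x)
    obtain ⟨⟨h1, h2⟩, -⟩ := this
    rw [div_le_iff₀ hN] at h1
    rw [le_div_iff₀ hN] at h2
    constructor <;> linarith

/-- The map that is `f` over the strips `2u/N ≤ θ < (2u+1)/N` and the identity over the other
strips. -/
def alternateFun (N : ℕ) (f : TorusDiff) (x : ℝ × ℝ) : ℝ × ℝ :=
  if Even ⌊N * x.1⌋ then lift f x else x

theorem alternateFun_inv {N : ℕ} {f : TorusDiff} (hf : FixesLines N f) (x : ℝ × ℝ) :
    alternateFun N f⁻¹ (alternateFun N f x) = x := by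
  unfold alternateFun
  by_cases h : Even ⌊N * x.1⌋
  · rw [if_pos h, hf.2, if_pos h]
    exact Equiv.symm_apply_apply (f : Equiv.Perm (ℝ × ℝ)) x
  · rw [if_neg h, if_neg h]

theorem contDiff_alternateFun {N : ℕ} {f : TorusDiff} (hf : FixesLines N f) :
    ContDiff ℝ ∞ (alternateFun N f) := by
  obtain ⟨⟨δ, hδ, h1⟩, h2⟩ := hf
  rw [contDiff_iff_contDiffAt]
  intro x
  have hcont : Continuous fun y : ℝ × ℝ => (N : ℝ) * y.1 := by fun_prop
  by_cases hx : (⌊(N : ℝ) * x.1⌋ : ℝ) = N * x.1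
  · have hev : ∀ᶠ y in nhds x, alternateFun N f y = id y := by
      have : ∀ᶠ y : ℝ × ℝ in nhds x, |(N : ℝ) * y.1 - ⌊(N : ℝ) * x.1⌋| < δ := by
        have hc : Continuous fun y : ℝ × ℝ => |(N : ℝ) * y.1 - ⌊(N : ℝ) * x.1⌋| := by fun_prop
        refine hc.continuousAt.eventually_lt continuousAt_const ?_
        rw [hx]
        simpa using hδ
      filter_upwards [this] with y hy
      unfold alternateFun
      split_ifs
      · exact h1 y _ hy
      · rfl
    exact contDiffAt_id.congr_of_eventuallyEq hev
  · have hlt : (⌊(N : ℝ) * x.1⌋ : ℝ) < N * x.1 := lt_of_le_of_ne (Int.floor_le _) hx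
    have hev : ∀ᶠ y : ℝ × ℝ in nhds x, ⌊(N : ℝ) * y.1⌋ = ⌊(N : ℝ) * x.1⌋ := by
      have e1 : ∀ᶠ y : ℝ × ℝ in nhds x, (⌊(N : ℝ) * x.1⌋ : ℝ) < N * y.1 :=
        continuousAt_const.eventually_lt hcont.continuousAt hlt
      have e2 : ∀ᶠ y : ℝ × ℝ in nhds x, (N : ℝ) * y.1 < (⌊(N : ℝ) * x.1⌋ : ℝ) + 1 :=
        hcont.continuousAt.eventually_lt continuousAt_const (Int.lt_floor_add_one _)
      filter_upwards [e1, e2] with y hy1 hy2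
      exact Int.floor_eq_iff.mpr ⟨hy1.le, hy2⟩
    by_cases h : Even ⌊(N : ℝ) * x.1⌋
    · have hev' : ∀ᶠ y in nhds x, alternateFun N f y = lift f y := by
        filter_upwards [hev] with y hy
        unfold alternateFun
        rw [hy, if_pos h]
      have hsm : ContDiff ℝ ∞ (lift f) := f.2.1
      exact hsm.contDiffAt.congr_of_eventuallyEq hev'
    · have hev' : ∀ᶠ y in nhds x, alternateFun N f y = id y := by
        filter_upwards [hev] with y hy
        unfold alternateFun
        rw [hy, if_neg h]
        rfl
      exact contDiffAt_id.congr_of_eventuallyEq hev'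

/-- `alternateFun` as a diffeomorphism of the torus, for an even number `2 q` of strips. -/
def alternate (q : ℕ) (f : TorusDiff) (hf : FixesLines (2 * q) f) : TorusDiff :=
  ⟨{ toFun := alternateFun (2 * q) f
     invFun := alternateFun (2 * q) f⁻¹
     left_inv := alternateFun_inv hf
     right_inv := fun x => by
      have h := alternateFun_inv hf.inv x
      rwa [inv_inv] at h },
    contDiff_alternateFun hf, contDiff_alternateFun hf.inv, by
      intro x a b
      have hfl : ⌊((2 * q : ℕ) : ℝ) * (x + ((a : ℝ), (b : ℝ))).1⌋
          = ⌊((2 * q : ℕ) : ℝ) * x.1⌋ + 2 * (q * a) := by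
        have : ((2 * q : ℕ) : ℝ) * (x + ((a : ℝ), (b : ℝ))).1
            = ((2 * q : ℕ) : ℝ) * x.1 + ((2 * (q * a) : ℤ) : ℝ) := by
          rw [Prod.fst_add]
          push_cast
          ring
        rw [this, Int.floor_add_intCast]
      change alternateFun (2 * q) f _ = alternateFun (2 * q) f x + _
      unfold alternateFun
      rw [hfl]
      have hiff : Even (⌊((2 * q : ℕ) : ℝ) * x.1⌋ + 2 * ((q : ℤ) * a))
          ↔ Even ⌊((2 * q : ℕ) : ℝ) * x.1⌋ := by
        rw [Int.even_add]
        simp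
      simp only [hiff]
      split_ifs
      · exact f.2.2.2 x a b
      · rfl⟩

/-- The conjugation map `φ`: it is `i ∘ φ̃` over the strips `[2u/(2q), (2u+1)/(2q)]` and the
identity over the strips `[(2u+1)/(2q), (2u+2)/(2q)]`. -/
def conjugation {n k q : ℕ} (hn : 0 < n) (hk : 0 < k) (hq : 0 < q) {φt i : TorusDiff}
    (hφt : IsInnerRotationA n k q φt) (hi : IsInnerRotationB n k q i) : TorusDiff :=
  alternate q (i * φt) ((hi.fixesLines hn hk hq).mul (hφt.fixesLines hk hq))

/-- The mixing time `m`, for the denominator `q` of `α_n` and `α_{n+1} = p'/q'`. -/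
def mixingTime (q : ℕ) (p' : ℤ) (q' : ℕ) : ℕ :=
  sInf {m : ℕ | m ≤ q' ∧
    (⨅ j : ℤ, |(m : ℝ) * ((q : ℝ) * p' / q') - 1 / 2 + (j : ℝ)|) ≤ (q : ℝ) / q'}

end TorusAbC

end

open TorusAbC

/-! The choice of the mixing time makes the rotation by $m\alpha_{n+1}$ equal to $1/(2q)$ modulo
$1/q$, up to an error `e` with $|e|\le 1/q'$. It therefore interchanges the strips on which
$\phi=i\circ\tilde\phi$ with those on which $\phi$ is the identity. At the relevant points $\Phi$ is
$i\circ\tilde\phi\circ R^m$ over an odd strip and $R^m\circ\tilde\phi^{-1}\circ i^{-1}$ over an even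
one: a single quarter turn and a single fibre rotation (`lift_of_odd`, `lift_of_even`).

The quarter turn exchanges the free digit $u_2$, which spreads a segment across its column, with the
fixed height digit $v_0$. In the image only $u_3$ is free horizontally at the scale of the grid
squares, so the image lies in a thin column $X$ of width `imageWidth` over a set $Y$ of rows of
total height `imageHeight`, and $X\times Y$ has almost the area of the segment. The map $i^{\pm1}$
turns tangent directions on the inner squares by $\pm u_1\pi/k$, because $u_1$ is the residue modulo
$k$ of the column in which $i$ acts. The numbering of the segments makes this residue $l$ in both
parities.

The image is not exactly a product: the error `e` and the motion of $i$ inside the grid squares blur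
it. This is handled by measure alone. The segment $S$ and the set $D$ on which $\Phi$ is known to be
locally a rotation both nearly fill the same hull of grid squares, so $S\cap D$ has almost full area
(`volume_inter_ge`). By Fubini and Markov (`exists_full_fibers`) there is a set $J\subseteq Y$ of
heights, of almost full length, over which every horizontal fibre of the image of $S\cap D$ has
length at least $(1-\eta)$ times the width of $X$. For $J'\subseteq J$ the mass sent to height $J'$
is then squeezed between $(1-\eta)$ and $1$ times width times $\lambda(J')$, which is the required
uniformity (`abs_ratio_sub_le`). On $S\cap D$ the direction $j/k$ goes exactly to $t/k$ modulo $1$,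
so the same two bounds also give the condition on the tangent intervals
(`exists_distributed_fibers`). -/

namespace TorusAbC

/-! ### Lebesgue measure on the torus and maps induced by area-preserving lifts -/

/-- The fundamental domain `[0,1)²` of the torus. -/
def unitSquare : Set (ℝ × ℝ) := Ico 0 1 ×ˢ Ico 0 1

theorem measurableSet_unitSquare : MeasurableSet unitSquare :=
  measurableSet_Ico.prod measurableSet_Ico

theorem measurable_proj : Measurable proj :=
  (AddCircle.measurable_mk'.comp measurable_fst).prodMk (AddCircle.measurable_mk'.comp measurable_snd)

theorem measurable_rep : Measurable rep := by
  have h : Measurable fun p : UnitAddCircle => (AddCircle.equivIco (1 : ℝ) 0 p : ℝ) :=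
    measurable_subtype_coe.comp (AddCircle.measurableEquivIco (1 : ℝ) 0).measurable
  exact (h.comp measurable_fst).prodMk (h.comp measurable_snd)

theorem rep_proj_of_mem {x : ℝ × ℝ} (hx : x ∈ unitSquare) : rep (proj x) = x := by
  have key : ∀ t : ℝ, t ∈ Ico (0 : ℝ) 1 →
      (AddCircle.equivIco (1 : ℝ) 0 ((t : ℝ) : UnitAddCircle) : ℝ) = t := by
    intro t ht
    have ht' : t ∈ Ico (0 : ℝ) (0 + 1) := by simpa using ht
    rw [AddCircle.equivIco_coe_of_mem ht']
  exact Prod.ext (key _ hx.1) (key _ hx.2)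

theorem measurePreserving_proj :
    MeasurePreserving proj ((volume : Measure (ℝ × ℝ)).restrict unitSquare) volume := by
  have h1 : MeasurePreserving (fun t : ℝ => (t : UnitAddCircle))
      ((volume : Measure ℝ).restrict (Ico 0 1)) volume := by
    have h := UnitAddCircle.measurePreserving_mk 0
    rw [← restrict_Ico_eq_restrict_Ioc] at h
    simpa using h
  have := h1.prod h1
  rw [Measure.prod_restrict] at this
  exact this

theorem volume_torus {E : Set Torus} (hE : MeasurableSet E) :
    volume E = volume (proj ⁻¹' E ∩ unitSquare) := by
  rw [← measurePreserving_proj.measure_preimage hE.nullMeasurableSet,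
    Measure.restrict_apply (measurable_proj hE)]

/-- Turns areas computed in the plane into measures on the torus. Working with `rep ⁻¹' S` instead
of `proj '' S` makes measurability immediate. -/
theorem volume_rep_preimage {S : Set (ℝ × ℝ)} (hS : MeasurableSet S) (hSF : S ⊆ unitSquare) :
    volume (rep ⁻¹' S) = volume S := by
  rw [volume_torus (measurable_rep hS)]
  congr 1
  ext x
  constructor
  · rintro ⟨h1, h2⟩
    rwa [mem_preimage, mem_preimage, rep_proj_of_mem h2] at h1
  · intro h
    refine ⟨?_, hSF h⟩
    rwa [mem_preimage, mem_preimage, rep_proj_of_mem (hSF h)]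

theorem proj_image_eq {S : Set (ℝ × ℝ)} (hSF : S ⊆ unitSquare) : proj '' S = rep ⁻¹' S := by
  ext p
  constructor
  · rintro ⟨x, hx, rfl⟩
    rwa [mem_preimage, rep_proj_of_mem (hSF hx)]
  · intro h
    exact ⟨rep p, h, proj_rep p⟩

/-- The translate of the unit square by an integer vector. -/
def shiftedSquare (z : ℤ × ℤ) : Set (ℝ × ℝ) :=
  {x | x - ((z.1 : ℝ), (z.2 : ℝ)) ∈ unitSquare}

theorem mem_shiftedSquare {z : ℤ × ℤ} {x : ℝ × ℝ} :
    x ∈ shiftedSquare z ↔ z = (⌊x.1⌋, ⌊x.2⌋) := by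
  have key : ∀ (t : ℝ) (a : ℤ), t - a ∈ Ico (0 : ℝ) 1 ↔ a = ⌊t⌋ := by
    intro t a
    rw [eq_comm, Int.floor_eq_iff, mem_Ico]
    constructor <;> rintro ⟨h1, h2⟩ <;> constructor <;> linarith
  rw [Prod.ext_iff, ← key, ← key]
  rfl

theorem measurableSet_shiftedSquare (z : ℤ × ℤ) : MeasurableSet (shiftedSquare z) :=
  (measurable_id.sub_const _) measurableSet_unitSquare

theorem volume_eq_tsum_shiftedSquare {A : Set (ℝ × ℝ)} (hA : MeasurableSet A) :
    volume A = ∑' z, volume (A ∩ shiftedSquare z) := by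
  rw [← measure_iUnion]
  · congr 1
    ext x
    simp [mem_shiftedSquare]
  · intro z w hzw
    rw [Function.onFun, disjoint_left]
    rintro x ⟨-, h1⟩ ⟨-, h2⟩
    rw [mem_shiftedSquare] at h1 h2
    exact hzw (h1.trans h2.symm)
  · exact fun z => hA.inter (measurableSet_shiftedSquare z)

theorem lift_inv_lift (f : TorusDiff) (x : ℝ × ℝ) : lift f⁻¹ (lift f x) = x :=
  Equiv.symm_apply_apply (f : Equiv.Perm (ℝ × ℝ)) x

theorem lift_lift_inv (f : TorusDiff) (x : ℝ × ℝ) : lift f (lift f⁻¹ x) = x :=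
  Equiv.apply_symm_apply (f : Equiv.Perm (ℝ × ℝ)) x

theorem lift_mul (f g : TorusDiff) (x : ℝ × ℝ) : lift (f * g) x = lift f (lift g x) := rfl

theorem continuous_lift (f : TorusDiff) : Continuous (lift f) :=
  (differentiable_lift f).continuous

theorem lift_add_int (f : TorusDiff) (x : ℝ × ℝ) (a b : ℤ) :
    lift f (x + ((a : ℝ), (b : ℝ))) = lift f x + ((a : ℝ), (b : ℝ)) := f.2.2.2 x a b

theorem torusMap_inv_torusMap (f : TorusDiff) (p : Torus) :
    torusMap f⁻¹ (torusMap f p) = p := by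
  rw [← proj_rep p, torusMap_proj, torusMap_proj, lift_inv_lift]

theorem torusMap_torusMap_inv (f : TorusDiff) (p : Torus) :
    torusMap f (torusMap f⁻¹ p) = p := by
  rw [← proj_rep p, torusMap_proj, torusMap_proj, lift_lift_inv]

theorem measurable_torusMap (f : TorusDiff) : Measurable (torusMap f) :=
  measurable_proj.comp ((continuous_lift f).measurable.comp measurable_rep)

theorem image_torusMap (f : TorusDiff) (C : Set Torus) :
    torusMap f '' C = torusMap f⁻¹ ⁻¹' C := by
  ext p
  constructor
  · rintro ⟨q, hq, rfl⟩
    rwa [mem_preimage, torusMap_inv_torusMap]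
  · intro h
    exact ⟨_, h, torusMap_torusMap_inv f p⟩

theorem measurePreserving_lift_inv {f : TorusDiff}
    (hf : MeasurePreserving (lift f) volume volume) :
    MeasurePreserving (lift f⁻¹) volume volume := by
  refine ⟨(continuous_lift _).measurable, ?_⟩
  ext s hs
  rw [Measure.map_apply (continuous_lift _).measurable hs,
    ← hf.measure_preimage ((continuous_lift f⁻¹).measurable hs).nullMeasurableSet]
  congr 1
  ext x
  simp only [mem_preimage, lift_inv_lift]

/-- The lift carries the unit square to another fundamental domain `G`, so the preimage of `E` has
the area of `P ∩ G`. Both `P ∩ G` and the preimage of `P ∩ unitSquare` are cut along the integer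
translates of the unit square. Since the lift commutes with integer translations, the piece for `-z`
of the first has the same area as the piece for `z` of the second, whence the reindexing by
negation. -/
theorem measurePreserving_torusMap {f : TorusDiff}
    (hf : MeasurePreserving (lift f) volume volume) :
    MeasurePreserving (torusMap f) volume volume := by
  refine ⟨measurable_torusMap f, ?_⟩
  ext E hE
  rw [Measure.map_apply (measurable_torusMap f) hE, volume_torus (measurable_torusMap f hE),
    volume_torus hE]
  set P : Set (ℝ × ℝ) := proj ⁻¹' E with hP
  have hPm : MeasurableSet P := measurable_proj hE
  set G : Set (ℝ × ℝ) := lift f⁻¹ ⁻¹' unitSquare with hG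
  have hGm : MeasurableSet G := (continuous_lift _).measurable measurableSet_unitSquare
  have h1 : proj ⁻¹' (torusMap f ⁻¹' E) ∩ unitSquare = lift f ⁻¹' (P ∩ G) := by
    ext x
    simp only [mem_inter_iff, mem_preimage, torusMap_proj, hP, hG, lift_inv_lift]
  rw [h1, hf.measure_preimage (hPm.inter hGm).nullMeasurableSet,
    volume_eq_tsum_shiftedSquare (hPm.inter hGm),
    ← hf.measure_preimage (hPm.inter measurableSet_unitSquare).nullMeasurableSet,
    volume_eq_tsum_shiftedSquare ((continuous_lift f).measurable
      (hPm.inter measurableSet_unitSquare)), ← (Equiv.neg (ℤ × ℤ)).tsum_eq]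
  refine tsum_congr fun z => ?_
  have hT : MeasurePreserving (fun x : ℝ × ℝ => x + ((z.1 : ℝ), (z.2 : ℝ))) volume volume :=
    measurePreserving_add_right volume _
  have hWm : MeasurableSet (lift f⁻¹ ⁻¹' shiftedSquare z) :=
    (continuous_lift _).measurable (measurableSet_shiftedSquare z)
  have h2 : lift f ⁻¹' (P ∩ unitSquare) ∩ shiftedSquare z
      = lift f ⁻¹' ((P ∩ unitSquare) ∩ lift f⁻¹ ⁻¹' shiftedSquare z) := by
    ext x
    simp only [mem_inter_iff, mem_preimage, lift_inv_lift]
  have h3 : P ∩ G ∩ shiftedSquare (-z) = (fun x : ℝ × ℝ => x + ((z.1 : ℝ), (z.2 : ℝ))) ⁻¹'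
      ((P ∩ unitSquare) ∩ lift f⁻¹ ⁻¹' shiftedSquare z) := by
    ext x
    have e1 : x - (((-z).1 : ℝ), ((-z).2 : ℝ)) = x + ((z.1 : ℝ), (z.2 : ℝ)) := by
      ext <;> simp
    simp only [mem_inter_iff, mem_preimage, shiftedSquare, mem_ofPred_eq, hP, hG,
      proj_add_int, lift_add_int, add_sub_cancel_right]
    rw [e1]
    tauto
  rw [h2, hf.measure_preimage ((hPm.inter measurableSet_unitSquare).inter hWm).nullMeasurableSet,
    Equiv.neg_apply, h3,
    hT.measure_preimage ((hPm.inter measurableSet_unitSquare).inter hWm).nullMeasurableSet]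

/-! ### Nearly full horizontal fibres -/

/-- Fubini and Markov: if a measure preserving map sends `I` into a product `X × Y` and the image of
`C ⊆ I` nearly fills it, then on most horizontal fibres over `Y` the image of `C` is nearly full. -/
theorem exists_full_fibers {f : TorusDiff} (hf : MeasurePreserving (lift f) volume volume)
    {I C : Set Torus} (hC : MeasurableSet C) (hCI : C ⊆ I) {X Y : Set UnitAddCircle}
    (hX : MeasurableSet X) (hY : MeasurableSet Y)
    (himg : ∀ p ∈ I, torusMap f p ∈ X ×ˢ Y) {gX gY ρ η : ℝ} (hgX : 0 < gX) (hgY : 0 ≤ gY)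
    (hη : 0 < η) (hη1 : η < 1) (hXg : volume X ≤ ENNReal.ofReal gX)
    (hYg : volume Y ≤ ENNReal.ofReal gY) (hCg : ENNReal.ofReal ((1 - ρ) * (gX * gY)) ≤ volume C) :
    ∃ J : Set UnitAddCircle, MeasurableSet J ∧ J ⊆ Prod.snd '' (torusMap f '' I) ∧ J ⊆ Y ∧
      gY * (1 - ρ / η) ≤ volume.real J ∧
      ∀ J' : Set UnitAddCircle, MeasurableSet J' → J' ⊆ J →
        (1 - η) * gX * volume.real J' ≤ volume.real (C ∩ torusMap f ⁻¹' (univ ×ˢ J')) ∧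
        volume.real (I ∩ torusMap f ⁻¹' (univ ×ˢ J')) ≤ gX * volume.real J' := by
  have hT := measurePreserving_torusMap hf
  set D : Set Torus := torusMap f '' C with hD
  have hDm : MeasurableSet D := by
    rw [hD, image_torusMap]
    exact measurable_torusMap _ hC
  have hpre : torusMap f ⁻¹' D = C := by
    ext p
    rw [hD, image_torusMap]
    simp only [mem_preimage, torusMap_inv_torusMap]
  set h : UnitAddCircle → ENNReal := fun r => volume ((fun θ => (θ, r)) ⁻¹' D) with hh
  have hhm : Measurable h := measurable_measure_prodMk_right hDm
  have hDXY : ∀ z ∈ D, z ∈ X ×ˢ Y := by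
    rintro _ ⟨p, hp, rfl⟩
    exact himg p (hCI hp)
  have hle : ∀ r, h r ≤ ENNReal.ofReal gX := fun r =>
    (measure_mono (t := X) fun θ hθ => (hDXY (θ, r) hθ).1).trans hXg
  have hzero : ∀ r, r ∉ Y → h r = 0 := by
    intro r hr
    have : (fun θ : UnitAddCircle => (θ, r)) ⁻¹' D = ∅ := by
      ext θ
      simp only [mem_preimage, mem_empty_iff_false, iff_false]
      exact fun hθ => hr (hDXY _ hθ).2
    simp only [hh, this, measure_empty]
  have hmass : ∀ J' : Set UnitAddCircle, MeasurableSet J' →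
      volume (C ∩ torusMap f ⁻¹' (univ ×ˢ J')) = ∫⁻ r in J', h r := by
    intro J' hJ'
    have hm : MeasurableSet (D ∩ univ ×ˢ J') := hDm.inter (MeasurableSet.univ.prod hJ')
    rw [← hpre, ← preimage_inter, hT.measure_preimage hm.nullMeasurableSet,
      Measure.volume_eq_prod, Measure.prod_apply_symm hm, ← lintegral_indicator hJ']
    refine lintegral_congr fun r => ?_
    by_cases hr : r ∈ J'
    · rw [indicator_of_mem hr]
      simp only [hh]
      congr 1
      ext θ
      simp [hr]
    · rw [indicator_of_notMem hr]
      have : (fun θ : UnitAddCircle => (θ, r)) ⁻¹' (D ∩ univ ×ˢ J') = ∅ := by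
        ext θ
        simp [hr]
      rw [this, measure_empty]
  set J : Set UnitAddCircle := {r | ENNReal.ofReal ((1 - η) * gX) ≤ h r} with hJ
  have hJm : MeasurableSet J := measurableSet_le measurable_const hhm
  -- A positive threshold makes the fibres over `J` nonempty; this is what places `J` inside the
  -- vertical projection of the image and inside `Y`.
  have hpos : 0 < (1 - η) * gX := mul_pos (by linarith) hgX
  have hne : ∀ r ∈ J, ∃ θ, (θ, r) ∈ D := by
    intro r hr
    have h1 : 0 < h r := (ENNReal.ofReal_pos.mpr hpos).trans_le hr
    exact nonempty_of_measure_ne_zero h1.ne'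
  have hJY : J ⊆ Y := fun r hr => by
    obtain ⟨θ, hθ⟩ := hne r hr
    exact (hDXY _ hθ).2
  refine ⟨J, hJm, ?_, hJY, ?_, ?_⟩
  · intro r hr
    obtain ⟨θ, hθ⟩ := hne r hr
    exact ⟨(θ, r), image_mono hCI hθ, rfl⟩
  -- The fibre length `h` is at most `gX` on `J`, below `(1 - η) * gX` on `Y \ J` and zero off `Y`.
  -- Comparing its integral with the lower bound on the mass of `C` limits the size of `Y \ J`.
  · have htot : volume C ≤ ENNReal.ofReal gX * volume J
        + ENNReal.ofReal ((1 - η) * gX) * volume (Y \ J) := by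
      have e := hmass univ MeasurableSet.univ
      have e' : C ∩ torusMap f ⁻¹' (univ ×ˢ univ) = C := by simp
      rw [e', Measure.restrict_univ] at e
      rw [e, ← setLIntegral_const, ← setLIntegral_const]
      rw [← lintegral_indicator hJm, ← lintegral_indicator (hY.diff hJm),
        ← lintegral_add_left (measurable_const.indicator hJm)]
      refine lintegral_mono fun r => ?_
      by_cases hr : r ∈ J
      · simpa [hr] using hle r
      · by_cases hrY : r ∈ Y
        · have : h r ≤ ENNReal.ofReal ((1 - η) * gX) := (not_le.mp hr).le
          simpa [hr, hrY] using this
        · simp [hzero r hrY]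
    have hreal : (1 - ρ) * (gX * gY)
        ≤ gX * volume.real J + (1 - η) * gX * volume.real (Y \ J) := by
      have h2 := (ENNReal.ofReal_le_iff_le_toReal (by finiteness)).mp (hCg.trans htot)
      rwa [ENNReal.toReal_add (by finiteness) (by finiteness), ENNReal.toReal_mul,
        ENNReal.toReal_mul, ENNReal.toReal_ofReal hgX.le, ENNReal.toReal_ofReal hpos.le] at h2
    have hYJ : volume.real (Y \ J) ≤ gY - volume.real J := by
      rw [measureReal_sdiff hJY hJm]
      have : volume.real Y ≤ gY := ENNReal.toReal_le_of_le_ofReal hgY hYg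
      linarith
    have h3 : (1 - ρ) * gY ≤ volume.real J + (1 - η) * (gY - volume.real J) := by
      have h4 : gX * ((1 - ρ) * gY) ≤ gX * (volume.real J + (1 - η) * (gY - volume.real J)) := by
        have := mul_le_mul_of_nonneg_left hYJ hpos.le
        linarith
      exact le_of_mul_le_mul_left h4 hgX
    have h5 : gY * (1 - ρ / η) = (gY * (η - ρ)) / η := by field_simp
    rw [h5, div_le_iff₀ hη]
    linarith
  · intro J' hJ'm hJ'
    constructor
    · have : ENNReal.ofReal ((1 - η) * gX) * volume J'
          ≤ volume (C ∩ torusMap f ⁻¹' (univ ×ˢ J')) := by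
        rw [hmass J' hJ'm, ← setLIntegral_const]
        exact setLIntegral_mono hhm fun r hr => hJ' hr
      have h2 := ENNReal.toReal_mono (by finiteness) this
      rwa [ENNReal.toReal_mul, ENNReal.toReal_ofReal hpos.le] at h2
    · have : volume (I ∩ torusMap f ⁻¹' (univ ×ˢ J')) ≤ ENNReal.ofReal gX * volume J' := by
        calc _ ≤ volume (torusMap f ⁻¹' (X ×ˢ J')) :=
              measure_mono fun p hp => ⟨(himg p hp.1).1, hp.2.2⟩
          _ = volume X * volume J' := by
              rw [hT.measure_preimage (hX.prod hJ'm).nullMeasurableSet, Measure.volume_eq_prod,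
                Measure.prod_prod]
          _ ≤ _ := by gcongr
      have h2 := ENNReal.toReal_mono (by finiteness) this
      rwa [ENNReal.toReal_mul, ENNReal.toReal_ofReal hgX.le] at h2

/-! ### Directions and local rotations -/

theorem direction_periodic : Function.Periodic direction 1 := by
  intro t
  unfold direction
  rw [Projectivization.mk_eq_mk_iff']
  refine ⟨-1, ?_⟩
  have : Real.pi * (t + 1) = Real.pi * t + Real.pi := by ring
  rw [this, Real.cos_add_pi, Real.sin_add_pi]
  ext <;> simp

/-- Only the left endpoint of `T_j` is followed: a turn by `b π / k` moves it exactly to the left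
endpoint of `T_t`. One such direction over each base point suffices, because the last condition
measures only the projection to the torus. -/
theorem direction_mem_tangentInterval {k j t : ℕ} (hk : 0 < k) {b : ℤ}
    (h : (t : ℤ) ≡ b + j [ZMOD k]) :
    direction ((j : ℝ) / k + (b : ℝ) * Real.pi / k / Real.pi) ∈ tangentInterval k t := by
  obtain ⟨z, hz⟩ := h.dvd
  have hk' : (0 : ℝ) < k := by exact_mod_cast hk
  have hz' : (b : ℝ) + j - t = k * z := by exact_mod_cast hz
  have e : (j : ℝ) / k + (b : ℝ) * Real.pi / k / Real.pi = (t : ℝ) / k + z * 1 := by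
    field_simp
    linarith
  rw [e, direction_periodic.int_mul z]
  exact ⟨_, ⟨le_rfl, by gcongr; linarith⟩, rfl⟩

/-- The rotation by `β` as a continuous linear map. -/
noncomputable def rotateL (β : ℝ) : ℝ × ℝ →L[ℝ] ℝ × ℝ :=
  (Real.cos β • ContinuousLinearMap.fst ℝ ℝ ℝ - Real.sin β • ContinuousLinearMap.snd ℝ ℝ ℝ).prod
    (Real.sin β • ContinuousLinearMap.fst ℝ ℝ ℝ + Real.cos β • ContinuousLinearMap.snd ℝ ℝ ℝ)

theorem rotateL_apply (β : ℝ) (x : ℝ × ℝ) : rotateL β x = rotate β x := by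
  simp [rotateL, rotate]

theorem rotate_add (β : ℝ) (x y : ℝ × ℝ) : rotate β (x + y) = rotate β x + rotate β y := by
  simp only [← rotateL_apply, map_add]

theorem rotate_sub (β : ℝ) (x y : ℝ × ℝ) : rotate β (x - y) = rotate β x - rotate β y := by
  simp only [← rotateL_apply, map_sub]

theorem rotate_neg_rotate (β : ℝ) (x : ℝ × ℝ) : rotate (-β) (rotate β x) = x := by
  have := Real.sin_sq_add_cos_sq β
  ext <;> simp only [rotate, Real.cos_neg, Real.sin_neg]
  · linear_combination x.1 * this
  · linear_combination x.2 * this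

theorem fderiv_eq_rotateL {f : ℝ × ℝ → ℝ × ℝ} {x w : ℝ × ℝ} {β : ℝ}
    (h : ∀ᶠ y in nhds x, f y = rotate β y + w) : fderiv ℝ f x = rotateL β := by
  have h1 : HasFDerivAt (fun y => rotateL β y + w) (rotateL β) x :=
    (rotateL β).hasFDerivAt.add_const w
  refine (h1.congr_of_eventuallyEq ?_).fderiv
  filter_upwards [h] with y hy
  rw [hy, rotateL_apply]

/-- The formula for the lift is needed on a whole neighbourhood, so that it determines the
derivative. This is why open cells are used for the sets of good points. -/
theorem derivExt_direction {f : TorusDiff} {p : Torus} {w : ℝ × ℝ} {β : ℝ}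
    (h : ∀ᶠ y in nhds (rep p), lift f y = rotate β y + w) (t : ℝ) :
    derivExt f (p, direction t) = (torusMap f p, direction (t + β / Real.pi)) := by
  unfold derivExt
  refine Prod.ext rfl ?_
  simp only [direction, Projectivization.map_mk]
  congr 1
  have e : fderiv ℝ (lift f) (rep p) (Real.cos (Real.pi * t), Real.sin (Real.pi * t))
      = (Real.cos (Real.pi * (t + β / Real.pi)), Real.sin (Real.pi * (t + β / Real.pi))) := by
    have e2 : Real.pi * (t + β / Real.pi) = β + Real.pi * t := by
      field_simp
      ring
    rw [fderiv_eq_rotateL h, rotateL_apply, e2, Real.cos_add, Real.sin_add]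
    rfl
  exact e

/-! ### The mixing time -/

/-- The infimum is attained, at minus the integer nearest to `x`. -/
theorem exists_int_near_of_iInf_le {x c : ℝ} (h : (⨅ j : ℤ, |x + (j : ℝ)|) ≤ c) :
    ∃ j : ℤ, |x + j| ≤ c := by
  refine ⟨-round x, le_trans ?_ h⟩
  refine le_ciInf fun j => ?_
  have := round_le x (-j)
  push_cast at this ⊢
  simpa [sub_eq_add_neg] using this

/-- The set that defines the mixing time is nonempty because $p'$ is invertible modulo $q'$: the
multiples of $p'/q'$ run through all of $\frac1{q'}\mathbb Z$ modulo $1$, and one of them is within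
$1/(2q')$ of $1/(2q)$. The minimum then belongs to the set, and dividing its defining inequality by
$q$ gives the error `e`. -/
theorem mixingTime_spec {q q' : ℕ} {p' : ℤ} (hq : 0 < q) (hq' : 0 < q')
    (hp' : IsCoprime p' (q' : ℤ)) :
    ∃ (h : ℤ) (e : ℝ), |e| ≤ 1 / q' ∧
      (mixingTime q p' q' : ℝ) * ((p' : ℝ) / q') = 1 / (2 * q) + h / q + e := by
  have hqr : (0 : ℝ) < q := by exact_mod_cast hq
  have hqr' : (0 : ℝ) < q' := by exact_mod_cast hq'
  have hne : {m : ℕ | m ≤ q' ∧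
    (⨅ j : ℤ, |(m : ℝ) * ((q : ℝ) * p' / q') - 1 / 2 + (j : ℝ)|) ≤ (q : ℝ) / q'}.Nonempty := by
    obtain ⟨a, b, hab⟩ := hp'
    -- `c / q'` is the fraction closest to `1/(2q)`, and `m` solves `m p' ≡ c` modulo `q'` by the
    -- Bézout relation.
    set c : ℤ := round ((q' : ℝ) / (2 * q)) with hc
    set m : ℤ := (c * a) % q' with hm
    have hq'z : (0 : ℤ) < q' := by exact_mod_cast hq'
    have hm0 : 0 ≤ m := Int.emod_nonneg _ hq'z.ne'
    have hm1 : m < q' := Int.emod_lt_of_pos _ hq'z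
    obtain ⟨n, hn⟩ : ∃ n : ℤ, m * p' = c + n * q' := by
      refine ⟨-(c * b) - (c * a / q') * p', ?_⟩
      have h1 : m = c * a - q' * (c * a / q') := by
        rw [hm, Int.emod_def]
      rw [h1]
      linear_combination c * hab
    have hn' : (m : ℝ) * p' = c + n * q' := by exact_mod_cast hn
    refine ⟨m.toNat, by omega, ?_⟩
    have hcast : ((m.toNat : ℕ) : ℝ) = m := by
      have : ((m.toNat : ℕ) : ℤ) = m := Int.toNat_of_nonneg hm0
      exact_mod_cast this
    refine (ciInf_le ⟨0, ?_⟩ (-(q * n))).trans ?_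
    · rintro _ ⟨j, rfl⟩
      positivity
    · rw [hcast]
      have e1 : (m : ℝ) * ((q : ℝ) * p' / q') - 1 / 2 + ((-(q * n) : ℤ) : ℝ)
          = (c - (q' : ℝ) / (2 * q)) * (q / q') := by
        have : (m : ℝ) * ((q : ℝ) * p' / q') = (c + n * q') * (q / q') := by rw [← hn']; ring
        rw [this]
        push_cast
        field_simp
        ring
      rw [e1, abs_mul, abs_of_pos (div_pos hqr hqr')]
      have := abs_sub_round ((q' : ℝ) / (2 * q))
      rw [abs_sub_comm] at this
      calc _ ≤ (1 / 2) * ((q : ℝ) / q') := by gcongr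
        _ ≤ _ := by
          have : 0 < (q : ℝ) / q' := by positivity
          linarith
  obtain ⟨-, hm⟩ := Nat.sInf_mem hne
  obtain ⟨j, hj⟩ := exists_int_near_of_iInf_le hm
  change |(mixingTime q p' q' : ℝ) * ((q : ℝ) * p' / q') - 1 / 2 + j| ≤ _ at hj
  set m := mixingTime q p' q'
  refine ⟨-j, ((m : ℝ) * ((q : ℝ) * p' / q') - 1 / 2 + j) / q, ?_, ?_⟩
  · rw [abs_div, abs_of_pos hqr, div_le_iff₀ hqr]
    refine hj.trans_eq (by ring)
  · push_cast
    field_simp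
    ring

/-! ### The conjugated rotation -/

theorem lift_rot_pow (α : ℝ) (m : ℕ) (x : ℝ × ℝ) : lift (rot α ^ m) x = x + (m * α, 0) := by
  induction m with
  | zero =>
    have : lift (rot α ^ 0) x = x := by rw [pow_zero]; rfl
    rw [this]
    ext <;> simp
  | succ m ih =>
    have : lift (rot α ^ (m + 1)) x = lift (rot α ^ m) x + (α, 0) := by
      rw [pow_succ', lift_mul]
      rfl
    rw [this, ih]
    ext
    · simp; ring
    · simp

theorem lift_conj_rot (φ : TorusDiff) (α : ℝ) (m : ℕ) (x : ℝ × ℝ) :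
    lift (φ * rot α ^ m * φ⁻¹) x = lift φ (lift φ⁻¹ x + (m * α, 0)) := by
  rw [lift_mul, lift_mul, lift_rot_pow]

/-- The union `Ev` of the even strips is invariant under `f`, so a preimage splits into its parts
inside and outside `Ev`, on which the map is `f` and the identity. -/
theorem measurePreserving_alternateFun {N : ℕ} {f : TorusDiff} (hf : FixesLines N f)
    (hfm : MeasurePreserving (lift f) volume volume) :
    MeasurePreserving (alternateFun N f) volume volume := by
  have hmeas : Measurable (alternateFun N f) := (contDiff_alternateFun hf).continuous.measurable
  refine ⟨hmeas, ?_⟩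
  ext E hE
  rw [Measure.map_apply hmeas hE]
  set Ev : Set (ℝ × ℝ) := {x | Even ⌊(N : ℝ) * x.1⌋} with hEv
  have hEvm : MeasurableSet Ev := by
    have : Measurable fun x : ℝ × ℝ => ⌊(N : ℝ) * x.1⌋ :=
      Int.measurable_floor.comp (measurable_fst.const_mul _)
    exact this (MeasurableSet.of_discrete (s := {z : ℤ | Even z}))
  have h1 : alternateFun N f ⁻¹' E ∩ Ev = lift f ⁻¹' (E ∩ Ev) := by
    ext x
    simp only [mem_inter_iff, mem_preimage, hEv, mem_ofPred_eq, hf.2, alternateFun]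
    by_cases h : Even ⌊(N : ℝ) * x.1⌋ <;> simp [h]
  have h2 : alternateFun N f ⁻¹' E \ Ev = E \ Ev := by
    ext x
    simp only [mem_sdiff, mem_preimage, hEv, mem_ofPred_eq, alternateFun]
    by_cases h : Even ⌊(N : ℝ) * x.1⌋ <;> simp [h]
  rw [← measure_inter_add_sdiff _ hEvm, h1, h2, hfm.measure_preimage (hE.inter hEvm).nullMeasurableSet,
    measure_inter_add_sdiff _ hEvm]

theorem measurePreserving_conj_rot {φ : TorusDiff} (hφ : MeasurePreserving (lift φ) volume volume)
    (α : ℝ) (m : ℕ) : MeasurePreserving (lift (φ * rot α ^ m * φ⁻¹)) volume volume := by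
  have h := hφ.comp ((measurePreserving_add_right volume ((m * α, 0) : ℝ × ℝ)).comp
    (measurePreserving_lift_inv hφ))
  have e : lift (φ * rot α ^ m * φ⁻¹)
      = lift φ ∘ (fun x => x + ((m * α, 0) : ℝ × ℝ)) ∘ lift φ⁻¹ := by
    funext x
    exact lift_conj_rot φ α m x
  rw [e]
  exact h

section Conjugation

variable {n k q : ℕ} (hn : 0 < n) (hk : 0 < k) (hq : 0 < q) {φt i : TorusDiff}
  (hφt : IsInnerRotationA n k q φt) (hi : IsInnerRotationB n k q i)

theorem measurePreserving_conjugation :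
    MeasurePreserving (lift (conjugation hn hk hq hφt hi)) volume volume :=
  measurePreserving_alternateFun ((hi.fixesLines hn hk hq).mul (hφt.fixesLines hk hq))
    (hi.measurePreserving.comp hφt.measurePreserving)

theorem lift_conjugation_of_even {x : ℝ × ℝ} (hx : Even ⌊((2 * q : ℕ) : ℝ) * x.1⌋) :
    lift (conjugation hn hk hq hφt hi) x = lift i (lift φt x) :=
  if_pos hx

theorem lift_conjugation_of_odd {x : ℝ × ℝ} (hx : ¬ Even ⌊((2 * q : ℕ) : ℝ) * x.1⌋) :
    lift (conjugation hn hk hq hφt hi) x = x :=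
  if_neg hx

theorem lift_conjugation_inv_of_even {x : ℝ × ℝ} (hx : Even ⌊((2 * q : ℕ) : ℝ) * x.1⌋) :
    lift (conjugation hn hk hq hφt hi)⁻¹ x = lift φt⁻¹ (lift i⁻¹ x) :=
  if_pos hx

theorem lift_conjugation_inv_of_odd {x : ℝ × ℝ} (hx : ¬ Even ⌊((2 * q : ℕ) : ℝ) * x.1⌋) :
    lift (conjugation hn hk hq hφt hi)⁻¹ x = x :=
  if_neg hx

end Conjugation

/-! ### Unions of cells of a grid -/

/-- The union over `N ∈ s` of the intervals `[(N + σ)/M, (N + 1 - σ)/M]`. -/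
def closedCells (M σ : ℝ) (s : Finset ℤ) : Set ℝ :=
  {x | ∃ N ∈ s, (N : ℝ) + σ ≤ M * x ∧ M * x ≤ N + 1 - σ}

/-- The union over `N ∈ s` of the intervals `((N + σ)/M, (N + 1 - σ)/M)`. -/
def openCells (M σ : ℝ) (s : Finset ℤ) : Set ℝ :=
  {x | ∃ N ∈ s, (N : ℝ) + σ < M * x ∧ M * x < N + 1 - σ}

theorem closedCells_eq {M σ : ℝ} (hM : 0 < M) (s : Finset ℤ) :
    closedCells M σ s = ⋃ N ∈ s, Icc (((N : ℝ) + σ) / M) ((N + 1 - σ) / M) := by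
  ext x
  simp only [closedCells, mem_ofPred_eq, mem_iUnion, mem_Icc, div_le_iff₀ hM, le_div_iff₀ hM,
    mul_comm x M, exists_prop]

theorem openCells_eq {M σ : ℝ} (hM : 0 < M) (s : Finset ℤ) :
    openCells M σ s = ⋃ N ∈ s, Ioo (((N : ℝ) + σ) / M) ((N + 1 - σ) / M) := by
  ext x
  simp only [openCells, mem_ofPred_eq, mem_iUnion, mem_Ioo, div_lt_iff₀ hM, lt_div_iff₀ hM,
    mul_comm x M, exists_prop]

theorem openCells_subset_closedCells (M σ : ℝ) (s : Finset ℤ) :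
    openCells M σ s ⊆ closedCells M σ s :=
  fun _ ⟨N, hN, h1, h2⟩ => ⟨N, hN, h1.le, h2.le⟩

theorem isOpen_openCells (M σ : ℝ) (s : Finset ℤ) : IsOpen (openCells M σ s) := by
  have : openCells M σ s = ⋃ N ∈ s, {x : ℝ | (N : ℝ) + σ < M * x ∧ M * x < N + 1 - σ} := by
    ext x
    simp only [openCells, mem_ofPred_eq, mem_iUnion, exists_prop]
  rw [this]
  refine isOpen_biUnion fun N _ => ?_
  have hc : Continuous fun x : ℝ => M * x := by fun_prop
  exact (isOpen_lt continuous_const hc).inter (isOpen_lt hc continuous_const)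

theorem isCompact_closedCells {M : ℝ} (hM : 0 < M) (σ : ℝ) (s : Finset ℤ) :
    IsCompact (closedCells M σ s) := by
  rw [closedCells_eq hM]
  exact s.isCompact_biUnion fun N _ => isCompact_Icc

theorem volume_closedCells_le {M : ℝ} (hM : 0 < M) (σ : ℝ) (s : Finset ℤ) :
    volume (closedCells M σ s) ≤ ENNReal.ofReal (s.card * ((1 - 2 * σ) / M)) := by
  rw [closedCells_eq hM]
  refine (measure_biUnion_finset_le _ _).trans_eq ?_
  have : ∀ N ∈ s, volume (Icc (((N : ℝ) + σ) / M) ((N + 1 - σ) / M))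
      = ENNReal.ofReal ((1 - 2 * σ) / M) := by
    intro N _
    rw [Real.volume_Icc]
    congr 1
    ring
  rw [Finset.sum_congr rfl this, Finset.sum_const, nsmul_eq_mul,
    ENNReal.ofReal_mul (Nat.cast_nonneg _), ENNReal.ofReal_natCast]

theorem volume_openCells {M σ : ℝ} (hM : 0 < M) (hσ : 0 ≤ σ) (s : Finset ℤ) :
    volume (openCells M σ s) = ENNReal.ofReal (s.card * ((1 - 2 * σ) / M)) := by
  rw [openCells_eq hM, measure_biUnion_finset]
  · have : ∀ N ∈ s, volume (Ioo (((N : ℝ) + σ) / M) ((N + 1 - σ) / M))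
        = ENNReal.ofReal ((1 - 2 * σ) / M) := by
      intro N _
      rw [Real.volume_Ioo]
      congr 1
      ring
    rw [Finset.sum_congr rfl this, Finset.sum_const, nsmul_eq_mul,
      ENNReal.ofReal_mul (Nat.cast_nonneg _), ENNReal.ofReal_natCast]
  · intro N _ L _ hNL
    rw [Function.onFun, disjoint_left]
    rintro x ⟨h1, h2⟩ ⟨h3, h4⟩
    rw [div_lt_iff₀ hM] at h1 h3
    rw [lt_div_iff₀ hM] at h2 h4
    apply hNL
    have h5 : (N : ℝ) < L + 1 := by linarith
    have h6 : (L : ℝ) < N + 1 := by linarith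
    have h5' : N < L + 1 := by exact_mod_cast h5
    have h6' : L < N + 1 := by exact_mod_cast h6
    omega
  · exact fun N _ => measurableSet_Ioo

/-! ### The index sets of the partition -/

/-- The indices `1, …, K - 2`. -/
noncomputable def innerIndices (K : ℕ) : Finset ℤ := Finset.Icc 1 ((K : ℤ) - 2)

/-- The indices `B + c₁ K + c₂` with `c₁ ∈ s` and `c₂ ∈ t`. -/
def digitPairs (K B : ℤ) (s t : Finset ℤ) : Finset ℤ :=
  (s ×ˢ t).image fun c => B + c.1 * K + c.2

theorem mem_digitPairs {K B N : ℤ} {s t : Finset ℤ} :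
    N ∈ digitPairs K B s t ↔ ∃ c₁ ∈ s, ∃ c₂ ∈ t, N = B + c₁ * K + c₂ := by
  simp only [digitPairs, Finset.mem_image, Finset.mem_product, Prod.exists]
  constructor
  · rintro ⟨a, b, ⟨ha, hb⟩, rfl⟩
    exact ⟨a, ha, b, hb, rfl⟩
  · rintro ⟨a, ha, b, hb, rfl⟩
    exact ⟨a, b, ⟨ha, hb⟩, rfl⟩

theorem card_digitPairs_le (K B : ℤ) (s t : Finset ℤ) :
    (digitPairs K B s t).card ≤ s.card * t.card :=
  Finset.card_image_le.trans_eq (Finset.card_product s t)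

/-- Uniqueness of division with remainder by `K`; only the lower digit has to be restricted. -/
theorem card_digitPairs {K : ℤ} (B : ℤ) {s t : Finset ℤ} (ht : ∀ c ∈ t, 0 ≤ c ∧ c < K) :
    (digitPairs K B s t).card = s.card * t.card := by
  rw [← Finset.card_product]
  refine Finset.card_image_of_injOn ?_
  rintro ⟨a, b⟩ h ⟨a', b'⟩ h' heq
  simp only [Finset.coe_product, mem_prod, Finset.mem_coe] at h h' heq
  obtain ⟨h1, h2⟩ := ht b h.2
  obtain ⟨h3, h4⟩ := ht b' h'.2
  have hK : 0 < K := h1.trans_lt h2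
  have e : b + K * a = b' + K * a' := by linarith
  have e1 : (b + K * a) % K = (b' + K * a') % K := by rw [e]
  rw [Int.add_mul_emod_self_left, Int.add_mul_emod_self_left, Int.emod_eq_of_lt h1 h2,
    Int.emod_eq_of_lt h3 h4] at e1
  have e2 : K * a = K * a' := by linarith
  exact Prod.ext (mul_left_cancel₀ hK.ne' e2) e1

theorem mem_innerIndices {K : ℕ} {c : ℤ} : c ∈ innerIndices K ↔ 1 ≤ c ∧ c ≤ (K : ℤ) - 2 :=
  Finset.mem_Icc

theorem card_innerIndices {K : ℕ} (hK : 2 ≤ K) : ((innerIndices K).card : ℝ) = K - 2 := by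
  rw [innerIndices, Int.card_Icc]
  have : ((((K : ℤ) - 2 + 1 - 1).toNat : ℕ) : ℤ) = K - 2 := by omega
  exact_mod_cast this

/-- The indices `2q ≤ v₁ ≤ 2k⁶q - 2q - 1`. -/
noncomputable def rowIndices (k q : ℕ) : Finset ℤ := Finset.Icc (2 * q) (2 * (k : ℤ) ^ 6 * q - 2 * q - 1)

theorem mem_rowIndices {k q : ℕ} {c : ℤ} :
    c ∈ rowIndices k q ↔ 2 * (q : ℤ) ≤ c ∧ c ≤ 2 * (k : ℤ) ^ 6 * q - 2 * q - 1 :=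
  Finset.mem_Icc

theorem card_rowIndices {k q : ℕ} (hk : 2 ≤ k) :
    ((rowIndices k q).card : ℝ) = 2 * (k : ℝ) ^ 6 * q - 4 * q := by
  rw [rowIndices, Int.card_Icc]
  have h1 : (2 : ℤ) ≤ (k : ℤ) ^ 6 := by
    have : 2 ^ 1 ≤ k ^ 6 := (Nat.pow_le_pow_left hk 1).trans (Nat.pow_le_pow_right (by omega) (by norm_num))
    exact_mod_cast this
  have h2 : 0 ≤ ((k : ℤ) ^ 6 - 2) * q := mul_nonneg (by linarith) (by positivity)
  have : (((2 * (k : ℤ) ^ 6 * q - 2 * q - 1 + 1 - 2 * q).toNat : ℕ) : ℤ)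
      = 2 * (k : ℤ) ^ 6 * q - 4 * q := by
    rw [Int.toNat_of_nonneg (by linarith)]
    ring
  exact_mod_cast this

/-! ### Images of intervals on the circle -/

/-- A set within one period injects into the circle. Compactness makes its image closed, hence
measurable. -/
theorem volume_coe_image_le {c : ℝ} {T : Set ℝ} (hT : IsCompact T) (hTc : T ⊆ Ico c (c + 1)) :
    MeasurableSet ((fun t : ℝ => (t : UnitAddCircle)) '' T) ∧
      volume ((fun t : ℝ => (t : UnitAddCircle)) '' T) ≤ volume T := by
  have hm : MeasurableSet ((fun t : ℝ => (t : UnitAddCircle)) '' T) :=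
    (hT.image (AddCircle.continuous_mk' 1)).isClosed.measurableSet
  refine ⟨hm, ?_⟩
  have hp := UnitAddCircle.measurePreserving_mk c
  rw [← restrict_Ico_eq_restrict_Ioc] at hp
  rw [← hp.measure_preimage hm.nullMeasurableSet,
    Measure.restrict_apply (AddCircle.measurable_mk' hm)]
  refine measure_mono ?_
  rintro y ⟨⟨t, ht, hty⟩, hy⟩
  have := (AddCircle.coe_eq_coe_iff_of_mem_Ico (p := 1) (a := c) (hTc ht) hy).mp hty
  rwa [← this]

/-! ### The hierarchy of scales -/

/-- The standing inequalities between the parameters; `e` is the distance of the rotation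
`m p'/q'` from `1/(2q) + h/q`. -/
structure Scale (n k q : ℕ) (e : ℝ) : Prop where
  n_pos : 0 < n
  k_ge : 20 * n ^ 5 ≤ k
  q_pos : 0 < q
  shift_le : |2 * (k : ℝ) ^ 16 * q * e| ≤ 1 / 16

/-- The fourth power of `2k < q^(1/4)` is `16 k⁴ < q`, and `q' > 2 k¹² q²` bounds the scaled error
by `k⁴ / q`. Thus the rotation error is at most a sixteenth of the side of the smallest squares. -/
theorem scale_of_lt {n k q q' : ℕ} (hn : 0 < n) (hk : 0 < k) (hq : 0 < q) (hkn : 20 * n ^ 5 ≤ k)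
    (hqk : 2 * (k : ℝ) < (q : ℝ) ^ (1 / 4 : ℝ)) (hq' : 2 * k ^ 12 * q ^ 2 < q') {e : ℝ}
    (he : |e| ≤ 1 / q') : Scale n k q e := by
  refine ⟨hn, hkn, hq, ?_⟩
  have hkr : (0 : ℝ) < k := by exact_mod_cast hk
  have hqr : (0 : ℝ) < q := by exact_mod_cast hq
  have hq4 : 16 * (k : ℝ) ^ 4 < q := by
    have h := pow_lt_pow_left₀ hqk (by positivity) (by norm_num : (4 : ℕ) ≠ 0)
    rw [← Real.rpow_natCast ((q : ℝ) ^ (1 / 4 : ℝ)), ← Real.rpow_mul hqr.le] at h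
    norm_num at h
    linarith
  have hq'r : 2 * (k : ℝ) ^ 12 * (q : ℝ) ^ 2 < q' := by exact_mod_cast hq'
  have hpos : 0 < 2 * (k : ℝ) ^ 12 * (q : ℝ) ^ 2 := by positivity
  rw [abs_mul, abs_of_pos (by positivity : 0 < 2 * (k : ℝ) ^ 16 * q)]
  calc 2 * (k : ℝ) ^ 16 * q * |e| ≤ 2 * (k : ℝ) ^ 16 * q * (1 / (2 * (k : ℝ) ^ 12 * (q : ℝ) ^ 2)) := by
        gcongr
        exact he.trans (one_div_le_one_div_of_le hpos hq'r.le)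
    _ = (k : ℝ) ^ 4 / q := by field_simp
    _ ≤ 1 / 16 := by
        rw [div_le_iff₀ hqr]
        linarith

namespace Scale

variable {n k q : ℕ} {e : ℝ}

theorem one_le_n (H : Scale n k q e) : (1 : ℝ) ≤ n := by exact_mod_cast H.n_pos

theorem one_le_n_pow (H : Scale n k q e) : (1 : ℝ) ≤ (n : ℝ) ^ 5 := one_le_pow₀ H.one_le_n

theorem k_ge_real (H : Scale n k q e) : 20 * (n : ℝ) ^ 5 ≤ k := by exact_mod_cast H.k_ge

theorem twenty_le (H : Scale n k q e) : (20 : ℝ) ≤ k := by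
  linarith [H.k_ge_real, H.one_le_n_pow]

theorem twenty_le_nat (H : Scale n k q e) : 20 ≤ k := by exact_mod_cast H.twenty_le

theorem one_le_q (H : Scale n k q e) : (1 : ℝ) ≤ q := by exact_mod_cast H.q_pos

theorem k_le_pow (H : Scale n k q e) : (k : ℝ) ≤ (k : ℝ) ^ 5 :=
  le_self_pow₀ (by linarith [H.twenty_le]) (by norm_num)

theorem twenty_le_pow (H : Scale n k q e) : 20 ≤ k ^ 5 :=
  H.twenty_le_nat.trans (Nat.le_self_pow (by norm_num) k)

end Scale

/-! ### The cells in scaled coordinates -/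

section Scaled

variable {n k q : ℕ} {e : ℝ}

theorem mem_gridSquare (H : Scale n k q e) {U V : ℤ} {x : ℝ × ℝ} :
    x ∈ gridSquare k q U V ↔
      ((U : ℝ) ≤ 2 * k ^ 11 * q * x.1 ∧ 2 * k ^ 11 * q * x.1 ≤ U + 1) ∧
      ((V : ℝ) ≤ 2 * k ^ 11 * q * x.2 ∧ 2 * k ^ 11 * q * x.2 ≤ V + 1) := by
  have hk : (0 : ℝ) < k := by linarith [H.twenty_le]
  have hq : (0 : ℝ) < q := by linarith [H.one_le_q]
  have ha : (0 : ℝ) < 2 * k ^ 11 * q := by positivity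
  simp only [gridSquare, mem_prod, mem_Icc, div_le_iff₀ ha, le_div_iff₀ ha,
    mul_comm _ (2 * (k : ℝ) ^ 11 * q)]

/-- Lengths are measured in units of `1/(2k¹⁶q)`, the side of the smallest squares. There the
margins of a cell are `1/(2n⁵)` horizontally and `kq/n⁵` vertically; the cruder `1/2` and `kq` are
free of `n`. -/
theorem mem_columnCell (H : Scale n k q e) {l v : ℤ} {t₁ t₂ : ℕ} {x : ℝ × ℝ}
    (h1 : (l : ℝ) * k ^ 15 + t₁ * k ^ 10 + 1 / 2 ≤ 2 * k ^ 16 * q * x.1)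
    (h2 : 2 * k ^ 16 * q * x.1 ≤ (l : ℝ) * k ^ 15 + (t₁ + 1) * k ^ 10 - 1 / 2)
    (h3 : 2 * k ^ 11 * q * ((v : ℝ) * k ^ 5 + t₂) + k * q ≤ 2 * k ^ 16 * q * x.2)
    (h4 : 2 * k ^ 16 * q * x.2 ≤ 2 * k ^ 11 * q * ((v : ℝ) * k ^ 5 + t₂ + 1) - k * q) :
    x ∈ columnCell n k q l v t₁ t₂ := by
  have hk : (0 : ℝ) < k := by linarith [H.twenty_le]
  have hq : (0 : ℝ) < q := by linarith [H.one_le_q]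
  have hn : (0 : ℝ) < n := by linarith [H.one_le_n]
  have hM : (0 : ℝ) < 2 * k ^ 16 * q := by positivity
  have hn5 : 1 / (n : ℝ) ^ 5 ≤ 1 := by
    rw [div_le_one (by positivity)]
    exact H.one_le_n_pow
  have hn6 : k * q * (1 / (n : ℝ) ^ 5) ≤ k * q := by
    exact mul_le_of_le_one_right (by positivity) hn5
  refine ⟨⟨?_, ?_⟩, ?_, ?_⟩
  · refine le_of_mul_le_mul_left (le_trans ?_ h1) hM
    have : 2 * (k : ℝ) ^ 16 * q * ((l : ℝ) / (2 * k * q)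
        + (t₁ + 1 / (2 * n ^ 5 * k ^ 10)) / (2 * k ^ 6 * q))
        = (l : ℝ) * k ^ 15 + t₁ * k ^ 10 + (1 / (n : ℝ) ^ 5) / 2 := by
      field_simp
      ring
    rw [this]
    linarith
  · refine le_of_mul_le_mul_left (h2.trans ?_) hM
    have : 2 * (k : ℝ) ^ 16 * q * ((l : ℝ) / (2 * k * q)
        + (t₁ + 1 - 1 / (2 * n ^ 5 * k ^ 10)) / (2 * k ^ 6 * q))
        = (l : ℝ) * k ^ 15 + (t₁ + 1) * k ^ 10 - (1 / (n : ℝ) ^ 5) / 2 := by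
      field_simp
      ring
    rw [this]
    linarith
  · refine le_of_mul_le_mul_left (le_trans ?_ h3) hM
    have : 2 * (k : ℝ) ^ 16 * q * ((v : ℝ) + (t₂ + 1 / (2 * n ^ 5 * k ^ 10)) / k ^ 5)
        = 2 * k ^ 11 * q * ((v : ℝ) * k ^ 5 + t₂) + k * q * (1 / (n : ℝ) ^ 5) := by
      field_simp
      ring
    rw [this]
    linarith
  · refine le_of_mul_le_mul_left (h4.trans ?_) hM
    have : 2 * (k : ℝ) ^ 16 * q * ((v : ℝ) + (t₂ + 1 - 1 / (2 * n ^ 5 * k ^ 10)) / k ^ 5)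
        = 2 * k ^ 11 * q * ((v : ℝ) * k ^ 5 + t₂ + 1) - k * q * (1 / (n : ℝ) ^ 5) := by
      field_simp
      ring
    rw [this]
    linarith

/-- The relative margin of the cells on which the second inner rotation is a rotation. -/
noncomputable def rotationMargin (n k : ℕ) : ℝ := 1 / ((n : ℝ) ^ 5 * k ^ 11)

/-- The relative margin of the small squares of the partition. -/
noncomputable def squareMargin (n k : ℕ) : ℝ := 1 / (2 * (n : ℝ) ^ 5 * k ^ 10)

theorem mem_gridCell (H : Scale n k q e) {l : ℤ} {u : ℕ} {v : ℤ} {s₁ s₂ : ℕ} {x : ℝ × ℝ}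
    (h1 : (l : ℝ) * k ^ 15 + u * k ^ 5 + s₁ + rotationMargin n k ≤ 2 * k ^ 16 * q * x.1)
    (h2 : 2 * k ^ 16 * q * x.1 ≤ (l : ℝ) * k ^ 15 + u * k ^ 5 + s₁ + 1 - rotationMargin n k)
    (h3 : (v : ℝ) * k ^ 5 + s₂ + rotationMargin n k ≤ 2 * k ^ 16 * q * x.2)
    (h4 : 2 * k ^ 16 * q * x.2 ≤ (v : ℝ) * k ^ 5 + s₂ + 1 - rotationMargin n k) :
    x ∈ gridCell n k q l u v s₁ s₂ := by
  have hk : (0 : ℝ) < k := by linarith [H.twenty_le]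
  have hq : (0 : ℝ) < q := by linarith [H.one_le_q]
  have hn : (0 : ℝ) < n := by linarith [H.one_le_n]
  have hM : (0 : ℝ) < 2 * k ^ 16 * q := by positivity
  unfold rotationMargin at h1 h2 h3 h4
  refine ⟨⟨?_, ?_⟩, ?_, ?_⟩
  · refine le_of_mul_le_mul_left (le_trans (le_of_eq ?_) h1) hM
    field_simp
    ring
  · refine le_of_mul_le_mul_left (h2.trans (le_of_eq ?_)) hM
    field_simp
    ring
  · refine le_of_mul_le_mul_left (le_trans (le_of_eq ?_) h3) hM
    field_simp
    ring
  · refine le_of_mul_le_mul_left (h4.trans (le_of_eq ?_)) hM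
    field_simp
    ring

theorem mem_smallSquare (H : Scale n k q e) {u₀ u₁ u₂ u₃ u₄ v₀ v₁ v₂ : ℕ} {x : ℝ × ℝ} :
    x ∈ smallSquare n k q u₀ u₁ u₂ u₃ u₄ v₀ v₁ v₂ ↔
      ((((u₀ * k + u₁) * k ^ 15 + u₂ * k ^ 10 + u₃ * k ^ 5 + u₄ : ℝ) + squareMargin n k
          ≤ 2 * k ^ 16 * q * x.1) ∧
        2 * k ^ 16 * q * x.1 ≤ ((u₀ * k + u₁) * k ^ 15 + u₂ * k ^ 10 + u₃ * k ^ 5 + u₄ : ℝ) + 1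
          - squareMargin n k) ∧
      (((v₀ * (2 * k ^ 11 * q) + v₁ * k ^ 5 + v₂ : ℝ) + squareMargin n k
          ≤ 2 * k ^ 16 * q * x.2) ∧
        2 * k ^ 16 * q * x.2 ≤ (v₀ * (2 * k ^ 11 * q) + v₁ * k ^ 5 + v₂ : ℝ) + 1
          - squareMargin n k) := by
  have hk : (0 : ℝ) < k := by linarith [H.twenty_le]
  have hq : (0 : ℝ) < q := by linarith [H.one_le_q]
  have hn : (0 : ℝ) < n := by linarith [H.one_le_n]
  have hM : (0 : ℝ) < 2 * k ^ 16 * q := by positivity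
  have key1 : ∀ A B t : ℝ, 2 * k ^ 16 * q * A = B → (A ≤ t ↔ B ≤ 2 * k ^ 16 * q * t) := by
    rintro A B t rfl
    exact (mul_le_mul_iff_right₀ hM).symm
  have key2 : ∀ A B t : ℝ, 2 * k ^ 16 * q * A = B → (t ≤ A ↔ 2 * k ^ 16 * q * t ≤ B) := by
    rintro A B t rfl
    exact (mul_le_mul_iff_right₀ hM).symm
  unfold smallSquare squareMargin
  refine and_congr (and_congr (key1 _ _ _ ?_) (key2 _ _ _ ?_))
    (and_congr (key1 _ _ _ ?_) (key2 _ _ _ ?_))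
  · field_simp
    ring
  · field_simp
    ring
  · field_simp
    ring
  · field_simp
    ring

/-! ### The segments as unions of cells -/

/-- The horizontal indices of the segment `(u₀, u₁)`. -/
noncomputable def xIndices (k u₀ u₁ : ℕ) : Finset ℤ :=
  digitPairs ((k : ℤ) ^ 5) ((u₀ * k + u₁) * k ^ 15)
    (digitPairs ((k : ℤ) ^ 5) 0 (innerIndices (k ^ 5)) (innerIndices (k ^ 5)))
    (innerIndices (k ^ 5))

/-- The vertical indices of the segments over `v₀`. -/
noncomputable def yIndices (k q v₀ : ℕ) : Finset ℤ :=
  digitPairs ((k : ℤ) ^ 5) (v₀ * (2 * k ^ 11 * q)) (rowIndices k q) (innerIndices (k ^ 5))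

/-- The digits `1 ≤ d ≤ k⁵ - 2`. -/
def IsInner (k d : ℕ) : Prop := 1 ≤ d ∧ d + 2 ≤ k ^ 5

theorem mem_innerIndices_pow {k : ℕ} {c : ℤ} :
    c ∈ innerIndices (k ^ 5) ↔ ∃ d : ℕ, IsInner k d ∧ c = d := by
  rw [mem_innerIndices]
  constructor
  · rintro ⟨h1, h2⟩
    lift c to ℕ using by omega
    exact ⟨c, ⟨by omega, by omega⟩, rfl⟩
  · rintro ⟨d, ⟨h1, h2⟩, rfl⟩
    constructor <;> omega

theorem IsInner.le_real {k d : ℕ} (h : IsInner k d) : (1 : ℝ) ≤ d ∧ (d : ℝ) + 2 ≤ (k : ℝ) ^ 5 :=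
  ⟨by exact_mod_cast h.1, by exact_mod_cast h.2⟩

theorem mem_xIndices {u₀ u₁ : ℕ} {N : ℤ} : N ∈ xIndices k u₀ u₁ ↔
    ∃ u₂ u₃ u₄ : ℕ, IsInner k u₂ ∧ IsInner k u₃ ∧ IsInner k u₄ ∧
      N = (u₀ * k + u₁) * k ^ 15 + u₂ * k ^ 10 + u₃ * k ^ 5 + u₄ := by
  simp only [xIndices, mem_digitPairs, mem_innerIndices_pow]
  constructor
  · rintro ⟨_, ⟨_, ⟨u₂, h2, rfl⟩, _, ⟨u₃, h3, rfl⟩, rfl⟩, _, ⟨u₄, h4, rfl⟩, rfl⟩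
    exact ⟨u₂, u₃, u₄, h2, h3, h4, by ring⟩
  · rintro ⟨u₂, u₃, u₄, h2, h3, h4, rfl⟩
    exact ⟨_, ⟨_, ⟨u₂, h2, rfl⟩, _, ⟨u₃, h3, rfl⟩, rfl⟩, _, ⟨u₄, h4, rfl⟩, by ring⟩

/-- The rows `2q ≤ v₁ ≤ 2k⁶q - 2q - 1`. -/
def IsRow (k q v : ℕ) : Prop := 2 * q ≤ v ∧ v + 2 * q + 1 ≤ 2 * k ^ 6 * q

theorem IsRow.le_real {k q v : ℕ} (h : IsRow k q v) :
    2 * (q : ℝ) ≤ v ∧ (v : ℝ) + 2 * q + 1 ≤ 2 * (k : ℝ) ^ 6 * q :=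
  ⟨by exact_mod_cast h.1, by exact_mod_cast h.2⟩

theorem mem_rowIndices_iff {c : ℤ} : c ∈ rowIndices k q ↔ ∃ v : ℕ, IsRow k q v ∧ c = v := by
  rw [mem_rowIndices]
  constructor
  · rintro ⟨h1, h2⟩
    lift c to ℕ using by omega
    have h2' : (c : ℤ) + 2 * q + 1 ≤ 2 * (k : ℤ) ^ 6 * q := by linarith
    exact ⟨c, ⟨by exact_mod_cast h1, by exact_mod_cast h2'⟩, rfl⟩
  · rintro ⟨d, ⟨h1, h2⟩, rfl⟩
    have h2' : (d : ℤ) + 2 * q + 1 ≤ 2 * (k : ℤ) ^ 6 * q := by exact_mod_cast h2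
    exact ⟨by exact_mod_cast h1, by linarith⟩

theorem mem_yIndices {v₀ : ℕ} {N : ℤ} : N ∈ yIndices k q v₀ ↔
    ∃ v₁ v₂ : ℕ, IsRow k q v₁ ∧ IsInner k v₂ ∧
      N = v₀ * (2 * k ^ 11 * q) + v₁ * k ^ 5 + v₂ := by
  simp only [yIndices, mem_digitPairs, mem_innerIndices_pow, mem_rowIndices_iff]
  constructor
  · rintro ⟨_, ⟨v₁, h1, rfl⟩, _, ⟨v₂, h2, rfl⟩, rfl⟩
    exact ⟨v₁, v₂, h1, h2, rfl⟩
  · rintro ⟨v₁, v₂, h1, h2, rfl⟩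
    exact ⟨_, ⟨v₁, h1, rfl⟩, _, ⟨v₂, h2, rfl⟩, rfl⟩

/-- The segment `Ĩ^{u₀,u₁}_{v₀}` in the plane. -/
noncomputable def planeSegment (n k q u₀ v₀ u₁ : ℕ) : Set (ℝ × ℝ) :=
  closedCells (2 * k ^ 16 * q) (squareMargin n k) (xIndices k u₀ u₁) ×ˢ
    closedCells (2 * k ^ 16 * q) (squareMargin n k) (yIndices k q v₀)

/-- Horizontal and vertical digits vary independently, so the union of squares is a product of two
one-dimensional unions of intervals. -/
theorem tildeSegment_eq (H : Scale n k q e) (u₀ v₀ u₁ : ℕ) :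
    tildeSegment n k q u₀ v₀ u₁ = proj '' planeSegment n k q u₀ v₀ u₁ := by
  ext p
  constructor
  · rintro ⟨u₂, u₃, u₄, v₁, v₂, h2, h3, h4, hv1, hv2, x, hx, rfl⟩
    rw [mem_smallSquare H] at hx
    refine ⟨x, ⟨⟨_, mem_xIndices.mpr ⟨u₂, u₃, u₄, h2, h3, h4, rfl⟩, ?_⟩,
      ⟨_, mem_yIndices.mpr ⟨v₁, v₂, hv1, hv2, rfl⟩, ?_⟩⟩, rfl⟩
    · push_cast
      exact hx.1
    · push_cast
      exact hx.2
  · rintro ⟨x, ⟨⟨N, hN, h1⟩, L, hL, h2⟩, rfl⟩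
    obtain ⟨u₂, u₃, u₄, hu2, hu3, hu4, rfl⟩ := mem_xIndices.mp hN
    obtain ⟨v₁, v₂, hv1, hv2, rfl⟩ := mem_yIndices.mp hL
    refine ⟨u₂, u₃, u₄, v₁, v₂, hu2, hu3, hu4, hv1, hv2, x, ?_, rfl⟩
    rw [mem_smallSquare H]
    push_cast at h1 h2
    exact ⟨h1, h2⟩

end Scaled

/-! ### The action of the conjugated rotation on grid squares -/

section Dynamics

variable {n k q : ℕ} {e : ℝ}

theorem Scale.abs_shift_le (H : Scale n k q e) :
    -(1 / 16) ≤ 2 * (k : ℝ) ^ 11 * q * e ∧ 2 * (k : ℝ) ^ 11 * q * e ≤ 1 / 16 := by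
  have h := H.shift_le
  have hk : (1 : ℝ) ≤ (k : ℝ) ^ 5 := by linarith [H.twenty_le, H.k_le_pow]
  have e1 : 2 * (k : ℝ) ^ 16 * q * e = (k : ℝ) ^ 5 * (2 * (k : ℝ) ^ 11 * q * e) := by ring
  rw [e1, abs_mul, abs_of_nonneg (by positivity : (0 : ℝ) ≤ (k : ℝ) ^ 5)] at h
  refine abs_le.mp (le_trans ?_ h)
  exact le_mul_of_one_le_left (abs_nonneg _) hk

theorem gridSquare_add (H : Scale n k q e) {U V c d : ℤ} {x τ : ℝ × ℝ}
    (hx : x ∈ gridSquare k q U V) (h1 : 2 * (k : ℝ) ^ 11 * q * τ.1 = c)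
    (h2 : 2 * (k : ℝ) ^ 11 * q * τ.2 = d) : x + τ ∈ gridSquare k q (U + c) (V + d) := by
  rw [mem_gridSquare H] at hx ⊢
  push_cast
  simp only [Prod.fst_add, Prod.snd_add, mul_add, h1, h2]
  obtain ⟨⟨_, _⟩, _, _⟩ := hx
  refine ⟨⟨?_, ?_⟩, ?_, ?_⟩ <;> linarith

theorem floor_eq_of_mem (H : Scale n k q e) {u : ℤ} {t : ℝ}
    (h1 : (u : ℝ) * k ^ 11 ≤ 2 * k ^ 11 * q * t) (h2 : 2 * k ^ 11 * q * t < (u + 1) * k ^ 11) :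
    ⌊((2 * q : ℕ) : ℝ) * t⌋ = u := by
  have hk : (0 : ℝ) < (k : ℝ) ^ 11 := pow_pos (by linarith [H.twenty_le]) _
  rw [Int.floor_eq_iff]
  push_cast
  constructor
  · refine le_of_mul_le_mul_right (h1.trans_eq ?_) hk
    ring
  · refine lt_of_mul_lt_mul_right (lt_of_eq_of_lt ?_ h2) hk.le
    ring

/-- A grid square with inner digits `u₂`, `u₃` lies well inside the strip. -/
theorem strip_bounds (H : Scale n k q e) {u u₁ u₂ u₃ : ℝ} (hu1 : 0 ≤ u₁) (hu1k : u₁ + 1 ≤ k)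
    (h2 : 1 ≤ u₂ ∧ u₂ + 2 ≤ (k : ℝ) ^ 5) (h3 : 1 ≤ u₃ ∧ u₃ + 2 ≤ (k : ℝ) ^ 5) :
    u * k ^ 11 + 1 ≤ (k * u + u₁) * k ^ 10 + u₂ * k ^ 5 + u₃ ∧
      (k * u + u₁) * k ^ 10 + u₂ * k ^ 5 + u₃ + 1 ≤ (u + 1) * k ^ 11 - 1 := by
  have hK := H.k_le_pow
  have hk := H.twenty_le
  have e10 : (k : ℝ) ^ 10 = k ^ 5 * k ^ 5 := by ring
  have e11 : (k : ℝ) ^ 11 = k * k ^ 10 := by ring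
  have h10 : (0 : ℝ) ≤ (k : ℝ) ^ 10 := by positivity
  have a1 : 0 ≤ u₁ * (k : ℝ) ^ 10 := by positivity
  have a2 : 0 ≤ u₂ * (k : ℝ) ^ 5 := mul_nonneg (by linarith) (by positivity)
  have a3 := mul_le_mul_of_nonneg_right hu1k h10
  have a4 := mul_le_mul_of_nonneg_right h2.2 (by positivity : (0 : ℝ) ≤ (k : ℝ) ^ 5)
  constructor
  · rw [e11]
    linarith
  · rw [e11]
    linarith

/-- This is what the ranges of `u₃` and `v₁` are for: they keep the grid square at least one square
away from the vertical sides, and `2q` rows away from the horizontal sides, of its `1/(2k⁶q) × 1/k⁵`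
cell, which exceeds the margins on which the quarter turn is not controlled. -/
theorem mem_columnCell_of_gridSquare (H : Scale n k q e) {l : ℤ} {t₁ t₂ u₃ v₁ : ℕ} {y : ℝ × ℝ}
    (h3 : IsInner k u₃) (hv : IsRow k q v₁)
    (hy : y ∈ gridSquare k q (l * k ^ 10 + t₁ * k ^ 5 + u₃) (t₂ * (2 * k ^ 6 * q) + v₁)) :
    y ∈ columnCell n k q l 0 t₁ t₂ := by
  rw [mem_gridSquare H] at hy
  push_cast at hy
  obtain ⟨⟨b1, b2⟩, b3, b4⟩ := hy
  have hK := H.k_le_pow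
  have hk := H.twenty_le
  have hq := H.one_le_q
  have i3 := h3.le_real
  have iv := hv.le_real
  have hK0 : (0 : ℝ) ≤ (k : ℝ) ^ 5 := by positivity
  have eM : ∀ t : ℝ, 2 * (k : ℝ) ^ 16 * q * t = (k : ℝ) ^ 5 * (2 * k ^ 11 * q * t) := by
    intro t; ring
  have hkq : (k : ℝ) * q ≤ (k : ℝ) ^ 5 * q := mul_le_mul_of_nonneg_right hK (by linarith)
  apply mem_columnCell H
  · rw [eM]
    have := mul_le_mul_of_nonneg_left
      (by linarith : (l : ℝ) * k ^ 10 + t₁ * k ^ 5 + 1 / 2 ≤ 2 * k ^ 11 * q * y.1) hK0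
    refine le_trans ?_ this
    have : (k : ℝ) ^ 5 * (l * k ^ 10 + t₁ * k ^ 5 + 1 / 2)
      = l * k ^ 15 + t₁ * k ^ 10 + k ^ 5 / 2 := by ring
    rw [this]
    linarith
  · rw [eM]
    have := mul_le_mul_of_nonneg_left
      (by linarith : 2 * k ^ 11 * q * y.1 ≤ (l : ℝ) * k ^ 10 + (t₁ + 1) * k ^ 5 - 1 / 2) hK0
    refine this.trans ?_
    have : (k : ℝ) ^ 5 * (l * k ^ 10 + (t₁ + 1) * k ^ 5 - 1 / 2)
      = l * k ^ 15 + (t₁ + 1) * k ^ 10 - k ^ 5 / 2 := by ring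
    rw [this]
    linarith
  · rw [eM]
    have := mul_le_mul_of_nonneg_left
      (by linarith : (t₂ : ℝ) * (2 * k ^ 6 * q) + 2 * q ≤ 2 * k ^ 11 * q * y.2) hK0
    refine le_trans ?_ this
    have e1 : (k : ℝ) ^ 5 * (t₂ * (2 * k ^ 6 * q) + 2 * q)
      = 2 * k ^ 11 * q * t₂ + 2 * (k ^ 5 * q) := by ring
    push_cast
    rw [e1]
    nlinarith
  · rw [eM]
    have := mul_le_mul_of_nonneg_left
      (by linarith : 2 * k ^ 11 * q * y.2 ≤ ((t₂ : ℝ) + 1) * (2 * k ^ 6 * q) - 2 * q) hK0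
    refine this.trans ?_
    have e1 : (k : ℝ) ^ 5 * ((t₂ + 1) * (2 * k ^ 6 * q) - 2 * q)
      = 2 * k ^ 11 * q * (t₂ + 1) - 2 * (k ^ 5 * q) := by ring
    push_cast
    rw [e1]
    nlinarith

variable {φt i : TorusDiff}

/-- Over an odd strip `Φ` is a translation followed by `i`. -/
theorem lift_of_odd (H : Scale n k q e) (hn : 0 < n) (hk : 0 < k) (hq : 0 < q)
    (hφt : IsInnerRotationA n k q φt) (hi : IsInnerRotationB n k q i) {α : ℝ} {m : ℕ} {h : ℤ}
    (hm : (m : ℝ) * α = 1 / (2 * q) + h / q + e) {u₀ u₁ u₂ u₃ v₀ v₁ : ℕ} (hu0 : ¬ Even u₀)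
    (hu1 : u₁ < k) (h2 : IsInner k u₂) (h3 : IsInner k u₃) (hv0 : IsInner k v₀)
    (hv1 : IsRow k q v₁) {x τ : ℝ × ℝ}
    (hτ : τ = (m * α + ((k : ℝ) ^ 5 - v₀ - 1 - u₂) / (2 * k ^ 6 * q), ((u₂ : ℝ) - v₀) / k ^ 5))
    (hx : x + (e, 0) ∈ gridSquare k q ((k * u₀ + u₁) * k ^ 10 + u₂ * k ^ 5 + u₃)
      (v₀ * (2 * k ^ 6 * q) + v₁)) :
    lift (conjugation hn hk hq hφt hi * rot α ^ m * (conjugation hn hk hq hφt hi)⁻¹) x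
        = lift i (x + τ) ∧
      x + τ ∈ gridSquare k q ((k * (u₀ + 1 + 2 * h) + u₁) * k ^ 10 + (k ^ 5 - 1 - v₀) * k ^ 5 + u₃)
        (u₂ * (2 * k ^ 6 * q) + v₁) := by
  have hkr : (0 : ℝ) < k := by linarith [H.twenty_le]
  have hqr : (0 : ℝ) < q := by linarith [H.one_le_q]
  have hae := H.abs_shift_le
  have hx' := (mem_gridSquare H).mp hx
  push_cast at hx'
  simp only [Prod.fst_add, Prod.snd_add, add_zero, mul_add] at hx'
  have hu1k : (u₁ : ℝ) + 1 ≤ k := by exact_mod_cast hu1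
  have hfl : ⌊((2 * q : ℕ) : ℝ) * x.1⌋ = u₀ := by
    have := strip_bounds H (u := u₀) (Nat.cast_nonneg u₁) hu1k h2.le_real h3.le_real
    apply floor_eq_of_mem H <;> push_cast <;> linarith
  have hodd : ¬ Even ⌊((2 * q : ℕ) : ℝ) * x.1⌋ := by
    rw [hfl]
    exact_mod_cast hu0
  rw [lift_conj_rot, lift_conjugation_inv_of_odd hn hk hq hφt hi hodd]
  -- The shift by `1/(2q) + h/q` is one of `1 + 2h` strips, each of `k` columns: the parity of the
  -- strip changes, while the column index modulo `k` remains `u₁`.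
  set l : ℤ := k * (u₀ + 1 + 2 * h) + u₁ with hl
  have hy : x + (m * α, 0) ∈ gridSquare k q (l * k ^ 10 + u₂ * k ^ 5 + u₃)
      (v₀ * (2 * k ^ 6 * q) + v₁) := by
    -- The hypothesis concerns `x + (e, 0)` because the rest of the rotation is an exact translation
    -- of the grid.
    have := gridSquare_add H hx (c := k ^ 11 * (1 + 2 * h)) (d := 0)
      (τ := (1 / (2 * (q : ℝ)) + h / q, 0)) (by push_cast; field_simp) (by simp)
    have e1 : x + (m * α, 0) = x + (e, 0) + (1 / (2 * (q : ℝ)) + h / q, 0) := by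
      ext
      · simp only [Prod.fst_add, hm]
        ring
      · simp
    rw [e1]
    convert this using 2
    · rw [hl]
      ring
    · ring
  have hcell : x + (m * α, 0) ∈ columnCell n k q l 0 u₂ v₀ :=
    mem_columnCell_of_gridSquare H h3 hv1 hy
  have hyb := (mem_gridSquare H).mp hy
  push_cast [hl] at hyb
  have hflr : ⌊((2 * q : ℕ) : ℝ) * (x + (m * α, 0)).1⌋ = (u₀ : ℤ) + 1 + 2 * h := by
    have := strip_bounds H (u := (u₀ : ℝ) + 1 + 2 * h) (Nat.cast_nonneg u₁) hu1k h2.le_real h3.le_real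
    apply floor_eq_of_mem H <;> push_cast <;> linarith
  have heven : Even ⌊((2 * q : ℕ) : ℝ) * (x + (m * α, 0)).1⌋ := by
    rw [hflr]
    have h0 : Odd (u₀ : ℤ) := by exact_mod_cast Nat.not_even_iff_odd.mp hu0
    exact (h0.add_odd odd_one).add (even_two_mul h)
  have hφ := hφt.cell l 0 u₂ v₀ h2.1 h2.2 hv0.1 hv0.2 _ hcell
  have exτ : x + (m * α, 0) + (((k : ℝ) ^ 5 - v₀ - 1 - u₂) / (2 * k ^ 6 * q), ((u₂ : ℝ) - v₀) / k ^ 5)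
      = x + τ := by
    rw [hτ]
    ext <;> simp [add_assoc]
  rw [exτ] at hφ
  rw [lift_conjugation_of_even hn hk hq hφt hi heven, hφ]
  refine ⟨rfl, ?_⟩
  have := gridSquare_add H hy (c := (k ^ 5 - v₀ - 1 - u₂) * k ^ 5) (d := (u₂ - v₀) * (2 * k ^ 6 * q))
      (τ := (((k : ℝ) ^ 5 - v₀ - 1 - u₂) / (2 * k ^ 6 * q), ((u₂ : ℝ) - v₀) / k ^ 5))
      (by push_cast; field_simp) (by push_cast; field_simp)
  rw [exτ] at this
  convert this using 2 <;> ring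

/-- Over an even strip `Φ` is the inverse of `i` followed by a translation. -/
theorem lift_of_even (H : Scale n k q e) (hn : 0 < n) (hk : 0 < k) (hq : 0 < q)
    (hφt : IsInnerRotationA n k q φt) (hi : IsInnerRotationB n k q i) {α : ℝ} {m : ℕ} {h : ℤ}
    (hm : (m : ℝ) * α = 1 / (2 * q) + h / q + e) {u₀ u₁ u₂ u₃ v₀ v₁ t₂ : ℕ} (hu0 : Even u₀)
    (hu1 : u₁ < k) (ht2 : t₂ + u₂ + 1 = k ^ 5) (h2 : IsInner k u₂) (h3 : IsInner k u₃)
    (hv0 : IsInner k v₀) (hv1 : IsRow k q v₁) {x τ : ℝ × ℝ}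
    (hτ : τ = (m * α - ((u₂ : ℝ) - v₀) / (2 * k ^ 6 * q), ((t₂ : ℝ) - v₀) / k ^ 5))
    (hx : x ∈ gridSquare k q ((k * u₀ + u₁) * k ^ 10 + u₂ * k ^ 5 + u₃)
      (v₀ * (2 * k ^ 6 * q) + v₁)) :
    lift (conjugation hn hk hq hφt hi * rot α ^ m * (conjugation hn hk hq hφt hi)⁻¹) x
        = lift i⁻¹ x + τ ∧
      lift i⁻¹ x + τ - (e, 0) ∈ gridSquare k q
        ((k * (u₀ + 1 + 2 * h) + u₁) * k ^ 10 + v₀ * k ^ 5 + u₃) (t₂ * (2 * k ^ 6 * q) + v₁) := by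
  have hkr : (0 : ℝ) < k := by linarith [H.twenty_le]
  have hqr : (0 : ℝ) < q := by linarith [H.one_le_q]
  have hae := H.abs_shift_le
  have hx' := (mem_gridSquare H).mp hx
  push_cast at hx'
  have hu1k : (u₁ : ℝ) + 1 ≤ k := by exact_mod_cast hu1
  have ht2r : (t₂ : ℝ) + u₂ + 1 = (k : ℝ) ^ 5 := by exact_mod_cast ht2
  have hfl : ⌊((2 * q : ℕ) : ℝ) * x.1⌋ = u₀ := by
    have := strip_bounds H (u := u₀) (Nat.cast_nonneg u₁) hu1k h2.le_real h3.le_real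
    apply floor_eq_of_mem H <;> push_cast <;> linarith
  have heven : Even ⌊((2 * q : ℕ) : ℝ) * x.1⌋ := by
    rw [hfl]
    exact_mod_cast hu0
  rw [lift_conj_rot, lift_conjugation_inv_of_even hn hk hq hφt hi heven]
  set z := lift i⁻¹ x with hz
  have hzmem : z ∈ gridSquare k q ((k * u₀ + u₁) * k ^ 10 + u₂ * k ^ 5 + u₃)
      (v₀ * (2 * k ^ 6 * q) + v₁) := by
    rw [← hi.image_square] at hx
    obtain ⟨z', hz', rfl⟩ := hx
    rwa [hz, lift_inv_lift]
  set σ : ℝ × ℝ := (-(((u₂ : ℝ) - v₀) / (2 * k ^ 6 * q)), ((t₂ : ℝ) - v₀) / k ^ 5) with hσ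
  have hy : z + σ ∈ gridSquare k q ((k * u₀ + u₁ : ℤ) * k ^ 10 + v₀ * k ^ 5 + u₃)
      (t₂ * (2 * k ^ 6 * q) + v₁) := by
    have := gridSquare_add H hzmem (c := -((u₂ - v₀) * k ^ 5)) (d := (t₂ - v₀) * (2 * k ^ 6 * q))
      (τ := σ) (by rw [hσ]; push_cast; field_simp) (by rw [hσ]; push_cast; field_simp)
    convert this using 2 <;> ring
  have ht2i : IsInner k t₂ := by
    unfold IsInner at h2 ⊢
    omega
  have hcell : z + σ ∈ columnCell n k q (k * u₀ + u₁ : ℤ) 0 v₀ t₂ :=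
    mem_columnCell_of_gridSquare H h3 hv1 hy
  have hφ := hφt.cell _ 0 v₀ t₂ hv0.1 hv0.2 ht2i.1 ht2i.2 _ hcell
  -- The quarter turn takes the cell `(v₀, t₂)` to `(k⁵ - t₂ - 1, v₀) = (u₂, v₀)`, so the
  -- translation by `σ` realizes its inverse at `z`.
  have hφz : lift φt (z + σ) = z := by
    rw [hφ, hσ]
    ext
    · simp only [Prod.fst_add]
      rw [← ht2r]
      ring
    · simp only [Prod.snd_add]
      ring
  have hinv : lift φt⁻¹ z = z + σ := by
    rw [← hφz, lift_inv_lift, hφz]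
  have exτ : z + σ + (m * α, 0) = z + τ := by
    rw [hτ, hσ]
    ext
    · simp only [Prod.fst_add]
      ring
    · simp only [Prod.snd_add]
      ring
  rw [hinv, exτ]
  have hend : z + τ - (e, 0) ∈ gridSquare k q
        ((k * (u₀ + 1 + 2 * h) + u₁) * k ^ 10 + v₀ * k ^ 5 + u₃) (t₂ * (2 * k ^ 6 * q) + v₁) := by
    have := gridSquare_add H hy (c := k ^ 11 * (1 + 2 * h)) (d := 0)
      (τ := (1 / (2 * (q : ℝ)) + h / q, 0)) (by push_cast; field_simp) (by simp)
    have e1 : z + τ - (e, 0) = z + σ + (1 / (2 * (q : ℝ)) + h / q, 0) := by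
      rw [← exτ]
      ext
      · simp only [Prod.fst_add, Prod.fst_sub, hm]
        ring
      · simp
    rw [e1]
    convert this using 2 <;> ring
  refine ⟨?_, hend⟩
  have hyb := (mem_gridSquare H).mp hend
  push_cast at hyb
  simp only [Prod.fst_sub, mul_sub] at hyb
  have hflr : ⌊((2 * q : ℕ) : ℝ) * (z + τ).1⌋ = (u₀ : ℤ) + 1 + 2 * h := by
    have := strip_bounds H (u := (u₀ : ℝ) + 1 + 2 * h) (Nat.cast_nonneg u₁) hu1k hv0.le_real h3.le_real
    apply floor_eq_of_mem H <;> push_cast <;> linarith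
  have hodd : ¬ Even ⌊((2 * q : ℕ) : ℝ) * (z + τ).1⌋ := by
    rw [hflr, Int.not_even_iff_odd]
    have h0 : Even (u₀ : ℤ) := by exact_mod_cast hu0
    exact (h0.add_odd odd_one).add_even (even_two_mul h)
  exact lift_conjugation_of_odd hn hk hq hφt hi hodd

end Dynamics

/-! ### From local rotations to distribution -/

/-- From above, `N/A ≤ j / ((1 - ρ) gY)` and `J ≤ gY`. From below, `N/A ≥ (1 - η) j / gY`, and `gY ≤
1` with `J ≥ 1 - δ` costs a factor `(1 - η)(1 - δ) ≥ 1 - ε`. -/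
theorem abs_ratio_sub_le {N A j J gX gY ρ η δ ε : ℝ} (hgX : 0 < gX) (hgY : gY ≤ 1) (hJ0 : 0 < J)
    (hj : 0 ≤ j) (hJ : J ≤ gY) (hJδ : 1 - δ ≤ J) (hA : 0 < A) (hA1 : (1 - ρ) * (gX * gY) ≤ A)
    (hA2 : A ≤ gX * gY) (hN1 : (1 - η) * gX * j ≤ N) (hN2 : N ≤ gX * j)
    (hε : ε ≤ 1) (hρ : 1 ≤ (1 + ε) * (1 - ρ)) (hη : η ≤ 1) (hηδ : η + δ ≤ ε) (hδ0 : 0 ≤ δ)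
    (hη0 : 0 ≤ η) : |N / A - j / J| ≤ ε * (j / J) := by
  have hε0 : 0 ≤ ε := by linarith
  have hgY0 : 0 < gY := hJ0.trans_le hJ
  have up : N / A ≤ (1 + ε) * (j / J) := by
    rw [← mul_div_assoc, div_le_div_iff₀ hA hJ0]
    have h1 : gX * J ≤ (1 + ε) * A := by
      have h2 : gX * J ≤ gX * gY := mul_le_mul_of_nonneg_left hJ hgX.le
      have h3 : gX * gY ≤ (1 + ε) * (1 - ρ) * (gX * gY) :=
        le_mul_of_one_le_left (by positivity) hρ
      have h4 := mul_le_mul_of_nonneg_left hA1 (by linarith : 0 ≤ 1 + ε)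
      linarith
    have h5 := mul_le_mul_of_nonneg_right hN2 hJ0.le
    have h6 := mul_le_mul_of_nonneg_left h1 hj
    linarith
  have low : (1 - ε) * (j / J) ≤ N / A := by
    rw [← mul_div_assoc, div_le_div_iff₀ hJ0 hA]
    have h1 : (1 - ε) * gY ≤ (1 - η) * J := by
      have h2 := mul_le_mul_of_nonneg_left hgY (by linarith : 0 ≤ 1 - ε)
      have h3 := mul_le_mul_of_nonneg_left hJδ (by linarith : 0 ≤ 1 - η)
      have h4 := mul_nonneg hη0 hδ0
      linarith
    have h5 : (1 - ε) * A ≤ (1 - η) * gX * J := by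
      have h6 := mul_le_mul_of_nonneg_left hA2 (by linarith : 0 ≤ 1 - ε)
      have h7 := mul_le_mul_of_nonneg_left h1 hgX.le
      linarith
    have h8 := mul_le_mul_of_nonneg_left h5 hj
    have h9 := mul_le_mul_of_nonneg_right hN1 hJ0.le
    linarith
  rw [abs_le]
  constructor <;> linarith

/-- Two subsets that each miss at most a proportion `ρ` of `z` in the hull `Z` jointly miss at most
`2ρ`. No inclusion between `S` and `D` is available: the error `e` may exceed the margins of the
squares, and `i` turns the squares. -/
theorem volume_inter_ge {S D Z : Set (ℝ × ℝ)} (hD : MeasurableSet D) (hSZ : S ⊆ Z) (hDZ : D ⊆ Z)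
    {z ρ : ℝ} (hz : 0 ≤ z) (hZ : volume Z ≤ ENNReal.ofReal z)
    (hSv : ENNReal.ofReal ((1 - ρ) * z) ≤ volume S)
    (hDv : ENNReal.ofReal ((1 - ρ) * z) ≤ volume D) :
    ENNReal.ofReal ((1 - 2 * ρ) * z) ≤ volume (S ∩ D) := by
  have fZ : volume Z ≠ ⊤ := ne_top_of_le_ne_top ENNReal.ofReal_ne_top hZ
  have fS : volume S ≠ ⊤ := ne_top_of_le_ne_top fZ (measure_mono hSZ)
  have fD : volume D ≠ ⊤ := ne_top_of_le_ne_top fZ (measure_mono hDZ)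
  have fI : volume (S ∩ D) ≠ ⊤ := ne_top_of_le_ne_top fS (measure_mono inter_subset_left)
  rw [ENNReal.ofReal_le_iff_le_toReal fI]
  rw [ENNReal.ofReal_le_iff_le_toReal fS] at hSv
  rw [ENNReal.ofReal_le_iff_le_toReal fD] at hDv
  have hZr : volume.real Z ≤ z := ENNReal.toReal_le_of_le_ofReal hz hZ
  have h1 : volume.real (S ∩ D) + volume.real (S \ D) = volume.real S :=
    measureReal_inter_add_sdiff hD fS
  have h2 : volume.real (S \ D) ≤ volume.real (Z \ D) :=
    measureReal_mono (sdiff_subset_sdiff_left hSZ)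
      (ne_top_of_le_ne_top fZ (measure_mono sdiff_subset))
  have h3 : volume.real (Z \ D) = volume.real Z - volume.real D := measureReal_sdiff hDZ hD fZ
  change (1 - ρ) * z ≤ volume.real S at hSv
  change (1 - ρ) * z ≤ volume.real D at hDv
  change _ ≤ volume.real (S ∩ D)
  linarith

/-- The width of the columns that the images of the segments lie in. -/
noncomputable def imageWidth (k q : ℕ) : ℝ := ((k : ℝ) ^ 5 - 2) / (2 * k ^ 11 * q)

/-- The total height of the rows that the images of the segments lie in. -/
noncomputable def imageHeight (k q : ℕ) : ℝ :=
  ((k : ℝ) ^ 5 - 2) * (2 * k ^ 6 * q - 4 * q) / (2 * k ^ 11 * q)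

/-- The rows that the images of the segments lie in. -/
noncomputable def imageRows (k q : ℕ) : Set ℝ :=
  closedCells (2 * k ^ 11 * q) 0
    (digitPairs (2 * (k : ℤ) ^ 6 * q) 0 (innerIndices (k ^ 5)) (rowIndices k q))

section Bounds

variable {n k q : ℕ} {e : ℝ}

theorem volume_imageRows_le (H : Scale n k q e) :
    volume (imageRows k q) ≤ ENNReal.ofReal (imageHeight k q) := by
  have hk : (0 : ℝ) < k := by linarith [H.twenty_le]
  have hq : (0 : ℝ) < q := by linarith [H.one_le_q]
  have ha : (0 : ℝ) < 2 * k ^ 11 * q := by positivity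
  refine (volume_closedCells_le ha 0 _).trans (ENNReal.ofReal_le_ofReal ?_)
  have h := card_digitPairs_le (2 * (k : ℤ) ^ 6 * q) 0 (innerIndices (k ^ 5)) (rowIndices k q)
  have h' : ((digitPairs (2 * (k : ℤ) ^ 6 * q) 0 (innerIndices (k ^ 5)) (rowIndices k q)).card : ℝ)
      ≤ ((k : ℝ) ^ 5 - 2) * (2 * k ^ 6 * q - 4 * q) := by
    have h1 := card_innerIndices (K := k ^ 5) (by linarith [H.twenty_le_pow])
    have h2 := card_rowIndices (k := k) (q := q) (by linarith [H.twenty_le_nat])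
    push_cast at h1
    rw [← h1, ← h2]
    exact_mod_cast h
  unfold imageHeight
  rw [mul_zero, sub_zero, mul_div_assoc', mul_one]
  gcongr

theorem imageRows_subset (H : Scale n k q e) : imageRows k q ⊆ Ico 0 (0 + 1) := by
  have hk : (0 : ℝ) < k := by linarith [H.twenty_le]
  have hq : (0 : ℝ) < q := by linarith [H.one_le_q]
  have ha : (0 : ℝ) < 2 * k ^ 11 * q := by positivity
  rintro t ⟨N, hN, h1, h2⟩
  obtain ⟨c, hc, d, hd, rfl⟩ := mem_digitPairs.mp hN
  obtain ⟨u, hu, rfl⟩ := mem_innerIndices_pow.mp hc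
  obtain ⟨v, hv, rfl⟩ := mem_rowIndices_iff.mp hd
  push_cast at h1 h2
  have iu := hu.le_real
  have iv := hv.le_real
  have h6 : (0 : ℝ) < 2 * k ^ 6 * q := by positivity
  have e11 : 2 * (k : ℝ) ^ 11 * q = k ^ 5 * (2 * k ^ 6 * q) := by ring
  have m1 : 0 ≤ (u : ℝ) * (2 * k ^ 6 * q) := by positivity
  have m2 := mul_le_mul_of_nonneg_right iu.2 h6.le
  constructor
  · refine nonneg_of_mul_nonneg_right (a := 2 * (k : ℝ) ^ 11 * q) ?_ ha
    linarith
  · rw [zero_add]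
    refine lt_of_mul_lt_mul_left (a := 2 * (k : ℝ) ^ 11 * q) ?_ ha.le
    rw [mul_one]
    linarith

theorem imageHeight_eq (H : Scale n k q e) :
    imageHeight k q = (1 - 2 * (1 / (k : ℝ)) ^ 5) * (1 - 2 * (1 / (k : ℝ)) ^ 6) := by
  have hk : (0 : ℝ) < k := by linarith [H.twenty_le]
  have hq : (0 : ℝ) < q := by linarith [H.one_le_q]
  unfold imageHeight
  field_simp
  ring

theorem imageWidth_pos (H : Scale n k q e) : 0 < imageWidth k q := by
  have hk := H.twenty_le
  have hk5 := H.k_le_pow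
  have hq : (0 : ℝ) < q := by linarith [H.one_le_q]
  exact div_pos (by linarith) (by positivity)

theorem imageWidth_le (H : Scale n k q e) : imageWidth k q ≤ 1 / (2 * (k : ℝ) ^ 5 * q) := by
  have hk := H.twenty_le
  have hq : (0 : ℝ) < q := by linarith [H.one_le_q]
  unfold imageWidth
  rw [div_le_div_iff₀ (by positivity) (by positivity)]
  have h1 : ((k : ℝ) ^ 5 - 2) * (2 * k ^ 5 * q) ≤ k ^ 5 * (2 * k ^ 5 * q) := by
    gcongr
    linarith
  have h2 : (k : ℝ) ^ 5 * (2 * k ^ 5 * q) * 1 ≤ k ^ 5 * (2 * k ^ 5 * q) * k := by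
    gcongr
    linarith
  calc _ ≤ _ := h1
    _ ≤ k ^ 5 * (2 * k ^ 5 * q) * k := by linarith
    _ = _ := by ring

/-- Ensures that the image column lies within one period of the circle. -/
theorem gamma_lt_one (H : Scale n k q e) : 1 / (2 * (k : ℝ) ^ 5 * q) < 1 := by
  have hk := H.twenty_le
  have hk5 := H.k_le_pow
  have hq := H.one_le_q
  rw [div_lt_one (by positivity)]
  nlinarith

/-- Everything is expressed through `s = 1/k ≤ 1/20`. The condition `k ≥ 20 n⁵` reads `20 s ≤ ε`, so
`η = ε/2` is at least `10 s`. Dividing the loss `ρ ≈ 8 s⁵` by `η` then costs about `0.8 s⁴`, which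
together with the missing height `1 - gY ≈ 2 s⁵` still fits into `δ = s⁴`. -/
theorem distribution_estimates (H : Scale n k q e) :
    0 < imageHeight k q ∧ imageHeight k q ≤ 1 ∧
    1 - 1 / (k : ℝ) ^ 4 ≤ imageHeight k q *
      (1 - 2 * (4 / (k : ℝ) ^ 5 + 2 / k ^ 10) / (1 / (n : ℝ) ^ 5 / 2)) ∧
    2 * (4 / (k : ℝ) ^ 5 + 2 / k ^ 10) ≤ 1 / (n : ℝ) ^ 5 / 2 ∧
    1 / (k : ℝ) ^ 4 ≤ 1 / (n : ℝ) ^ 5 / 2 ∧ 0 < 1 / (n : ℝ) ^ 5 ∧ 1 / (n : ℝ) ^ 5 ≤ 1 := by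
  have hk := H.twenty_le
  have hn1 := H.one_le_n_pow
  have hkn := H.k_ge_real
  set gY := imageHeight k q with hgYdef
  set ρ : ℝ := 2 * (4 / (k : ℝ) ^ 5 + 2 / k ^ 10) with hρ
  set s : ℝ := 1 / (k : ℝ) with hs
  have hs0 : 0 < s := by positivity
  have hs20 : s ≤ 1 / 20 := one_div_le_one_div_of_le (by norm_num) hk
  have hρs : ρ = 8 * s ^ 5 + 4 * s ^ 10 := by
    rw [hρ, hs]
    field_simp
    ring
  have hδs : 1 / (k : ℝ) ^ 4 = s ^ 4 := by rw [hs, one_div_pow]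
  have hεs : 20 * s ≤ 1 / (n : ℝ) ^ 5 := by
    rw [hs, ← mul_div_assoc, mul_one, div_le_div_iff₀ (by linarith) (by linarith), one_mul]
    exact hkn
  have hε1 : 1 / (n : ℝ) ^ 5 ≤ 1 := by
    rw [div_le_one (by linarith)]
    exact hn1
  set ε : ℝ := 1 / (n : ℝ) ^ 5 with hε
  set η : ℝ := ε / 2 with hη_eq
  have hη0 : 0 < η := by rw [hη_eq]; linarith
  have hηs : 10 * s ≤ η := by rw [hη_eq]; linarith
  have hgYs : gY = (1 - 2 * s ^ 5) * (1 - 2 * s ^ 6) := imageHeight_eq H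
  have p4 : s ^ 4 ≤ s / 8000 := by
    have : s ^ 3 ≤ (1 / 20) ^ 3 := pow_le_pow_left₀ hs0.le hs20 3
    calc s ^ 4 = s * s ^ 3 := by ring
      _ ≤ s * (1 / 20) ^ 3 := by gcongr
      _ = _ := by ring
  have p4' : 0 < s ^ 4 := by positivity
  have p5 : s ^ 5 ≤ s ^ 4 / 20 := by
    calc s ^ 5 = s ^ 4 * s := by ring
      _ ≤ s ^ 4 * (1 / 20) := by gcongr
      _ = _ := by ring
  have p5' : 0 < s ^ 5 := by positivity
  have p6 : s ^ 6 ≤ s ^ 5 / 20 := by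
    calc s ^ 6 = s ^ 5 * s := by ring
      _ ≤ s ^ 5 * (1 / 20) := by gcongr
      _ = _ := by ring
  have p6' : 0 < s ^ 6 := by positivity
  have p9' : 0 < s ^ 9 := by positivity
  have p9 : s ^ 9 ≤ s ^ 4 / 20 := by
    calc s ^ 9 = s ^ 5 * s ^ 4 := by ring
      _ ≤ 1 / 20 * s ^ 4 := by
        gcongr
        linarith
      _ = _ := by ring
  have hprod : 0 < s ^ 5 * s ^ 6 := by positivity
  have hprod' : s ^ 5 * s ^ 6 ≤ s ^ 6 := mul_le_of_le_one_left p6'.le (by linarith)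
  have hgY1 : gY ≤ 1 := by
    rw [hgYs]
    linarith
  have hgYlow : 1 - s ^ 4 / 9 ≤ gY := by
    rw [hgYs]
    linarith
  have hgY0 : 0 < gY := by linarith
  have hρη : ρ / η ≤ 83 / 100 * s ^ 4 := by
    rw [div_le_iff₀ hη0]
    calc ρ = 10 * s * (8 / 10 * s ^ 4 + 4 / 10 * s ^ 9) := by rw [hρs]; ring
      _ ≤ η * (8 / 10 * s ^ 4 + 4 / 10 * s ^ 9) := by gcongr
      _ ≤ η * (83 / 100 * s ^ 4) := by
        gcongr
        linarith
      _ = _ := by ring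
  have hδ : 1 - 1 / (k : ℝ) ^ 4 ≤ gY * (1 - ρ / η) := by
    rw [hδs]
    have h1 : (1 - s ^ 4 / 9) * (1 - 83 / 100 * s ^ 4) ≤ gY * (1 - ρ / η) := by
      -- The budget closes because `1/9 + 83/100 < 1`.
      apply mul_le_mul hgYlow (by linarith) (by linarith) hgY0.le
    have h2 : 0 < s ^ 4 * s ^ 4 := by positivity
    linarith
  refine ⟨hgY0, hgY1, hδ, ?_, by rw [hδs]; linarith, by positivity, hε1⟩
  have : s ^ 10 ≤ s ^ 5 := pow_le_pow_of_le_one hs0.le (by linarith) (by norm_num)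
  rw [hρs]
  linarith

/-- The conditions of `IsDistributing` on one segment `I` with its set `J`, when `f` turns the
directions over most of `I` by `b π / k`. -/
def DistributesSegment (n k q : ℕ) (f : TorusDiff) (I : Set Torus) (b : ℤ)
    (J : Set UnitAddCircle) : Prop :=
  (MeasurableSet J ∧ J ⊆ Prod.snd '' (torusMap f '' I) ∧
    1 - 1 / (k : ℝ) ^ 4 ≤ volume.real J ∧ volume.real J ≤ 1) ∧
  (∃ c : UnitAddCircle, torusMap f '' I ⊆
    ((fun s : ℝ => c + (s : UnitAddCircle)) '' Icc 0 (1 / (2 * (k : ℝ) ^ 5 * q))) ×ˢ univ) ∧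
  (∀ J' : Set UnitAddCircle, MeasurableSet J' → J' ⊆ J →
    |volume.real (I ∩ torusMap f ⁻¹' (univ ×ˢ J')) / volume.real I
      - volume.real J' / volume.real J|
    ≤ 1 / (n : ℝ) ^ 5 * (volume.real J' / volume.real J)) ∧
  (∀ j t : ℕ, (t : ℤ) ≡ b + j [ZMOD k] →
    ∀ J' : Set UnitAddCircle, MeasurableSet J' → J' ⊆ J →
    |volume.real (Prod.fst '' ((I ×ˢ tangentInterval k j) ∩
          derivExt f ⁻¹' ((univ ×ˢ J') ×ˢ tangentInterval k t))) / volume.real I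
        - volume.real J' / volume.real J|
      ≤ 1 / (n : ℝ) ^ 5 * (volume.real J' / volume.real J))

/-- If `Φ` is locally a rotation by `b π / k` on `D`, and maps a plane segment `S` that nearly
coincides with `D` into a thin column over the image rows, then the projection of `S` is
distributed as required. -/
theorem exists_distributed_fibers (H : Scale n k q e) {f : TorusDiff}
    (hf : MeasurePreserving (lift f) volume volume) {S D : Set (ℝ × ℝ)} (hS : S ⊆ unitSquare)
    (hSm : MeasurableSet S) (hDm : MeasurableSet D) {b : ℤ}
    (hloc : ∀ x ∈ D, ∃ w, ∀ᶠ y in nhds x, lift f y = rotate ((b : ℝ) * Real.pi / k) y + w) {c : ℝ}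
    (himg : ∀ x ∈ S, (lift f x).1 ∈ Icc c (c + imageWidth k q) ∧ (lift f x).2 ∈ imageRows k q)
    (hvol : ENNReal.ofReal ((1 - 2 * (4 / (k : ℝ) ^ 5 + 2 / k ^ 10))
      * (imageWidth k q * imageHeight k q)) ≤ volume (S ∩ D)) :
    ∃ J : Set UnitAddCircle, DistributesSegment n k q f (proj '' S) b J := by
  unfold DistributesSegment
  have hk := H.twenty_le
  have hk0 : 0 < k := by linarith [H.twenty_le_nat]
  have hgX := imageWidth_pos H
  have hgXγ := imageWidth_le H
  have hγ1 := gamma_lt_one H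
  obtain ⟨hgY0, hgY1, hδ, hρ1, hδε, hε0, hε1⟩ := distribution_estimates H
  set gX := imageWidth k q with hgXdef
  set gY := imageHeight k q with hgYdef
  set ρ : ℝ := 2 * (4 / (k : ℝ) ^ 5 + 2 / k ^ 10) with hρ
  set ε : ℝ := 1 / (n : ℝ) ^ 5 with hε
  -- Half of the tolerance is spent on incomplete fibres; the other half covers `δ ≤ ε/2`, the
  -- length missing from `J`.
  set η : ℝ := ε / 2 with hη
  have hη0 : 0 < η := by positivity
  set X : Set UnitAddCircle := (fun t : ℝ => (t : UnitAddCircle)) '' Icc c (c + gX) with hX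
  set Y : Set UnitAddCircle := (fun t : ℝ => (t : UnitAddCircle)) '' imageRows k q with hY
  obtain ⟨hXm, hXv⟩ := volume_coe_image_le (c := c) (T := Icc c (c + gX)) isCompact_Icc
    fun t ht => ⟨ht.1, by linarith [ht.2]⟩
  have ha : (0 : ℝ) < 2 * k ^ 11 * q := by
    have := H.one_le_q
    positivity
  obtain ⟨hYm, hYv⟩ := volume_coe_image_le (c := 0) (T := imageRows k q)
    (isCompact_closedCells ha _ _) (imageRows_subset H)
  rw [Real.volume_Icc, add_sub_cancel_left] at hXv
  replace hYv := hYv.trans (volume_imageRows_le H)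
  have himg' : ∀ p ∈ proj '' S, torusMap f p ∈ X ×ˢ Y := by
    rintro _ ⟨x, hx, rfl⟩
    rw [torusMap_proj]
    exact ⟨mem_image_of_mem _ (himg x hx).1, mem_image_of_mem _ (himg x hx).2⟩
  set C : Set Torus := rep ⁻¹' (S ∩ D) with hC
  have hCm : MeasurableSet C := measurable_rep (hSm.inter hDm)
  have hCI : C ⊆ proj '' S := by
    rw [proj_image_eq hS]
    exact preimage_mono inter_subset_left
  have hCv : ENNReal.ofReal ((1 - ρ) * (gX * gY)) ≤ volume C := by
    rw [hC, volume_rep_preimage (hSm.inter hDm) (inter_subset_left.trans hS)]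
    exact hvol
  obtain ⟨J, hJm, hJI, hJY, hJl, hJ⟩ := exists_full_fibers hf hCm hCI hXm hYm himg' hgX hgY0.le
    hη0 (by linarith) hXv hYv hCv
  have hJgY : volume.real J ≤ gY :=
    (measureReal_mono hJY).trans (ENNReal.toReal_le_of_le_ofReal hgY0.le hYv)
  have hJδ : 1 - 1 / (k : ℝ) ^ 4 ≤ volume.real J := hδ.trans hJl
  have hJ0 : 0 < volume.real J := by linarith
  have hA1 : (1 - ρ) * (gX * gY) ≤ volume.real (proj '' S) :=
    ((ENNReal.ofReal_le_iff_le_toReal (by finiteness)).mp hCv).trans (measureReal_mono hCI)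
  have hA2 : volume.real (proj '' S) ≤ gX * gY := by
    refine ENNReal.toReal_le_of_le_ofReal (by positivity) ?_
    calc volume (proj '' S) ≤ volume (torusMap f ⁻¹' (X ×ˢ Y)) := measure_mono himg'
      _ = volume X * volume Y := by
          rw [(measurePreserving_torusMap hf).measure_preimage (hXm.prod hYm).nullMeasurableSet,
            Measure.volume_eq_prod, Measure.prod_prod]
      _ ≤ ENNReal.ofReal gX * ENNReal.ofReal gY := by gcongr
      _ = _ := (ENNReal.ofReal_mul hgX.le).symm
  have hA0 : 0 < volume.real (proj '' S) :=
    (mul_pos (by linarith) (mul_pos hgX hgY0)).trans_le hA1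
  have hερ : 1 ≤ (1 + ε) * (1 - ρ) := by
    have h1 : (1 + ε) * (1 - ε / 2) ≤ (1 + ε) * (1 - ρ) := by
      gcongr
    have h2 : 0 ≤ ε * (1 - ε) := mul_nonneg hε0.le (by linarith)
    linarith
  have ratio : ∀ (N : ℝ) (J' : Set UnitAddCircle), (1 - η) * gX * volume.real J' ≤ N →
      N ≤ gX * volume.real J' →
      |N / volume.real (proj '' S) - volume.real J' / volume.real J|
        ≤ ε * (volume.real J' / volume.real J) := fun N J' h1 h2 =>
    abs_ratio_sub_le hgX hgY1 hJ0 measureReal_nonneg hJgY hJδ hA0 hA1 hA2 h1 h2 hε1 hερ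
      (by linarith) (by linarith) (by positivity) hη0.le
  refine ⟨J, ⟨hJm, hJI, hJδ, by linarith⟩, ⟨(c : UnitAddCircle), ?_⟩, ?_, ?_⟩
  · rintro _ ⟨p, hp, rfl⟩
    obtain ⟨⟨t, ht, hte⟩, -⟩ := himg' p hp
    refine ⟨⟨t - c, ⟨by linarith [ht.1], by linarith [ht.2]⟩, ?_⟩, mem_univ _⟩
    change (c : UnitAddCircle) + ((t - c : ℝ) : UnitAddCircle) = _
    rw [← hte, ← AddCircle.coe_add, add_sub_cancel]
  · intro J' hJ'm hJ'
    obtain ⟨h1, h2⟩ := hJ J' hJ'm hJ'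
    exact ratio _ _ (h1.trans (measureReal_mono (inter_subset_inter_left _ hCI))) h2
  · intro j t hjt J' hJ'm hJ'
    obtain ⟨h1, h2⟩ := hJ J' hJ'm hJ'
    -- The set in question lies between the good points and all points of the segment that are sent
    -- to height `J'`. For the lower bound, the direction `j/k` serves as witness over each good
    -- point; for the upper bound, the directions are simply forgotten.
    refine ratio _ _ (h1.trans (measureReal_mono ?_)) (le_trans (measureReal_mono ?_) h2)
    · rintro p ⟨hpC, hpJ⟩
      obtain ⟨w, hw⟩ := hloc _ hpC.2
      refine ⟨(p, direction ((j : ℝ) / k)), ⟨⟨hCI hpC, ?_⟩, ?_⟩, rfl⟩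
      · exact ⟨_, ⟨le_rfl, by gcongr; linarith⟩, rfl⟩
      · rw [mem_preimage, derivExt_direction hw]
        exact ⟨hpJ, direction_mem_tangentInterval hk0 hjt⟩
    · rintro _ ⟨⟨p, d⟩, ⟨⟨hpI, -⟩, hpd⟩, rfl⟩
      exact ⟨hpI, hpd.1⟩

end Bounds

/-! ### Areas of the segments, their hulls and the good cells -/

section Segments

variable {n k q : ℕ} {e : ℝ}

/-- The interiors of the cells of the segment `(u₀, u₁)` over `v₀`, with relative margin `σ`. -/
noncomputable def openPattern (k q : ℕ) (σ : ℝ) (u₀ v₀ u₁ : ℕ) : Set (ℝ × ℝ) :=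
  openCells (2 * k ^ 16 * q) σ (xIndices k u₀ u₁) ×ˢ openCells (2 * k ^ 16 * q) σ (yIndices k q v₀)

/-- The union of the grid squares that contain the cells of a segment. -/
noncomputable def segmentHull (k q u₀ v₀ u₁ : ℕ) : Set (ℝ × ℝ) :=
  closedCells (2 * k ^ 11 * q) 0 (digitPairs ((k : ℤ) ^ 5) ((k * u₀ + u₁) * k ^ 10)
    (innerIndices (k ^ 5)) (innerIndices (k ^ 5))) ×ˢ
  closedCells (2 * k ^ 11 * q) 0 (digitPairs 1 (v₀ * (2 * k ^ 6 * q)) (rowIndices k q) {0})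

theorem card_innerIndices_pow (H : Scale n k q e) :
    ((innerIndices (k ^ 5)).card : ℝ) = (k : ℝ) ^ 5 - 2 := by
  have h1 := card_innerIndices (K := k ^ 5) (by linarith [H.twenty_le_pow])
  push_cast at h1
  exact h1

theorem card_rowIndices' (H : Scale n k q e) :
    ((rowIndices k q).card : ℝ) = 2 * (k : ℝ) ^ 6 * q - 4 * q :=
  card_rowIndices (by linarith [H.twenty_le_nat])

theorem card_digitPairs_inner (B : ℤ) (s : Finset ℤ) :
    (digitPairs ((k : ℤ) ^ 5) B s (innerIndices (k ^ 5))).card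
      = s.card * (innerIndices (k ^ 5)).card := by
  apply card_digitPairs
  intro c hc
  rw [mem_innerIndices] at hc
  push_cast at hc
  omega

/-- Within the hull, the digits `u₄` and `v₂` each omit two of `k⁵` values and the margins remove
`2σ` in each direction. The proportion kept is `(1 - 2/k⁵)² (1 - 2σ)²`, estimated by Bernoulli. -/
theorem volume_openPattern_ge (H : Scale n k q e) {σ : ℝ} (hσ : 0 ≤ σ)
    (hσ1 : σ ≤ 1 / (2 * (k : ℝ) ^ 10)) (u₀ v₀ u₁ : ℕ) :
    ENNReal.ofReal ((1 - (4 / (k : ℝ) ^ 5 + 2 / k ^ 10)) * (imageWidth k q * imageHeight k q))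
      ≤ volume (openPattern k q σ u₀ v₀ u₁) := by
  have hk := H.twenty_le
  have hK := H.k_le_pow
  have hq : (0 : ℝ) < q := by linarith [H.one_le_q]
  have hM : (0 : ℝ) < 2 * k ^ 16 * q := by positivity
  rw [openPattern, Measure.volume_eq_prod, Measure.prod_prod, volume_openCells hM hσ,
    volume_openCells hM hσ, xIndices, yIndices, card_digitPairs_inner, card_digitPairs_inner,
    card_digitPairs_inner]
  push_cast
  rw [card_innerIndices_pow H, card_rowIndices' H]
  have hs : 1 / (2 * (k : ℝ) ^ 10) ≤ 1 / 2 := by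
    apply one_div_le_one_div_of_le (by norm_num)
    have : (1 : ℝ) ≤ (k : ℝ) ^ 10 := one_le_pow₀ (by linarith)
    linarith
  have hK2 : (0 : ℝ) ≤ (k : ℝ) ^ 5 - 2 := by linarith
  rw [← ENNReal.ofReal_mul (mul_nonneg (by positivity) (div_nonneg (by linarith) hM.le))]
  apply ENNReal.ofReal_le_ofReal
  have e1 : ((k : ℝ) ^ 5 - 2) * ((k : ℝ) ^ 5 - 2) * ((k : ℝ) ^ 5 - 2)
        * ((1 - 2 * σ) / (2 * k ^ 16 * q)) *
      ((2 * (k : ℝ) ^ 6 * q - 4 * q) * ((k : ℝ) ^ 5 - 2) * ((1 - 2 * σ) / (2 * k ^ 16 * q)))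
      = ((1 - 2 / (k : ℝ) ^ 5) ^ 2 * (1 - 2 * σ) ^ 2) * (imageWidth k q * imageHeight k q) := by
    unfold imageWidth imageHeight
    field_simp
  rw [e1]
  have hWH : 0 ≤ imageWidth k q * imageHeight k q :=
    (mul_pos (imageWidth_pos H) (distribution_estimates H).1).le
  refine mul_le_mul_of_nonneg_right ?_ hWH
  set a := 2 / (k : ℝ) ^ 5 with ha
  set b := 1 / (2 * (k : ℝ) ^ 10) with hb
  have ea : 4 / (k : ℝ) ^ 5 = 2 * a := by rw [ha]; ring
  have eb : 2 / (k : ℝ) ^ 10 = 4 * b := by rw [hb]; field_simp; norm_num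
  have ha1 : a ≤ 1 / 2 := by
    rw [ha, div_le_iff₀ (by positivity)]
    linarith
  have ha0 : 0 ≤ a := by positivity
  rw [ea, eb]
  have h1 : 1 - 2 * a ≤ (1 - a) ^ 2 := by nlinarith
  have h2 : 1 - 4 * σ ≤ (1 - 2 * σ) ^ 2 := by nlinarith
  have h3 : (1 - 2 * a) * (1 - 2 * σ) ^ 2 ≤ (1 - a) ^ 2 * (1 - 2 * σ) ^ 2 :=
    mul_le_mul_of_nonneg_right h1 (sq_nonneg _)
  have h4 := mul_le_mul_of_nonneg_left h2 (by linarith : 0 ≤ 1 - 2 * a)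
  nlinarith [mul_nonneg ha0 hσ]

/-- The hull and the image box count the same number of grid squares: the `k⁵ - 2` values of one
digit are a factor of the width before the quarter turn and of the height after it. -/
theorem volume_segmentHull_le (H : Scale n k q e) (u₀ v₀ u₁ : ℕ) :
    volume (segmentHull k q u₀ v₀ u₁)
      ≤ ENNReal.ofReal (imageWidth k q * imageHeight k q) := by
  have hk := H.twenty_le
  have hK := H.k_le_pow
  have hq : (0 : ℝ) < q := by linarith [H.one_le_q]
  have ha : (0 : ℝ) < 2 * k ^ 11 * q := by positivity
  have hK2 : (0 : ℝ) ≤ (k : ℝ) ^ 5 - 2 := by linarith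
  rw [segmentHull, Measure.volume_eq_prod, Measure.prod_prod]
  refine (mul_le_mul' (volume_closedCells_le ha 0 _) (volume_closedCells_le ha 0 _)).trans ?_
  rw [← ENNReal.ofReal_mul (by positivity), card_digitPairs_inner]
  apply ENNReal.ofReal_le_ofReal
  have h2 : ((digitPairs 1 (v₀ * (2 * k ^ 6 * q)) (rowIndices k q) {0}).card : ℝ)
      ≤ 2 * (k : ℝ) ^ 6 * q - 4 * q := by
    rw [← card_rowIndices' H]
    have := card_digitPairs_le 1 (v₀ * (2 * k ^ 6 * q)) (rowIndices k q) {0}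
    rw [Finset.card_singleton, mul_one] at this
    exact_mod_cast this
  push_cast
  rw [card_innerIndices_pow H]
  calc _ ≤ ((k : ℝ) ^ 5 - 2) * ((k : ℝ) ^ 5 - 2) * ((1 - 2 * 0) / (2 * k ^ 11 * q)) *
        ((2 * (k : ℝ) ^ 6 * q - 4 * q) * ((1 - 2 * 0) / (2 * k ^ 11 * q))) := by
        gcongr
    _ = _ := by
        unfold imageWidth imageHeight
        field_simp
        ring

/-- The grid square with digits `u₂`, `u₃` in column `u₁` of strip `u₀`, and in row `v₁` over
`v₀`. -/
def digitSquare (k q u₀ u₁ u₂ u₃ v₀ v₁ : ℕ) : Set (ℝ × ℝ) :=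
  gridSquare k q ((k * u₀ + u₁) * k ^ 10 + u₂ * k ^ 5 + u₃) (v₀ * (2 * k ^ 6 * q) + v₁)

theorem mem_segmentHull (H : Scale n k q e) {u₀ u₁ u₂ u₃ v₀ v₁ : ℕ} (h2 : IsInner k u₂)
    (h3 : IsInner k u₃) (hv1 : IsRow k q v₁) {x : ℝ × ℝ}
    (hx : x ∈ digitSquare k q u₀ u₁ u₂ u₃ v₀ v₁) : x ∈ segmentHull k q u₀ v₀ u₁ := by
  obtain ⟨hx1, hx2⟩ := (mem_gridSquare H).mp hx
  refine ⟨⟨_, mem_digitPairs.mpr ⟨_, mem_innerIndices_pow.mpr ⟨u₂, h2, rfl⟩, _,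
    mem_innerIndices_pow.mpr ⟨u₃, h3, rfl⟩, rfl⟩, ?_⟩,
    ⟨_, mem_digitPairs.mpr ⟨_, mem_rowIndices_iff.mpr ⟨v₁, hv1, rfl⟩, _,
    Finset.mem_singleton_self 0, rfl⟩, ?_⟩⟩
  · simpa using hx1
  · simpa using hx2

theorem digitSquare_subset_unitSquare (H : Scale n k q e) {u₀ u₁ u₂ u₃ v₀ v₁ : ℕ}
    (hu0 : u₀ < 2 * q) (hu1 : u₁ < k) (h2 : IsInner k u₂) (h3 : IsInner k u₃) (hv0 : IsInner k v₀)
    (hv1 : IsRow k q v₁) : digitSquare k q u₀ u₁ u₂ u₃ v₀ v₁ ⊆ unitSquare := by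
  intro x hx
  have hk := H.twenty_le
  have hq := H.one_le_q
  have ha : (0 : ℝ) < 2 * k ^ 11 * q := by positivity
  have h6 : (0 : ℝ) < 2 * k ^ 6 * q := by positivity
  obtain ⟨⟨a1, a2⟩, a3, a4⟩ := (mem_gridSquare H).mp hx
  push_cast at a1 a2 a3 a4
  have hu1k : (u₁ : ℝ) + 1 ≤ k := by exact_mod_cast hu1
  have hu0q : (u₀ : ℝ) + 1 ≤ 2 * q := by exact_mod_cast hu0
  obtain ⟨b1, b2⟩ := strip_bounds H (u := u₀) (Nat.cast_nonneg u₁) hu1k h2.le_real h3.le_real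
  have b3 := mul_le_mul_of_nonneg_right hu0q (by positivity : (0 : ℝ) ≤ (k : ℝ) ^ 11)
  have b4 : 0 ≤ (u₀ : ℝ) * k ^ 11 := by positivity
  have b5 := mul_le_mul_of_nonneg_right hv0.le_real.2 h6.le
  have b6 : 0 ≤ (v₀ : ℝ) * (2 * k ^ 6 * q) := by positivity
  have b7 := hv1.le_real
  have e11 : 2 * (k : ℝ) ^ 11 * q = k ^ 5 * (2 * k ^ 6 * q) := by ring
  refine ⟨⟨?_, ?_⟩, ?_, ?_⟩
  · refine nonneg_of_mul_nonneg_right (a := 2 * (k : ℝ) ^ 11 * q) ?_ ha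
    linarith
  · refine lt_of_mul_lt_mul_left (a := 2 * (k : ℝ) ^ 11 * q) ?_ ha.le
    linarith
  · refine nonneg_of_mul_nonneg_right (a := 2 * (k : ℝ) ^ 11 * q) ?_ ha
    linarith
  · refine lt_of_mul_lt_mul_left (a := 2 * (k : ℝ) ^ 11 * q) ?_ ha.le
    linarith

/-- A point that is close, in the horizontal direction, to an inner cell of a grid square lies in
the grid square. -/
theorem mem_digitSquare_of_near (H : Scale n k q e) {σ : ℝ} (hσ : 0 ≤ σ)
    {u₀ u₁ u₂ u₃ u₄ v₀ v₁ v₂ : ℕ} (h4 : IsInner k u₄) (hv2 : IsInner k v₂) {y x : ℝ × ℝ}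
    (h1 : ((u₀ * k + u₁) * k ^ 15 + u₂ * k ^ 10 + u₃ * k ^ 5 + u₄ : ℝ) + σ
      ≤ 2 * k ^ 16 * q * y.1)
    (h2 : 2 * k ^ 16 * q * y.1
      ≤ ((u₀ * k + u₁) * k ^ 15 + u₂ * k ^ 10 + u₃ * k ^ 5 + u₄ : ℝ) + 1 - σ)
    (h3 : (v₀ * (2 * k ^ 11 * q) + v₁ * k ^ 5 + v₂ : ℝ) + σ ≤ 2 * k ^ 16 * q * y.2)
    (h4' : 2 * k ^ 16 * q * y.2 ≤ (v₀ * (2 * k ^ 11 * q) + v₁ * k ^ 5 + v₂ : ℝ) + 1 - σ)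
    (hx1 : |2 * (k : ℝ) ^ 16 * q * (x.1 - y.1)| ≤ 1 / 16) (hx2 : x.2 = y.2) :
    x ∈ digitSquare k q u₀ u₁ u₂ u₃ v₀ v₁ := by
  have hK : (0 : ℝ) < (k : ℝ) ^ 5 := by
    have := H.twenty_le
    positivity
  obtain ⟨d1, d2⟩ := abs_le.mp hx1
  have i4 := h4.le_real
  have i2 := hv2.le_real
  rw [digitSquare, mem_gridSquare H, hx2]
  push_cast
  have eM : ∀ t : ℝ, 2 * (k : ℝ) ^ 16 * q * t = (k : ℝ) ^ 5 * (2 * k ^ 11 * q * t) := by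
    intro t; ring
  rw [mul_sub] at d1 d2
  rw [eM] at d1 d2 h1 h2 h3 h4'
  rw [eM y.1] at d1 d2
  have e1 : ((u₀ * k + u₁) * k ^ 15 + u₂ * k ^ 10 + u₃ * k ^ 5 : ℝ)
      = k ^ 5 * ((k * u₀ + u₁) * k ^ 10 + u₂ * k ^ 5 + u₃) := by ring
  have e2 : (v₀ * (2 * k ^ 11 * q) + v₁ * k ^ 5 : ℝ)
      = k ^ 5 * (v₀ * (2 * k ^ 6 * q) + v₁) := by ring
  rw [e1] at h1 h2
  rw [e2] at h3 h4'
  refine ⟨⟨?_, ?_⟩, ?_, ?_⟩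
  · refine le_of_mul_le_mul_left ?_ hK
    linarith
  · refine le_of_mul_le_mul_left ?_ hK
    linarith
  · refine le_of_mul_le_mul_left ?_ hK
    linarith
  · refine le_of_mul_le_mul_left ?_ hK
    linarith

/-- Since `u₄` is an inner digit, a small square is at least one unit away from the vertical sides
of its grid square, and a horizontal shift by `1/16` of a unit does not leave it. Applied to the
point itself and to its shift by `e`. -/
theorem exists_mem_digitSquare (H : Scale n k q e) {u₀ v₀ u₁ : ℕ} {y : ℝ × ℝ}
    (hy : y ∈ planeSegment n k q u₀ v₀ u₁) : ∃ u₂ u₃ v₁ : ℕ, IsInner k u₂ ∧ IsInner k u₃ ∧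
      IsRow k q v₁ ∧ ∀ x : ℝ × ℝ, |2 * (k : ℝ) ^ 16 * q * (x.1 - y.1)| ≤ 1 / 16 → x.2 = y.2 →
        x ∈ digitSquare k q u₀ u₁ u₂ u₃ v₀ v₁ := by
  obtain ⟨⟨N, hN, h1⟩, L, hL, h2⟩ := hy
  obtain ⟨u₂, u₃, u₄, hu2, hu3, hu4, rfl⟩ := mem_xIndices.mp hN
  obtain ⟨v₁, v₂, hv1, hv2, rfl⟩ := mem_yIndices.mp hL
  push_cast at h1 h2
  have hσ : 0 ≤ squareMargin n k := by
    unfold squareMargin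
    positivity
  exact ⟨u₂, u₃, v₁, hu2, hu3, hv1, fun x hx1 hx2 =>
    mem_digitSquare_of_near H hσ hu4 hv2 h1.1 h1.2 h2.1 h2.2 hx1 hx2⟩

/-- With `B` fixed, only `u₃` varies horizontally, and `1 ≤ u₃ ≤ k⁵ - 2` confines the squares to `[B
+ 1, B + k⁵ - 1]` in grid units. The shift `d` is `0` over odd strips and `e` over even ones. -/
theorem image_bounds (H : Scale n k q e) {B : ℤ} {d : ℝ} {t u₃ v₁ : ℕ} (ht : IsInner k t)
    (h3 : IsInner k u₃) (hv1 : IsRow k q v₁) {y : ℝ × ℝ}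
    (hy : y - (d, 0) ∈ gridSquare k q (B + u₃) (t * (2 * k ^ 6 * q) + v₁)) :
    y.1 ∈ Icc (((B : ℝ) + 1) / (2 * k ^ 11 * q) + d)
        (((B : ℝ) + 1) / (2 * k ^ 11 * q) + d + imageWidth k q) ∧ y.2 ∈ imageRows k q := by
  have hk := H.twenty_le
  have hq := H.one_le_q
  have ha : (0 : ℝ) < 2 * k ^ 11 * q := by positivity
  obtain ⟨⟨a1, a2⟩, a3⟩ := (mem_gridSquare H).mp hy
  push_cast at a1 a2
  simp only [Prod.fst_sub] at a1 a2
  have i3 := h3.le_real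
  refine ⟨⟨?_, ?_⟩, _, mem_digitPairs.mpr ⟨_, mem_innerIndices_pow.mpr ⟨t, ht, rfl⟩, _,
    mem_rowIndices_iff.mpr ⟨v₁, hv1, rfl⟩, rfl⟩, ?_⟩
  · rw [← le_sub_iff_add_le, div_le_iff₀ ha]
    linarith
  · have e1 : ((B : ℝ) + 1) / (2 * k ^ 11 * q) + d + imageWidth k q
        = ((B : ℝ) + (k ^ 5 - 2) + 1) / (2 * k ^ 11 * q) + d := by
      unfold imageWidth
      ring
    rw [e1, ← sub_le_iff_le_add, le_div_iff₀ ha]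
    linarith
  · simpa using a3

end Segments

/-! ### Local models of the map over odd and even strips -/

section Main

variable {n k q : ℕ} {e : ℝ} {φt i : TorusDiff}

theorem rotationMargin_nonneg (n k : ℕ) : 0 ≤ rotationMargin n k := by
  unfold rotationMargin
  positivity

theorem squareMargin_nonneg (n k : ℕ) : 0 ≤ squareMargin n k := by
  unfold squareMargin
  positivity

theorem rotationMargin_le (H : Scale n k q e) : rotationMargin n k ≤ 1 / (2 * (k : ℝ) ^ 10) := by
  have hk := H.twenty_le
  unfold rotationMargin
  apply one_div_le_one_div_of_le (by positivity)
  have e1 : (n : ℝ) ^ 5 * k ^ 11 = n ^ 5 * k * k ^ 10 := by ring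
  rw [e1]
  gcongr
  nlinarith [H.one_le_n_pow]

theorem squareMargin_le (H : Scale n k q e) : squareMargin n k ≤ 1 / (2 * (k : ℝ) ^ 10) := by
  have hk := H.twenty_le
  unfold squareMargin
  apply one_div_le_one_div_of_le (by positivity)
  gcongr
  nlinarith [H.one_le_n_pow]

theorem column_emod {k u₁ : ℕ} (hu1 : u₁ < k) (a : ℤ) : (k * a + u₁ : ℤ) % k = u₁ := by
  rw [Int.mul_add_emod_self_left, Int.emod_eq_of_lt (by positivity) (by exact_mod_cast hu1)]

theorem isOpen_openPattern (k q : ℕ) (σ : ℝ) (u₀ v₀ u₁ : ℕ) :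
    IsOpen (openPattern k q σ u₀ v₀ u₁) :=
  (isOpen_openCells _ _ _).prod (isOpen_openCells _ _ _)

theorem volume_planeSegment_ge (H : Scale n k q e) (u₀ v₀ u₁ : ℕ) :
    ENNReal.ofReal ((1 - (4 / (k : ℝ) ^ 5 + 2 / k ^ 10)) * (imageWidth k q * imageHeight k q))
      ≤ volume (planeSegment n k q u₀ v₀ u₁) :=
  (volume_openPattern_ge H (squareMargin_nonneg n k) (squareMargin_le H) u₀ v₀ u₁).trans
    (measure_mono (prod_mono (openCells_subset_closedCells _ _ _)
      (openCells_subset_closedCells _ _ _)))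

theorem planeSegment_subset_hull (H : Scale n k q e) (u₀ v₀ u₁ : ℕ) :
    planeSegment n k q u₀ v₀ u₁ ⊆ segmentHull k q u₀ v₀ u₁ := by
  intro x hx
  obtain ⟨u₂, u₃, v₁, h2, h3, hv1, h⟩ := exists_mem_digitSquare H hx
  exact mem_segmentHull H h2 h3 hv1 (h x (by norm_num) rfl)

theorem planeSegment_subset_unitSquare (H : Scale n k q e) {u₀ v₀ u₁ : ℕ} (hu0 : u₀ < 2 * q)
    (hu1 : u₁ < k) (hv0 : IsInner k v₀) : planeSegment n k q u₀ v₀ u₁ ⊆ unitSquare := by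
  intro x hx
  obtain ⟨u₂, u₃, v₁, h2, h3, hv1, h⟩ := exists_mem_digitSquare H hx
  exact digitSquare_subset_unitSquare H hu0 hu1 h2 h3 hv0 hv1 (h x (by norm_num) rfl)

theorem measurableSet_planeSegment (H : Scale n k q e) (u₀ v₀ u₁ : ℕ) :
    MeasurableSet (planeSegment n k q u₀ v₀ u₁) := by
  have hk := H.twenty_le
  have hq := H.one_le_q
  have hM : (0 : ℝ) < 2 * k ^ 16 * q := by positivity
  exact (isCompact_closedCells hM _ _).measurableSet.prod
    (isCompact_closedCells hM _ _).measurableSet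

/-- The indices and inequalities that a point of an open pattern satisfies. -/
theorem mem_openPattern {σ : ℝ} {u₀ v₀ u₁ : ℕ} {y : ℝ × ℝ} :
    y ∈ openPattern k q σ u₀ v₀ u₁ ↔ ∃ u₂ u₃ u₄ v₁ v₂ : ℕ, IsInner k u₂ ∧ IsInner k u₃ ∧
      IsInner k u₄ ∧ IsRow k q v₁ ∧ IsInner k v₂ ∧ y ∈
        {y : ℝ × ℝ | ((u₀ * k + u₁) * k ^ 15 + u₂ * k ^ 10 + u₃ * k ^ 5 + u₄ : ℝ) + σ
            < 2 * k ^ 16 * q * y.1 ∧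
          2 * k ^ 16 * q * y.1
            < ((u₀ * k + u₁) * k ^ 15 + u₂ * k ^ 10 + u₃ * k ^ 5 + u₄ : ℝ) + 1 - σ ∧
          (v₀ * (2 * k ^ 11 * q) + v₁ * k ^ 5 + v₂ : ℝ) + σ < 2 * k ^ 16 * q * y.2 ∧
          2 * k ^ 16 * q * y.2 < (v₀ * (2 * k ^ 11 * q) + v₁ * k ^ 5 + v₂ : ℝ) + 1 - σ} := by
  constructor
  · rintro ⟨⟨N, hN, h1⟩, L, hL, h2⟩
    obtain ⟨u₂, u₃, u₄, hu2, hu3, hu4, rfl⟩ := mem_xIndices.mp hN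
    obtain ⟨v₁, v₂, hv1, hv2, rfl⟩ := mem_yIndices.mp hL
    push_cast at h1 h2
    exact ⟨u₂, u₃, u₄, v₁, v₂, hu2, hu3, hu4, hv1, hv2, h1.1, h1.2, h2.1, h2.2⟩
  · rintro ⟨u₂, u₃, u₄, v₁, v₂, hu2, hu3, hu4, hv1, hv2, a1, a2, a3, a4⟩
    refine ⟨⟨_, mem_xIndices.mpr ⟨u₂, u₃, u₄, hu2, hu3, hu4, rfl⟩, ?_⟩,
      ⟨_, mem_yIndices.mpr ⟨v₁, v₂, hv1, hv2, rfl⟩, ?_⟩⟩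
    · push_cast
      exact ⟨a1, a2⟩
    · push_cast
      exact ⟨a3, a4⟩

theorem isOpen_openBox (A B C D M : ℝ) :
    IsOpen {y : ℝ × ℝ | A < M * y.1 ∧ M * y.1 < B ∧ C < M * y.2 ∧ M * y.2 < D} := by
  have c1 : Continuous fun y : ℝ × ℝ => M * y.1 := by fun_prop
  have c2 : Continuous fun y : ℝ × ℝ => M * y.2 := by fun_prop
  exact (isOpen_lt continuous_const c1).inter ((isOpen_lt c1 continuous_const).inter
    ((isOpen_lt continuous_const c2).inter (isOpen_lt c2 continuous_const)))

/-- Over an odd strip, `Φ` is locally a rotation by `u₁ π / k` on a set that nearly coincides with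
the segment, and maps the segment into a thin column over the image rows. -/
theorem exists_model_of_odd (H : Scale n k q e) (hn : 0 < n) (hk : 0 < k) (hq : 0 < q)
    (hφt : IsInnerRotationA n k q φt) (hi : IsInnerRotationB n k q i) {α : ℝ} {m : ℕ} {h : ℤ}
    (hm : (m : ℝ) * α = 1 / (2 * q) + h / q + e) {u₀ u₁ v₀ : ℕ} (hu0 : ¬ Even u₀)
    (hu1 : u₁ < k) (hv0 : IsInner k v₀) {f : TorusDiff}
    (hf : f = conjugation hn hk hq hφt hi * rot α ^ m * (conjugation hn hk hq hφt hi)⁻¹) :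
    ∃ (D : Set (ℝ × ℝ)) (c : ℝ), MeasurableSet D ∧ D ⊆ segmentHull k q u₀ v₀ u₁ ∧
      ENNReal.ofReal ((1 - (4 / (k : ℝ) ^ 5 + 2 / k ^ 10)) * (imageWidth k q * imageHeight k q))
        ≤ volume D ∧
      (∀ x ∈ D, ∃ w, ∀ᶠ y in nhds x, lift f y = rotate (((u₁ : ℤ) : ℝ) * Real.pi / k) y + w) ∧
      ∀ x ∈ planeSegment n k q u₀ v₀ u₁,
        (lift f x).1 ∈ Icc c (c + imageWidth k q) ∧ (lift f x).2 ∈ imageRows k q := by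
  have hkr := H.twenty_le
  have hqr := H.one_le_q
  obtain ⟨t, ht⟩ : ∃ t : ℕ, t + v₀ + 1 = k ^ 5 := ⟨k ^ 5 - 1 - v₀, by have := hv0.2; omega⟩
  have hti : IsInner k t := by
    unfold IsInner at hv0 ⊢
    omega
  have htr : (t : ℝ) + v₀ + 1 = (k : ℝ) ^ 5 := by exact_mod_cast ht
  have htz : (t : ℤ) + v₀ + 1 = (k : ℤ) ^ 5 := by exact_mod_cast ht
  set l : ℤ := k * (u₀ + 1 + 2 * h) + u₁ with hl
  -- `x + (e, 0)` differs by a translation of the cell lattice from the point at which `i` is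
  -- evaluated, so pulling back the pattern puts that point into a cell on which `i` is a rotation.
  set D : Set (ℝ × ℝ) :=
    (fun x => x + ((e, 0) : ℝ × ℝ)) ⁻¹' openPattern k q (rotationMargin n k) u₀ v₀ u₁ with hD
  have hopen := isOpen_openPattern k q (rotationMargin n k) u₀ v₀ u₁
  -- There is no residual shift: the error has been absorbed before `i`, which acts last and
  -- preserves the grid square.
  refine ⟨D, (((l * k ^ 10 + t * k ^ 5 : ℤ) : ℝ) + 1) / (2 * k ^ 11 * q) + 0,
    (measurable_id.add_const _) hopen.measurableSet, ?_, ?_, ?_, ?_⟩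
  · intro x hx
    obtain ⟨u₂, u₃, u₄, v₁, v₂, h2, h3, h4, hv1, hv2, a1, a2, a3, a4⟩ := mem_openPattern.mp hx
    refine mem_segmentHull H h2 h3 hv1 (mem_digitSquare_of_near H (rotationMargin_nonneg n k) h4 hv2
      a1.le a2.le a3.le a4.le ?_ (by simp))
    rw [Prod.fst_add, sub_add_cancel_left, mul_neg, abs_neg]
    exact H.shift_le
  · rw [hD, measure_preimage_add_right]
    exact volume_openPattern_ge H (rotationMargin_nonneg n k) (rotationMargin_le H) u₀ v₀ u₁
  · intro x hx
    obtain ⟨u₂, u₃, u₄, v₁, v₂, h2, h3, h4, hv1, hv2, hx⟩ := mem_openPattern.mp hx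
    set τ : ℝ × ℝ := (m * α + ((k : ℝ) ^ 5 - v₀ - 1 - u₂) / (2 * k ^ 6 * q),
      ((u₂ : ℝ) - v₀) / k ^ 5) with hτ
    have hu : t * k ^ 5 + u₃ < k ^ 10 := by
      have e10 : k ^ 10 = k ^ 5 * k ^ 5 := by ring
      have := Nat.mul_le_mul_right (k ^ 5) hti.2
      have := h3.2
      rw [e10]
      linarith
    obtain ⟨w, hw⟩ := hi.cell l (t * k ^ 5 + u₃) (u₂ * (2 * k ^ 6 * q) + v₁) u₄ v₂ hu h4.1 h4.2
      hv2.1 hv2.2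
    refine ⟨rotate (((u₁ : ℤ) : ℝ) * Real.pi / k) τ + w, ?_⟩
    have hcont : Continuous fun y : ℝ × ℝ => y + ((e, 0) : ℝ × ℝ) := by fun_prop
    have hnear := ((isOpen_openBox _ _ _ _ _).preimage hcont).mem_nhds hx
    filter_upwards [hnear] with y hy
    obtain ⟨a1, a2, a3, a4⟩ := hy
    have hyq : y + (e, 0) ∈ digitSquare k q u₀ u₁ u₂ u₃ v₀ v₁ :=
      mem_digitSquare_of_near H (rotationMargin_nonneg n k) h4 hv2 a1.le a2.le a3.le a4.le
        (by norm_num) rfl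
    obtain ⟨hly, -⟩ := lift_of_odd H hn hk hq hφt hi hm hu0 hu1 h2 h3 hv0 hv1 hτ hyq
    have hcell : y + τ ∈ gridCell n k q l (t * k ^ 5 + u₃) (u₂ * (2 * k ^ 6 * q) + v₁) u₄ v₂ := by
      have e1 : 2 * (k : ℝ) ^ 16 * q * (y + τ).1 = 2 * k ^ 16 * q * (y + (e, 0)).1
          + (k ^ 16 * (1 + 2 * h) + (t - u₂) * k ^ 10) := by
        simp only [Prod.fst_add, hτ, hm, ← htr]
        field_simp
        ring
      have e2 : 2 * (k : ℝ) ^ 16 * q * (y + τ).2 = 2 * k ^ 16 * q * (y + (e, 0)).2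
          + (u₂ - v₀) * (2 * k ^ 11 * q) := by
        simp only [Prod.snd_add, hτ]
        field_simp
        ring
      have e3 : (l : ℝ) * k ^ 15 = (u₀ * k + u₁) * k ^ 15 + k ^ 16 * (1 + 2 * h) := by
        rw [hl]
        push_cast
        ring
      apply mem_gridCell H
      · rw [e1, e3]
        push_cast
        linarith
      · rw [e1, e3]
        push_cast
        linarith
      · rw [e2]
        push_cast
        linarith
      · rw [e2]
        push_cast
        linarith
    have hrot := hw _ hcell
    rw [hl, column_emod hu1] at hrot
    rw [hf, hly, hrot, rotate_add, add_assoc]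
  · intro x hx
    obtain ⟨u₂, u₃, v₁, h2, h3, hv1, hsq⟩ := exists_mem_digitSquare H hx
    have hxq : x + (e, 0) ∈ digitSquare k q u₀ u₁ u₂ u₃ v₀ v₁ :=
      hsq _ (by simpa using H.shift_le) (by simp)
    obtain ⟨hlx, hmem⟩ := lift_of_odd H hn hk hq hφt hi hm hu0 hu1 h2 h3 hv0 hv1 rfl hxq
    rw [← hf] at hlx
    apply image_bounds H h2 h3 hv1
    rw [hlx]
    have := mem_image_of_mem (lift i) hmem
    rw [hi.image_square] at this
    have et : (k : ℤ) ^ 5 - 1 - v₀ = t := by linarith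
    rw [et, ← hl] at this
    have e0 : ∀ z : ℝ × ℝ, z - (0, 0) = z := fun z => by ext <;> simp
    rw [e0]
    exact this

/-- Over an even strip, `Φ` is locally a rotation by `- u₁ π / k` on a set that nearly coincides
with the segment, and maps the segment into a thin column over the image rows. -/
theorem exists_model_of_even (H : Scale n k q e) (hn : 0 < n) (hk : 0 < k) (hq : 0 < q)
    (hφt : IsInnerRotationA n k q φt) (hi : IsInnerRotationB n k q i) {α : ℝ} {m : ℕ} {h : ℤ}
    (hm : (m : ℝ) * α = 1 / (2 * q) + h / q + e) {u₀ u₁ v₀ : ℕ} (hu0 : Even u₀)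
    (hu1 : u₁ < k) (hv0 : IsInner k v₀) {f : TorusDiff}
    (hf : f = conjugation hn hk hq hφt hi * rot α ^ m * (conjugation hn hk hq hφt hi)⁻¹) :
    ∃ (D : Set (ℝ × ℝ)) (c : ℝ), MeasurableSet D ∧ D ⊆ segmentHull k q u₀ v₀ u₁ ∧
      ENNReal.ofReal ((1 - (4 / (k : ℝ) ^ 5 + 2 / k ^ 10)) * (imageWidth k q * imageHeight k q))
        ≤ volume D ∧
      (∀ x ∈ D, ∃ w, ∀ᶠ y in nhds x, lift f y = rotate (((-u₁ : ℤ) : ℝ) * Real.pi / k) y + w) ∧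
      ∀ x ∈ planeSegment n k q u₀ v₀ u₁,
        (lift f x).1 ∈ Icc c (c + imageWidth k q) ∧ (lift f x).2 ∈ imageRows k q := by
  have hkr := H.twenty_le
  have hqr := H.one_le_q
  have hdual : ∀ {u₂ : ℕ}, IsInner k u₂ → ∃ t : ℕ, t + u₂ + 1 = k ^ 5 ∧ IsInner k t := by
    intro u₂ h2
    refine ⟨k ^ 5 - 1 - u₂, ?_, ?_⟩ <;> unfold IsInner at * <;> omega
  -- Here `i⁻¹` acts first, and it is a rotation on the images of the cells under `i`. These rotated
  -- cells stay inside the same grid squares and keep their area.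
  set D : Set (ℝ × ℝ) := lift i⁻¹ ⁻¹' openPattern k q (rotationMargin n k) u₀ v₀ u₁ with hD
  have hopen := isOpen_openPattern k q (rotationMargin n k) u₀ v₀ u₁
  have hsquare : ∀ {u₂ u₃ v₁ : ℕ} {x : ℝ × ℝ}, lift i⁻¹ x ∈ digitSquare k q u₀ u₁ u₂ u₃ v₀ v₁ →
      x ∈ digitSquare k q u₀ u₁ u₂ u₃ v₀ v₁ := by
    intro u₂ u₃ v₁ x hx
    have := mem_image_of_mem (lift i) hx
    rwa [lift_lift_inv, digitSquare, hi.image_square] at this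
  -- The rotation acts last, so its error `e` shifts the whole image column.
  refine ⟨D, ((((k * (u₀ + 1 + 2 * h) + u₁) * k ^ 10 + v₀ * k ^ 5 : ℤ) : ℝ) + 1)
    / (2 * k ^ 11 * q) + e, (continuous_lift _).measurable hopen.measurableSet, ?_, ?_, ?_, ?_⟩
  · intro x hx
    obtain ⟨u₂, u₃, u₄, v₁, v₂, h2, h3, h4, hv1, hv2, a1, a2, a3, a4⟩ := mem_openPattern.mp hx
    exact mem_segmentHull H h2 h3 hv1 (hsquare (mem_digitSquare_of_near H
      (rotationMargin_nonneg n k) h4 hv2 a1.le a2.le a3.le a4.le (by norm_num) rfl))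
  · rw [hD, (measurePreserving_lift_inv hi.measurePreserving).measure_preimage
      hopen.measurableSet.nullMeasurableSet]
    exact volume_openPattern_ge H (rotationMargin_nonneg n k) (rotationMargin_le H) u₀ v₀ u₁
  · intro x hx
    obtain ⟨u₂, u₃, u₄, v₁, v₂, h2, h3, h4, hv1, hv2, hx⟩ := mem_openPattern.mp hx
    obtain ⟨t, ht, hti⟩ := hdual h2
    have hu : u₂ * k ^ 5 + u₃ < k ^ 10 := by
      have e10 : k ^ 10 = k ^ 5 * k ^ 5 := by ring
      have := Nat.mul_le_mul_right (k ^ 5) h2.2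
      have := h3.2
      rw [e10]
      linarith
    obtain ⟨w, hw⟩ := hi.cell (k * u₀ + u₁) (u₂ * k ^ 5 + u₃) (v₀ * (2 * k ^ 6 * q) + v₁) u₄ v₂ hu
      h4.1 h4.2 hv2.1 hv2.2
    rw [column_emod hu1] at hw
    set β : ℝ := ((u₁ : ℤ) : ℝ) * Real.pi / k with hβ
    have eβ : ((-u₁ : ℤ) : ℝ) * Real.pi / k = -β := by
      rw [hβ]
      push_cast
      ring
    set τ : ℝ × ℝ := (m * α - ((u₂ : ℝ) - v₀) / (2 * k ^ 6 * q), ((t : ℝ) - v₀) / k ^ 5) with hτ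
    refine ⟨τ - rotate (-β) w, ?_⟩
    have hnear := ((isOpen_openBox _ _ _ _ _).preimage (continuous_lift i⁻¹)).mem_nhds hx
    filter_upwards [hnear] with y hy
    obtain ⟨a1, a2, a3, a4⟩ := hy
    have hyq := hsquare (mem_digitSquare_of_near H (rotationMargin_nonneg n k) h4 hv2 a1.le a2.le
      a3.le a4.le (by norm_num) rfl)
    obtain ⟨hly, -⟩ := lift_of_even H hn hk hq hφt hi hm hu0 hu1 ht h2 h3 hv0 hv1 hτ hyq
    have hcell : lift i⁻¹ y ∈ gridCell n k q (k * u₀ + u₁) (u₂ * k ^ 5 + u₃)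
        (v₀ * (2 * k ^ 6 * q) + v₁) u₄ v₂ := by
      apply mem_gridCell H
      · push_cast
        linarith
      · push_cast
        linarith
      · push_cast
        linarith
      · push_cast
        linarith
    have hrot := hw _ hcell
    rw [lift_lift_inv] at hrot
    have hinv : lift i⁻¹ y = rotate (-β) (y - w) := by
      have : y - w = rotate β (lift i⁻¹ y) := sub_eq_of_eq_add hrot
      rw [this, rotate_neg_rotate]
    rw [hf, hly, hinv, eβ, rotate_sub]
    abel
  · intro x hx
    obtain ⟨u₂, u₃, v₁, h2, h3, hv1, hsq⟩ := exists_mem_digitSquare H hx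
    obtain ⟨t, ht, hti⟩ := hdual h2
    have hxq := hsq x (by norm_num) rfl
    obtain ⟨hlx, hmem⟩ := lift_of_even H hn hk hq hφt hi hm hu0 hu1 ht h2 h3 hv0 hv1 rfl hxq
    rw [← hf] at hlx
    rw [← hlx] at hmem
    exact image_bounds H hti h3 hv1 hmem

theorem segmentIndex_lt {k u₀ l : ℕ} (hl : l < k) : segmentIndex k u₀ l < k := by
  unfold segmentIndex
  split_ifs
  · exact Nat.mod_lt _ (by omega)
  · exact hl

theorem neg_segmentIndex_modEq {k u₀ l : ℕ} (hl : l < k) (hu0 : Even u₀) :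
    (-(segmentIndex k u₀ l : ℤ)) ≡ l [ZMOD k] := by
  rw [segmentIndex, if_pos hu0]
  push_cast [hl.le]
  have h1 : ((k : ℤ) - l) % k ≡ (k : ℤ) - l [ZMOD k] := Int.mod_modEq _ _
  have h2 : -((k : ℤ) - l) ≡ l [ZMOD k] := by
    rw [Int.modEq_iff_dvd]
    exact ⟨1, by ring⟩
  exact h1.neg.trans h2

end Main

end TorusAbC

/-! ### Assembly of the distribution property -/

theorem lemma7 (n k q q' : ℕ) (p' : ℤ)
    (hn : 0 < n) (hk : 0 < k) (hq : 0 < q)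
    (hkn : 20 * n ^ 5 ≤ k)
    (hqk : 2 * (k : ℝ) < (q : ℝ) ^ (1 / 4 : ℝ))
    (hq' : 2 * k ^ 12 * q ^ 2 < q')
    (hp' : IsCoprime p' (q' : ℤ))
    (φt i : TorusDiff)
    (hφt : IsInnerRotationA n k q φt) (hi : IsInnerRotationB n k q i)
    (φ Φ : TorusDiff)
    (hφ : φ = conjugation hn hk hq hφt hi)
    (hΦ : Φ = φ * rot ((p' : ℝ) / q') ^ mixingTime q p' q' * φ⁻¹)
    (u₀ v₀ : ℕ) (hu₀ : u₀ < 2 * q) (hv₀ : 1 ≤ v₀ ∧ v₀ + 2 ≤ k ^ 5) :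
    IsDistributing (1 / (2 * (k : ℝ) ^ 5 * q)) (1 / (k : ℝ) ^ 4)
      (1 / (n : ℝ) ^ 5) (1 / (n : ℝ) ^ 5) k Φ
      (fun l => tildeSegment n k q u₀ v₀ (segmentIndex k u₀ l)) := by
  obtain ⟨h, e, he, hm⟩ := mixingTime_spec hq (by omega) hp'
  have H := scale_of_lt hn hk hq hkn hqk hq' he
  rw [hφ] at hΦ
  have hf : MeasurePreserving (lift Φ) volume volume := by
    rw [hΦ]
    exact measurePreserving_conj_rot (measurePreserving_conjugation hn hk hq hφt hi) _ _
  have hz : 0 ≤ imageWidth k q * imageHeight k q :=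
    (mul_pos (imageWidth_pos H) (distribution_estimates H).1).le
  have model : ∀ l < k, ∃ b : ℤ, b ≡ l [ZMOD k] ∧ ∃ (D : Set (ℝ × ℝ)) (c : ℝ), MeasurableSet D ∧
      D ⊆ segmentHull k q u₀ v₀ (segmentIndex k u₀ l) ∧
      ENNReal.ofReal ((1 - (4 / (k : ℝ) ^ 5 + 2 / k ^ 10)) * (imageWidth k q * imageHeight k q))
        ≤ volume D ∧
      (∀ x ∈ D, ∃ w, ∀ᶠ y in nhds x, lift Φ y = rotate ((b : ℝ) * Real.pi / k) y + w) ∧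
      ∀ x ∈ planeSegment n k q u₀ v₀ (segmentIndex k u₀ l),
        (lift Φ x).1 ∈ Icc c (c + imageWidth k q) ∧ (lift Φ x).2 ∈ imageRows k q := by
    intro l hl
    by_cases hu : Even u₀
    · exact ⟨-(segmentIndex k u₀ l : ℤ), neg_segmentIndex_modEq hl hu,
        exists_model_of_even H hn hk hq hφt hi hm hu (segmentIndex_lt hl) hv₀ hΦ⟩
    · refine ⟨segmentIndex k u₀ l, ?_,
        exists_model_of_odd H hn hk hq hφt hi hm hu (segmentIndex_lt hl) hv₀ hΦ⟩
      rw [segmentIndex, if_neg hu]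
  have fibers : ∀ l : ℕ, ∃ J : Set UnitAddCircle, l < k → ∃ b : ℤ, b ≡ l [ZMOD k] ∧
      DistributesSegment n k q Φ (tildeSegment n k q u₀ v₀ (segmentIndex k u₀ l)) b J := by
    intro l
    by_cases hl : l < k
    · obtain ⟨b, hb, D, c, hDm, hDZ, hDv, hloc, himg⟩ := model l hl
      obtain ⟨J, hJ⟩ := exists_distributed_fibers H hf
        (planeSegment_subset_unitSquare H hu₀ (segmentIndex_lt hl) hv₀)
        (measurableSet_planeSegment H u₀ v₀ _) hDm hloc himg
        (volume_inter_ge hDm (planeSegment_subset_hull H u₀ v₀ _) hDZ hz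
          (volume_segmentHull_le H u₀ v₀ _) (volume_planeSegment_ge H u₀ v₀ _) hDv)
      rw [← tildeSegment_eq H] at hJ
      exact ⟨J, fun _ => ⟨b, hb, hJ⟩⟩
    · exact ⟨∅, fun h => absurd h hl⟩
  choose J hJ using fibers
  refine ⟨J, fun l hl => ?_, fun l hl => ?_, fun l hl => ?_, fun j hj t ht => ?_⟩
  · obtain ⟨b, hb, h1, -⟩ := hJ l hl
    exact h1
  · obtain ⟨b, hb, -, h2, -⟩ := hJ l hl
    exact h2
  · obtain ⟨b, hb, -, -, h3, -⟩ := hJ l hl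
    exact h3
  -- Adding `k` before subtracting `j < k` keeps the natural subtraction from truncating.
  · have hlk : (t + k - j) % k < k := Nat.mod_lt _ hk
    have hmod : t ≡ (t + k - j) % k + j [MOD k] := by
      have h1 : (t + k - j) % k + j ≡ t + k - j + j [MOD k] := (Nat.mod_modEq _ _).add_right j
      rw [Nat.sub_add_cancel (by omega)] at h1
      exact (h1.trans (Nat.add_mod_right t k)).symm
    refine ⟨(t + k - j) % k, hlk, hmod, fun l' hl' hl'm => ?_, ?_⟩
    · have h1 := hl'm.symm.trans hmod
      exact (Nat.ModEq.add_right_cancel' j h1).eq_of_lt_of_lt hl' hlk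
    · obtain ⟨b, hb, -, -, -, h4⟩ := hJ _ hlk
      refine h4 j t ?_
      have h1 : (t : ℤ) ≡ (((t + k - j) % k : ℕ) : ℤ) + j [ZMOD k] := by
        exact_mod_cast (Int.natCast_modEq_iff.mpr hmod)
      exact h1.trans (hb.symm.add_right _)
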